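/- Let $K_*=(K_m)_{m\ge 0}$ be an extended N-series, i.e. a descending series of groups $K_0\ge K_1\ge K_2\ge\cdots$ with $[K_m,K_n]\le K_{m+n}$ for all $m,n\ge 0$. For $m\ge 1$ let $I_m=\ker(\mathbb{Q}[K_0]\to\mathbb{Q}[K_0/K_m])$. Let $J_0=\mathbb{Q}[K_0]$ and, for $m\ge1$, $J_m=\sum I_{m_1}\cdots I_{m_p}$, the sum being over all $p\ge1$ and $m_1,\dots,m_p\ge 1$ with $m_1+\cdots+m_p\ge m$. This makes $\mathbb{Q}[K_0]$ a filtered Hopf algebra. Let $\widehat{\mathbb{Q}[K_*]}=\varprojlim_k \mathbb{Q}[K_0]/J_k$ and $\widehat{\mathrm{gr}}(J_*)=\prod_{k\ge0}J_k/J_{k+1}$, with their induced complete Hopf algebra structures. Call $K_*$ *formal* if there is an isomorphism of complete Hopf algebras $\widehat{\mathbb{Q}[K_*]}\cong\widehat{\mathrm{gr}}(J_*)$ (a filtration-preserving algebra isomorphism, with filtration-preserving inverse, compatible with the comultiplications and counits) whose associated graded map is the identity of $\bigoplus_k J_k/J_{k+1}$. Let $\mathrm{gr}_+^{\mathbb{Q}}(K_*)=\bigoplus_{m\ge1}(K_m/K_{m+1})\otimes\mathbb{Q}$,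 the graded Lie $\mathbb{Q}$-algebra whose bracket is induced by commutators, on which the group $K_0/K_1$ acts by conjugation. Let $U$ be the crossed product $U(\mathrm{gr}_+^{\mathbb{Q}}(K_*))\,\sharp\,\mathbb{Q}[K_0/K_1]$ of the universal enveloping algebra of $\mathrm{gr}_+^{\mathbb{Q}}(K_*)$ with the group algebra of $K_0/K_1$; it is a graded Hopf algebra, in which the elements of $K_0/K_1$ are group-like of degree $0$ and the elements of $(K_m/K_{m+1})\otimes\mathbb{Q}$ are primitive of degree $m$. Let $\hat U$ be its degree-completion. An *expansion* of $K_*$ is a homomorphism $\theta:K_0\to\hat U$ (into the multiplicative monoid of $\hat U$) which, for every $i\ge0$, maps each $x\in K_i$ to a group-like element of the form $$\theta(x)=\begin{cases}1+(xK_{i+1})+(\deg>i)&\text{if } i>0,\\ (xK_1)+(\deg>0)&\text{if } i=0.\end{cases}$$ Then $K_*$ is formal if and only if $K_*$ has an expansion. -/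

import Mathlib

open scoped TensorProduct commutatorElement

noncomputable section

/-! ### Filtered Hopf algebras, their completions and associated graded -/

/-- The subspace `M ⊗ N` of `A ⊗ A`, for subspaces `M, N` of `A`. -/
def tensorSub {A : Type*} [Ring A] [Algebra ℚ A] (M N : Submodule ℚ A) :
    Submodule ℚ (A ⊗[ℚ] A) :=
  Submodule.map₂ (TensorProduct.mk ℚ A A) M N

/-- A filtered Hopf algebra structure on the Hopf algebra `A` over `ℚ`: a descending filtration
`A = J₀ ⊇ J₁ ⊇ ⋯` with `J_m J_n ⊆ J_{m+n}`, `Δ(J_m) ⊆ ∑_{i+j=m} J_i ⊗ J_j` and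
`ε(J_m) = 0` for `m ≥ 1`, `S(J_m) ⊆ J_m`. -/
structure HopfFiltration (A : Type*) [Ring A] [HopfAlgebra ℚ A] where
  /-- the subspace `J_m` -/
  J : ℕ → Submodule ℚ A
  J_zero : J 0 = ⊤
  antitone : Antitone J
  mul_le : ∀ m n, J m * J n ≤ J (m + n)
  comul_mem : ∀ m, ∀ x ∈ J m, Coalgebra.comul (R := ℚ) x ∈
    ⨆ p : {p : ℕ × ℕ // p.1 + p.2 = m}, tensorSub (J p.1.1) (J p.1.2)
  counit_eq_zero : ∀ m, 1 ≤ m → ∀ x ∈ J m, Coalgebra.counit (R := ℚ) x = 0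
  antipode_mem : ∀ m, ∀ x ∈ J m, HopfAlgebra.antipode ℚ x ∈ J m

/-- The `ℚ`-linear map on `A / I` induced by a `ℚ`-linear map on `A` which vanishes on `I`. -/
def idealLift {A : Type*} [Ring A] [Algebra ℚ A] {M : Type*} [AddCommGroup M] [Module ℚ M]
    (I : Ideal A) (f : A →ₗ[ℚ] M) (h : ∀ x ∈ I, f x = 0) : (A ⧸ I) →ₗ[ℚ] M :=
  ((I.restrictScalars ℚ).liftQ f h) ∘ₗ
    (Submodule.Quotient.restrictScalarsEquiv ℚ I).symm.toLinearMap

namespace HopfFiltration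

variable {A : Type*} [Ring A] [HopfAlgebra ℚ A] (F : HopfFiltration A)

theorem mul_mem {m n : ℕ} {x y : A} (hx : x ∈ F.J m) (hy : y ∈ F.J n) : x * y ∈ F.J (m + n) :=
  F.mul_le m n (Submodule.mul_mem_mul hx hy)

theorem mem_zero (x : A) : x ∈ F.J 0 := by rw [F.J_zero]; trivial

/-- `J_m` as an ideal of `A`. -/
def ideal (m : ℕ) : Ideal A where
  carrier := F.J m
  zero_mem' := zero_mem _
  add_mem' hx hy := add_mem hx hy
  smul_mem' a x hx := by
    have := F.mul_mem (F.mem_zero a) hx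
    rwa [zero_add] at this

theorem mem_ideal {m : ℕ} {x : A} : x ∈ F.ideal m ↔ x ∈ F.J m := Iff.rfl

instance (m : ℕ) : (F.ideal m).IsTwoSided where
  mul_mem_of_left a hx := F.mul_mem hx (F.mem_zero a)

theorem ideal_le {m n : ℕ} (h : m ≤ n) : F.ideal n ≤ F.ideal m := F.antitone h

/-- The projection `A → A / J_m`. -/
def proj (m : ℕ) : A →ₗ[ℚ] A ⧸ F.ideal m := (Ideal.Quotient.mkₐ ℚ (F.ideal m)).toLinearMap

theorem proj_eq_zero {m : ℕ} {x : A} : F.proj m x = 0 ↔ x ∈ F.J m :=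
  Ideal.Quotient.eq_zero_iff_mem

/-! #### The completion -/

/-- The completion `lim_k A / J_k`. -/
def Completion : Subalgebra ℚ (∀ k, A ⧸ F.ideal k) where
  carrier := {x | ∀ (k l : ℕ) (h : k ≤ l), Ideal.Quotient.factor (F.ideal_le h) (x l) = x k}
  add_mem' hx hy k l h := by simp only [Pi.add_apply, map_add, hx k l h, hy k l h]
  mul_mem' hx hy k l h := by simp only [Pi.mul_apply, map_mul, hx k l h, hy k l h]
  algebraMap_mem' q k l h := rfl

/-- The canonical map `A → lim_k A / J_k`. -/
def ofA : A →ₐ[ℚ] F.Completion :=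
  AlgHom.codRestrict (AlgHom.pi fun k => Ideal.Quotient.mkₐ ℚ (F.ideal k)) F.Completion
    (fun _ _ _ _ => rfl)

/-- The filtration `Ĵ_m = ker (lim_k A / J_k → A / J_m)` of the completion. -/
def hatJ (m : ℕ) : Submodule ℚ F.Completion where
  carrier := {x | x.1 m = 0}
  zero_mem' := rfl
  add_mem' {x y} hx hy := by
    change x.1 m + y.1 m = 0
    rw [show x.1 m = 0 from hx, show y.1 m = 0 from hy, add_zero]
  smul_mem' q x hx := by
    change q • x.1 m = 0
    rw [show x.1 m = 0 from hx, smul_zero]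

/-- `Δ(J_m) ⊆ J_k ⊗ A + A ⊗ J_l` for `m ≥ k + l - 1`: the projection of `Δ(x)` to
`A/J_k ⊗ A/J_l` vanishes. -/
theorem map_proj_comul {k l m : ℕ} (h : k + l ≤ m + 1) {x : A} (hx : x ∈ F.J m) :
    TensorProduct.map (F.proj k) (F.proj l) (Coalgebra.comul (R := ℚ) x) = 0 := by
  have : (⨆ p : {p : ℕ × ℕ // p.1 + p.2 = m}, tensorSub (F.J p.1.1) (F.J p.1.2)) ≤
      LinearMap.ker (TensorProduct.map (F.proj k) (F.proj l)) := by
    refine iSup_le ?_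
    rintro ⟨⟨i, j⟩, hij⟩
    refine Submodule.map₂_le.2 ?_
    intro a ha b hb
    rw [LinearMap.mem_ker, TensorProduct.mk_apply, TensorProduct.map_tmul]
    dsimp only at ha hb hij
    by_cases hk : k ≤ i
    · rw [F.proj_eq_zero.2 (F.antitone hk ha), TensorProduct.zero_tmul]
    · have hl : l ≤ j := by omega
      rw [F.proj_eq_zero.2 (F.antitone hl hb), TensorProduct.tmul_zero]
  exact this (F.comul_mem m x hx)

/-- The map `A / J_{k+l} → A / J_k ⊗ A / J_l` induced by the comultiplication. -/
def comulLevel (k l : ℕ) : A ⧸ F.ideal (k + l) →ₗ[ℚ] (A ⧸ F.ideal k) ⊗[ℚ] (A ⧸ F.ideal l) :=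
  idealLift _ (TensorProduct.map (F.proj k) (F.proj l) ∘ₗ Coalgebra.comul)
    (fun _ hx => F.map_proj_comul (Nat.le_succ _) hx)

/-- The comultiplication of the completion, with values in the completed tensor product
`lim_{k,l} A / J_k ⊗ A / J_l`: the component of index `(k, l)` of `Δ(x)`. -/
def complComul (k l : ℕ) : F.Completion →ₗ[ℚ] (A ⧸ F.ideal k) ⊗[ℚ] (A ⧸ F.ideal l) where
  toFun x := F.comulLevel k l (x.1 (k + l))
  map_add' x y := map_add (F.comulLevel k l) (x.1 (k + l)) (y.1 (k + l))
  map_smul' q x := map_smul (F.comulLevel k l) q (x.1 (k + l))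

/-- The counit of the completion. -/
def complCounit : F.Completion →ₗ[ℚ] ℚ where
  toFun x := idealLift (F.ideal 1) Coalgebra.counit (F.counit_eq_zero 1 le_rfl) (x.1 1)
  map_add' x y := map_add (idealLift _ _ _) (x.1 1) (y.1 1)
  map_smul' q x := map_smul (idealLift _ _ _) q (x.1 1)

/-! #### The associated graded -/

/-- The degree `k` part `J_k / J_{k+1}` of the associated graded. -/
abbrev Gr (k : ℕ) : Type _ := F.J k ⧸ (F.J (k + 1)).submoduleOf (F.J k)

/-- The class of `a ∈ J_k` in `J_k / J_{k+1}`. -/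
def grMk (k : ℕ) : F.J k →ₗ[ℚ] F.Gr k := Submodule.mkQ _

theorem mem_submoduleOf {k l : ℕ} {a : F.J l} :
    a ∈ (F.J k).submoduleOf (F.J l) ↔ (a : A) ∈ F.J k := Iff.rfl

theorem grMk_eq_zero {k : ℕ} {a : F.J k} : F.grMk k a = 0 ↔ (a : A) ∈ F.J (k + 1) := by
  unfold grMk
  rw [Submodule.mkQ_apply, Submodule.Quotient.mk_eq_zero]
  exact F.mem_submoduleOf

/-- The multiplication `J_i × J_j → J_n`, `i + j = n`. -/
def mulJ (i j n : ℕ) (h : i + j = n) : F.J i →ₗ[ℚ] F.J j →ₗ[ℚ] F.J n :=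
  LinearMap.mk₂ ℚ (fun a b => ⟨(a : A) * b, h ▸ F.mul_mem a.2 b.2⟩)
    (fun a a' b => Subtype.ext (add_mul (a : A) a' b))
    (fun q a b => Subtype.ext (smul_mul_assoc q (a : A) b))
    (fun a b b' => Subtype.ext (mul_add (a : A) b b'))
    (fun q a b => Subtype.ext (mul_smul_comm q (a : A) b))

/-- The product `J_i/J_{i+1} × J_j/J_{j+1} → J_n/J_{n+1}`, `i + j = n`, of the associated
graded. -/
def grMul (i j n : ℕ) (h : i + j = n) : F.Gr i →ₗ[ℚ] F.Gr j →ₗ[ℚ] F.Gr n :=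
  Submodule.liftQ _
    (LinearMap.flip (Submodule.liftQ _ ((F.mulJ i j n h).compr₂ (F.grMk n)).flip
      (by
        intro b hb
        refine LinearMap.mem_ker.2 (LinearMap.ext fun a => F.grMk_eq_zero.2 ?_)
        have e : n + 1 = i + (j + 1) := by omega
        rw [e]
        exact F.mul_mem a.2 (F.mem_submoduleOf.1 hb))))
    (by
      intro a ha
      refine LinearMap.mem_ker.2 (LinearMap.ext fun b => ?_)
      obtain ⟨b, rfl⟩ := Submodule.mkQ_surjective _ b
      refine F.grMk_eq_zero.2 ?_
      have e : n + 1 = i + 1 + j := by omega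
      rw [e]
      exact F.mul_mem (F.mem_submoduleOf.1 ha) b.2)

theorem grMul_mk (i j n : ℕ) (h : i + j = n) (a : F.J i) (b : F.J j) :
    F.grMul i j n h (F.grMk i a) (F.grMk j b) = F.grMk n (F.mulJ i j n h a b) := rfl

/-- The degree-completion `∏_k J_k / J_{k+1}` of the associated graded. -/
def GrHat : Type _ := ∀ k, F.Gr k

instance : AddCommGroup F.GrHat := inferInstanceAs (AddCommGroup (∀ k, F.Gr k))

instance : Module ℚ F.GrHat := inferInstanceAs (Module ℚ (∀ k, F.Gr k))

instance : Mul F.GrHat where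
  mul x y n := ∑ p : Finset.HasAntidiagonal.antidiagonal n,
    F.grMul p.1.1 p.1.2 n (Finset.HasAntidiagonal.mem_antidiagonal.1 p.2) (x p.1.1) (y p.1.2)

instance : One F.GrHat where
  one := Pi.single 0 (F.grMk 0 ⟨1, F.mem_zero 1⟩)

theorem grHat_mul_apply (x y : F.GrHat) (n : ℕ) :
    (x * y) n = ∑ p : Finset.HasAntidiagonal.antidiagonal n,
      F.grMul p.1.1 p.1.2 n (Finset.HasAntidiagonal.mem_antidiagonal.1 p.2)
        (x p.1.1) (y p.1.2) := rfl

/-- The element of `∏_k J_k / J_{k+1}` represented by a power series whose `k`-th coefficient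
lies in `J_k`. -/
def ofSeries (φ : PowerSeries A) (h : ∀ k, PowerSeries.coeff k φ ∈ F.J k) : F.GrHat :=
  fun k => F.grMk k ⟨PowerSeries.coeff k φ, h k⟩

theorem exists_ofSeries (x : F.GrHat) : ∃ (φ : PowerSeries A)
    (h : ∀ k, PowerSeries.coeff k φ ∈ F.J k), x = F.ofSeries φ h := by
  have : ∀ k, ∃ a : F.J k, F.grMk k a = x k := fun k => Submodule.mkQ_surjective _ (x k)
  choose a ha using this
  have hm : ∀ k, PowerSeries.coeff k (PowerSeries.mk fun k => (a k : A)) ∈ F.J k := by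
    intro k
    rw [PowerSeries.coeff_mk]; exact (a k).2
  refine ⟨PowerSeries.mk fun k => (a k : A), hm, ?_⟩
  funext k
  rw [← ha k]
  unfold ofSeries
  congr 1
  ext
  exact (PowerSeries.coeff_mk k (fun k => (a k : A))).symm

theorem ofSeries_congr {φ ψ : PowerSeries A} (hφ : ∀ k, PowerSeries.coeff k φ ∈ F.J k)
    (hψ : ∀ k, PowerSeries.coeff k ψ ∈ F.J k) (h : φ = ψ) :
    F.ofSeries φ hφ = F.ofSeries ψ hψ := by subst h; rfl

theorem series_mul {φ ψ : PowerSeries A} (hφ : ∀ k, PowerSeries.coeff k φ ∈ F.J k)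
    (hψ : ∀ k, PowerSeries.coeff k ψ ∈ F.J k) (k : ℕ) : PowerSeries.coeff k (φ * ψ) ∈ F.J k := by
  rw [PowerSeries.coeff_mul]
  refine Submodule.sum_mem _ fun p hp => ?_
  rw [← Finset.HasAntidiagonal.mem_antidiagonal.1 hp]
  exact F.mul_mem (hφ p.1) (hψ p.2)

theorem ofSeries_mul {φ ψ : PowerSeries A} (hφ : ∀ k, PowerSeries.coeff k φ ∈ F.J k)
    (hψ : ∀ k, PowerSeries.coeff k ψ ∈ F.J k) :
    F.ofSeries φ hφ * F.ofSeries ψ hψ = F.ofSeries (φ * ψ) (F.series_mul hφ hψ) := by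
  funext n
  rw [grHat_mul_apply]
  unfold ofSeries
  simp only [grMul_mk]
  rw [← map_sum]
  congr 1
  ext
  rw [AddSubmonoidClass.coe_finsetSum]
  refine Eq.trans ?_ (PowerSeries.coeff_mul n φ ψ).symm
  exact Finset.sum_coe_sort (Finset.HasAntidiagonal.antidiagonal n)
    (fun p => PowerSeries.coeff p.1 φ * PowerSeries.coeff p.2 ψ)

theorem series_add {φ ψ : PowerSeries A} (hφ : ∀ k, PowerSeries.coeff k φ ∈ F.J k)
    (hψ : ∀ k, PowerSeries.coeff k ψ ∈ F.J k) (k : ℕ) : PowerSeries.coeff k (φ + ψ) ∈ F.J k := by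
  rw [map_add]; exact add_mem (hφ k) (hψ k)

theorem ofSeries_add {φ ψ : PowerSeries A} (hφ : ∀ k, PowerSeries.coeff k φ ∈ F.J k)
    (hψ : ∀ k, PowerSeries.coeff k ψ ∈ F.J k) :
    F.ofSeries φ hφ + F.ofSeries ψ hψ = F.ofSeries (φ + ψ) (F.series_add hφ hψ) := by
  funext n
  change F.grMk n _ + F.grMk n _ = F.grMk n _
  rw [← map_add]
  congr 1

theorem series_smul (q : ℚ) {φ : PowerSeries A} (hφ : ∀ k, PowerSeries.coeff k φ ∈ F.J k)
    (k : ℕ) : PowerSeries.coeff k (q • φ) ∈ F.J k := by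
  rw [PowerSeries.coeff_smul]; exact Submodule.smul_mem _ _ (hφ k)

theorem ofSeries_smul (q : ℚ) {φ : PowerSeries A}
    (hφ : ∀ k, PowerSeries.coeff k φ ∈ F.J k) :
    q • F.ofSeries φ hφ = F.ofSeries (q • φ) (F.series_smul q hφ) := by
  funext n
  change q • F.grMk n _ = F.grMk n _
  rw [← map_smul]
  congr 1

theorem series_one (k : ℕ) : PowerSeries.coeff k (1 : PowerSeries A) ∈ F.J k := by
  rw [PowerSeries.coeff_one]
  split_ifs with h
  · subst h; exact F.mem_zero 1
  · exact zero_mem _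

theorem ofSeries_one : F.ofSeries 1 F.series_one = 1 := by
  funext n
  change F.grMk n _ = (Pi.single 0 (F.grMk 0 ⟨1, F.mem_zero 1⟩) : ∀ k, F.Gr k) n
  by_cases h : n = 0
  · subst h
    rw [Pi.single_eq_same]
    congr 1
    ext
    simp
  · rw [Pi.single_eq_of_ne h]
    refine F.grMk_eq_zero.2 ?_
    simp [PowerSeries.coeff_one, h]

/-- The ring structure of the degree-completion of the associated graded. -/
instance : Ring F.GrHat :=
  { (inferInstance : AddCommGroup F.GrHat) with
    mul := (· * ·)
    one := 1
    left_distrib := by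
      intro x y z
      obtain ⟨φ, hφ, rfl⟩ := F.exists_ofSeries x
      obtain ⟨ψ, hψ, rfl⟩ := F.exists_ofSeries y
      obtain ⟨χ, hχ, rfl⟩ := F.exists_ofSeries z
      change F.ofSeries φ hφ * (F.ofSeries ψ hψ + F.ofSeries χ hχ) =
        F.ofSeries φ hφ * F.ofSeries ψ hψ + F.ofSeries φ hφ * F.ofSeries χ hχ
      simp only [ofSeries_mul, ofSeries_add]
      exact F.ofSeries_congr _ _ (mul_add _ _ _)
    right_distrib := by
      intro x y z
      obtain ⟨φ, hφ, rfl⟩ := F.exists_ofSeries x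
      obtain ⟨ψ, hψ, rfl⟩ := F.exists_ofSeries y
      obtain ⟨χ, hχ, rfl⟩ := F.exists_ofSeries z
      change (F.ofSeries φ hφ + F.ofSeries ψ hψ) * F.ofSeries χ hχ =
        F.ofSeries φ hφ * F.ofSeries χ hχ + F.ofSeries ψ hψ * F.ofSeries χ hχ
      simp only [ofSeries_mul, ofSeries_add]
      exact F.ofSeries_congr _ _ (add_mul _ _ _)
    zero_mul := by
      intro x
      funext n
      change (∑ p : Finset.HasAntidiagonal.antidiagonal n, F.grMul p.1.1 p.1.2 n _ 0 (x p.1.2)) = 0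
      simp only [map_zero, LinearMap.zero_apply, Finset.sum_const_zero]
    mul_zero := by
      intro x
      funext n
      change (∑ p : Finset.HasAntidiagonal.antidiagonal n, F.grMul p.1.1 p.1.2 n _ (x p.1.1) 0) = 0
      simp only [map_zero, Finset.sum_const_zero]
    mul_assoc := by
      intro x y z
      obtain ⟨φ, hφ, rfl⟩ := F.exists_ofSeries x
      obtain ⟨ψ, hψ, rfl⟩ := F.exists_ofSeries y
      obtain ⟨χ, hχ, rfl⟩ := F.exists_ofSeries z
      simp only [ofSeries_mul]
      exact F.ofSeries_congr _ _ (mul_assoc _ _ _)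
    one_mul := by
      intro x
      obtain ⟨φ, hφ, rfl⟩ := F.exists_ofSeries x
      rw [← ofSeries_one, ofSeries_mul]
      exact F.ofSeries_congr _ _ (one_mul _)
    mul_one := by
      intro x
      obtain ⟨φ, hφ, rfl⟩ := F.exists_ofSeries x
      rw [← ofSeries_one, ofSeries_mul]
      exact F.ofSeries_congr _ _ (mul_one _) }

instance : Algebra ℚ F.GrHat :=
  Algebra.ofModule
    (by
      intro q x y
      obtain ⟨φ, hφ, rfl⟩ := F.exists_ofSeries x
      obtain ⟨ψ, hψ, rfl⟩ := F.exists_ofSeries y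
      simp only [ofSeries_smul, ofSeries_mul]
      exact F.ofSeries_congr _ _ (smul_mul_assoc q φ ψ))
    (by
      intro q x y
      obtain ⟨φ, hφ, rfl⟩ := F.exists_ofSeries x
      obtain ⟨ψ, hψ, rfl⟩ := F.exists_ofSeries y
      simp only [ofSeries_smul, ofSeries_mul]
      exact F.ofSeries_congr _ _ (mul_smul_comm q φ ψ))

/-- The degree `k` component, as a linear map. -/
def grComp (k : ℕ) : F.GrHat →ₗ[ℚ] F.Gr k where
  toFun x := x k
  map_add' _ _ := rfl
  map_smul' _ _ := rfl

/-- The filtration `∏_{k ≥ m} J_k / J_{k+1}` of the degree-completion. -/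
def grHatGE (m : ℕ) : Submodule ℚ F.GrHat where
  carrier := {x | ∀ k < m, F.grComp k x = 0}
  zero_mem' k _ := map_zero _
  add_mem' hx hy k hk := by rw [map_add, hx k hk, hy k hk, add_zero]
  smul_mem' q x hx k hk := by rw [map_smul, hx k hk, smul_zero]

/-- The inclusion `J_k / J_{k+1} → A / J_{k+1}`. -/
def grIncl (k : ℕ) : F.Gr k →ₗ[ℚ] A ⧸ F.ideal (k + 1) :=
  Submodule.liftQ _ (F.proj (k + 1) ∘ₗ (F.J k).subtype)
    (fun _ ha => F.proj_eq_zero.2 (F.mem_submoduleOf.1 ha))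

theorem grIncl_mk (k : ℕ) (a : F.J k) : F.grIncl k (F.grMk k a) = F.proj (k + 1) a := rfl

theorem grIncl_injective (k : ℕ) : Function.Injective (F.grIncl k) := by
  rw [injective_iff_map_eq_zero]
  intro x hx
  obtain ⟨a, rfl⟩ := Submodule.mkQ_surjective _ x
  exact F.grMk_eq_zero.2 (F.proj_eq_zero.1 hx)

/-- The inclusion `J_i/J_{i+1} ⊗ J_j/J_{j+1} → A/J_{i+1} ⊗ A/J_{j+1}`. -/
def grInclTensor (i j : ℕ) :
    F.Gr i ⊗[ℚ] F.Gr j →ₗ[ℚ] (A ⧸ F.ideal (i + 1)) ⊗[ℚ] (A ⧸ F.ideal (j + 1)) :=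
  TensorProduct.map (F.grIncl i) (F.grIncl j)

theorem grInclTensor_injective (i j : ℕ) : Function.Injective (F.grInclTensor i j) :=
  TensorProduct.map_injective_of_flat_flat _ _ (F.grIncl_injective i) (F.grIncl_injective j)

theorem comul_mem_range (i j : ℕ) (a : F.J (i + j)) :
    TensorProduct.map (F.proj (i + 1)) (F.proj (j + 1)) (Coalgebra.comul (R := ℚ) (a : A)) ∈
      LinearMap.range (F.grInclTensor i j) := by
  have : (⨆ p : {p : ℕ × ℕ // p.1 + p.2 = i + j}, tensorSub (F.J p.1.1) (F.J p.1.2)) ≤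
      (LinearMap.range (F.grInclTensor i j)).comap
        (TensorProduct.map (F.proj (i + 1)) (F.proj (j + 1))) := by
    refine iSup_le ?_
    rintro ⟨⟨k, l⟩, hkl⟩
    refine Submodule.map₂_le.2 ?_
    intro x hx y hy
    rw [Submodule.mem_comap, TensorProduct.mk_apply, TensorProduct.map_tmul]
    dsimp only at hx hy hkl
    by_cases hk : i + 1 ≤ k
    · rw [F.proj_eq_zero.2 (F.antitone hk hx), TensorProduct.zero_tmul]
      exact zero_mem _
    · by_cases hl : j + 1 ≤ l
      · rw [F.proj_eq_zero.2 (F.antitone hl hy), TensorProduct.tmul_zero]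
        exact zero_mem _
      · obtain rfl : k = i := by omega
        obtain rfl : l = j := by omega
        exact ⟨F.grMk k ⟨x, hx⟩ ⊗ₜ F.grMk l ⟨y, hy⟩, rfl⟩
  exact this (F.comul_mem _ _ a.2)

/-- The component `J_n/J_{n+1} → J_i/J_{i+1} ⊗ J_j/J_{j+1}`, `n = i + j`, of the comultiplication
of the associated graded: for `a ∈ J_n`, it maps the class of `a` to the unique element whose image
in `A/J_{i+1} ⊗ A/J_{j+1}` is that of `Δ(a) ∈ ∑_{k+l=n} J_k ⊗ J_l`. -/
def grComul (i j : ℕ) : F.Gr (i + j) →ₗ[ℚ] F.Gr i ⊗[ℚ] F.Gr j :=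
  Submodule.liftQ _
    ((LinearEquiv.ofInjective (F.grInclTensor i j) (F.grInclTensor_injective i j)).symm.toLinearMap ∘ₗ
      LinearMap.codRestrict (LinearMap.range (F.grInclTensor i j))
        (TensorProduct.map (F.proj (i + 1)) (F.proj (j + 1)) ∘ₗ Coalgebra.comul ∘ₗ
          (F.J (i + j)).subtype)
        (F.comul_mem_range i j))
    (by
      intro a ha
      refine LinearMap.mem_ker.2 ?_
      rw [LinearMap.comp_apply, LinearEquiv.coe_coe, LinearEquiv.map_eq_zero_iff]
      ext
      exact F.map_proj_comul (m := i + j + 1) (by omega) (F.mem_submoduleOf.1 ha))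

theorem grInclTensor_grComul (i j : ℕ) (a : F.J (i + j)) :
    F.grInclTensor i j (F.grComul i j (F.grMk (i + j) a)) =
      TensorProduct.map (F.proj (i + 1)) (F.proj (j + 1)) (Coalgebra.comul (R := ℚ) (a : A)) := by
  have := LinearEquiv.apply_symm_apply
    (LinearEquiv.ofInjective (F.grInclTensor i j) (F.grInclTensor_injective i j))
    ⟨_, F.comul_mem_range i j a⟩
  exact congrArg Subtype.val this

/-- The comultiplication of `∏_k J_k/J_{k+1}`, with values in the completed tensor product
`∏_{i,j} J_i/J_{i+1} ⊗ J_j/J_{j+1}`: the component of index `(i, j)` of `Δ(x)`. -/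
def grHatComul (i j : ℕ) : F.GrHat →ₗ[ℚ] F.Gr i ⊗[ℚ] F.Gr j := F.grComul i j ∘ₗ F.grComp (i + j)

/-- The counit of `∏_k J_k/J_{k+1}`: it vanishes in positive degrees. -/
def grHatCounit : F.GrHat →ₗ[ℚ] ℚ :=
  Submodule.liftQ _ ((Coalgebra.counit : A →ₗ[ℚ] ℚ) ∘ₗ (F.J 0).subtype)
    (fun _ ha => F.counit_eq_zero 1 le_rfl _ (F.mem_submoduleOf.1 ha)) ∘ₗ F.grComp 0

/-! #### Formality -/

/-- A linear map `f` from the completion to `∏_k J_k/J_{k+1}` which preserves the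
filtrations induces maps `A/J_{i+1} = lim_k A/J_k / Ĵ_{i+1} → J_i/J_{i+1}`, giving the degree `i`
component of `f`. -/
def levelMap (f : F.Completion →ₗ[ℚ] F.GrHat) (hf : ∀ m, ∀ x ∈ F.hatJ m, f x ∈ F.grHatGE m)
    (i : ℕ) : A ⧸ F.ideal (i + 1) →ₗ[ℚ] F.Gr i :=
  idealLift _ (F.grComp i ∘ₗ f ∘ₗ F.ofA.toLinearMap)
    (fun x hx => hf (i + 1) (F.ofA x) (F.proj_eq_zero.2 hx) i (Nat.lt_succ_self i))

/-- An isomorphism of complete Hopf algebras from the completion `lim_k A/J_k` to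
`∏_k J_k/J_{k+1}`: an isomorphism of algebras which is an isomorphism of filtered spaces and
preserves the comultiplication and the counit (hence the antipode). -/
structure CompleteHopfIso where
  /-- the isomorphism of algebras -/
  toAlgEquiv : F.Completion ≃ₐ[ℚ] F.GrHat
  map_mem : ∀ m, ∀ x ∈ F.hatJ m, toAlgEquiv x ∈ F.grHatGE m
  symm_map_mem : ∀ m, ∀ y ∈ F.grHatGE m, toAlgEquiv.symm y ∈ F.hatJ m
  /-- `(f ⊗ f)(Δ(x)) = Δ(f(x))`, in each component `J_i/J_{i+1} ⊗ J_j/J_{j+1}` -/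
  map_comul : ∀ (i j : ℕ) (x : F.Completion),
    TensorProduct.map (F.levelMap toAlgEquiv.toLinearMap map_mem i)
      (F.levelMap toAlgEquiv.toLinearMap map_mem j) (F.complComul (i + 1) (j + 1) x) =
    F.grHatComul i j (toAlgEquiv x)
  map_counit : ∀ x, F.grHatCounit (toAlgEquiv x) = F.complCounit x

/-- The associated graded of `f` is the identity of `⨁_m J_m/J_{m+1}`, where
`Ĵ_m/Ĵ_{m+1}` is identified with `J_m/J_{m+1}`: if `x ∈ Ĵ_m` is represented by `a ∈ J_m` modulo
`Ĵ_{m+1}`, then the degree `m` component of `f(x)` is the class of `a`. -/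
def CompleteHopfIso.GradedIsId {F : HopfFiltration A} (f : F.CompleteHopfIso) : Prop :=
  ∀ (m : ℕ) (x : F.Completion) (a : F.J m), x - F.ofA a ∈ F.hatJ (m + 1) →
    F.grComp m (f.toAlgEquiv x) = F.grMk m a

/-- There is an isomorphism of complete Hopf algebras from the completion to the
degree-completion of the associated graded, which induces the identity on the associated graded. -/
def IsFormal : Prop := ∃ f : F.CompleteHopfIso, f.GradedIsId

end HopfFiltration

/-! ### Extended N-series -/

/-- An extended N-series `K₀ ≥ K₁ ≥ K₂ ≥ ⋯` of the group `G = K₀`: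
a descending series of subgroups with `[K_m, K_n] ≤ K_{m+n}` for all `m, n ≥ 0`. -/
structure ExtendedNSeries (G : Type*) [Group G] where
  /-- the subgroup `K_m` -/
  sub : ℕ → Subgroup G
  sub_zero : sub 0 = ⊤
  antitone : Antitone sub
  commutator_le : ∀ m n : ℕ, ⁅sub m, sub n⁆ ≤ sub (m + n)

namespace ExtendedNSeries

variable {G : Type*} [Group G] (K : ExtendedNSeries G)

theorem comm_mem {m n : ℕ} {x y : G} (hx : x ∈ K.sub m) (hy : y ∈ K.sub n) :
    ⁅x, y⁆ ∈ K.sub (m + n) :=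
  K.commutator_le m n (Subgroup.commutator_mem_commutator hx hy)

instance normal (m : ℕ) : (K.sub m).Normal where
  conj_mem y hy g := by
    have h := K.comm_mem (m := 0) (x := g) (by rw [K.sub_zero]; trivial) hy
    rw [zero_add] at h
    have := mul_mem h hy
    simpa [commutatorElement_def] using this

/-- In `G / K_d` the images of `x` and `y` commute as soon as `[x, y] ∈ K_d`. -/
theorem commute_mk {d : ℕ} {x y : G} (h : ⁅x, y⁆ ∈ K.sub d) :
    Commute (x : G ⧸ K.sub d) (y : G ⧸ K.sub d) := by
  rw [← commutatorElement_eq_one_iff_commute]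
  have : ((⁅x, y⁆ : G) : G ⧸ K.sub d) = 1 := (QuotientGroup.eq_one_iff _).2 h
  simpa [commutatorElement_def] using this

/-- The group `K_m / K_{m+1}`. -/
abbrev GrMul (m : ℕ) : Type _ := K.sub m ⧸ (K.sub (m + 1)).subgroupOf (K.sub m)

/-- Equality in `K_m / K_{m+1}` can be tested in `G / K_{m+1}`. -/
theorem grMul_mk_eq {m : ℕ} {x y : K.sub m}
    (h : ((x : G) : G ⧸ K.sub (m + 1)) = ((y : G) : G ⧸ K.sub (m + 1))) :
    (QuotientGroup.mk x : K.GrMul m) = QuotientGroup.mk y := by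
  rw [QuotientGroup.eq] at h ⊢
  simpa [Subgroup.mem_subgroupOf] using h

/-- For `m ≥ 1` the group `K_m / K_{m+1}` is abelian. -/
instance grMulCommGroup (m : ℕ+) : CommGroup (K.GrMul m) :=
  { (inferInstance : Group (K.GrMul m)) with
    mul_comm := by
      rintro ⟨x⟩ ⟨y⟩
      refine K.grMul_mk_eq (x := x * y) (y := y * x) ?_
      refine K.commute_mk (K.antitone ?_ (K.comm_mem x.2 y.2))
      have := m.pos
      omega }

/-- The degree `m` part `K_m / K_{m+1}`, `m ≥ 1`, of the associated graded, written additively. -/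
abbrev GrPos (m : ℕ+) : Type _ := Additive (K.GrMul m)

/-- The direct sum `⨁_{m ≥ 1} K_m / K_{m+1}`. -/
def GrLie : Type _ := DirectSum ℕ+ fun m => K.GrPos m

instance : AddCommGroup K.GrLie :=
  inferInstanceAs (AddCommGroup (DirectSum ℕ+ fun m => K.GrPos m))

/-- The inclusion of the degree `m` part. -/
def grOf (m : ℕ+) : K.GrPos m →+ K.GrLie := DirectSum.of (fun m : ℕ+ => K.GrPos m) m

/-- The class of `x ∈ K_m` in `K_m / K_{m+1}`, placed in degree `m`. -/
def cls (m : ℕ+) (x : K.sub m) : K.GrLie :=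
  K.grOf m (Additive.ofMul (QuotientGroup.mk x))

theorem cls_eq {m n : ℕ+} (h : m = n) {x : K.sub m} {y : K.sub n}
    (hxy : ((x : G) : G ⧸ K.sub (m + 1)) = ((y : G) : G ⧸ K.sub (m + 1))) :
    K.cls m x = K.cls n y := by
  subst h
  unfold cls
  rw [K.grMul_mk_eq hxy]

theorem cls_mul (m : ℕ+) (x y : K.sub m) : K.cls m (x * y) = K.cls m x + K.cls m y := by
  unfold cls
  rw [← map_add, ← ofMul_mul]
  rfl

theorem cls_one (m : ℕ+) : K.cls m 1 = 0 := by
  unfold cls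
  exact map_zero (K.grOf m)

theorem grLie_induction {p : K.GrLie → Prop} (zero : p 0)
    (cls : ∀ m x, p (K.cls m x)) (add : ∀ x y, p x → p y → p (x + y)) (x : K.GrLie) : p x := by
  refine DirectSum.induction_on (motive := p) x zero ?_ add
  intro m y
  obtain ⟨z, hz⟩ := QuotientGroup.mk_surjective (Additive.toMul y)
  have := cls m z
  unfold ExtendedNSeries.cls at this
  rw [hz] at this
  exact this

theorem grLie_hom_ext {A : Type*} [AddCommMonoid A] {f g : K.GrLie →+ A}
    (h : ∀ m x, f (K.cls m x) = g (K.cls m x)) : f = g := by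
  ext x
  induction x using K.grLie_induction with
  | zero => rw [map_zero, map_zero]
  | cls m x => exact h m x
  | add x y hx hy => rw [map_add, map_add, hx, hy]

/-- Homomorphisms out of the direct sum, given on each homogeneous part. -/
def grLieLift {A : Type*} [AddCommMonoid A] (f : ∀ m : ℕ+, K.GrPos m →+ A) : K.GrLie →+ A :=
  DirectSum.toAddMonoid f

theorem grLieLift_cls {A : Type*} [AddCommMonoid A] (f : ∀ m : ℕ+, K.GrPos m →+ A) (m : ℕ+)
    (x : K.sub m) :
    K.grLieLift f (K.cls m x) = f m (Additive.ofMul (QuotientGroup.mk x)) :=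
  DirectSum.toAddMonoid_of f m _

/-! #### The Lie bracket -/

theorem commutator_mul_right' {H : Type*} [Group H] (x y z : H) (h : Commute y ⁅x, z⁆) :
    ⁅x, y * z⁆ = ⁅x, y⁆ * ⁅x, z⁆ := by
  have h1 : ⁅x, y * z⁆ = ⁅x, y⁆ * (y * ⁅x, z⁆ * y⁻¹) := by
    simp only [commutatorElement_def]; group
  rw [h1, h.eq, mul_inv_cancel_right]

theorem commutator_mul_left' {H : Type*} [Group H] (x y z : H) (h : Commute x ⁅y, z⁆)
    (h' : Commute ⁅x, z⁆ ⁅y, z⁆) :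
    ⁅x * y, z⁆ = ⁅x, z⁆ * ⁅y, z⁆ := by
  have h1 : ⁅x * y, z⁆ = (x * ⁅y, z⁆ * x⁻¹) * ⁅x, z⁆ := by
    simp only [commutatorElement_def]; group
  rw [h1, h.eq, mul_inv_cancel_right, h'.eq]

/-- The Jacobi identity, for elements whose higher commutators commute. -/
theorem commutator_jacobi {H : Type*} [Group H] (x y z : H)
    (h1 : Commute ⁅x, y⁆ ⁅y, z⁆) (h2 : Commute ⁅x, z⁆ ⁅y, z⁆) (h3 : Commute ⁅x, y⁆ ⁅x, z⁆)
    (h4 : Commute ⁅x, y⁆ ⁅y, ⁅x, z⁆⁆) (h5 : Commute ⁅x, z⁆ ⁅⁅x, y⁆, z⁆)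
    (h6 : Commute ⁅y, z⁆ ⁅⁅x, y⁆, z⁆) (h7 : Commute ⁅y, ⁅x, z⁆⁆ ⁅⁅x, y⁆, z⁆) :
    ⁅x, ⁅y, z⁆⁆ = ⁅⁅x, y⁆, z⁆ * ⁅y, ⁅x, z⁆⁆ := by
  have e1 : ⁅x, ⁅y, z⁆⁆ * ⁅y, z⁆ = ⁅⁅x, y⁆ * y, ⁅x, z⁆ * z⁆ := by
    simp only [commutatorElement_def]; group
  have e2 : ⁅⁅x, y⁆ * y, ⁅x, z⁆ * z⁆ =
      (⁅x, y⁆ * ⁅y, ⁅x, z⁆⁆ * ⁅x, y⁆⁻¹) * (⁅x, y⁆ * (⁅x, z⁆ * ⁅y, z⁆ * ⁅x, z⁆⁻¹) * ⁅x, y⁆⁻¹) *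
        (⁅⁅x, y⁆, ⁅x, z⁆⁆ * (⁅x, z⁆ * ⁅⁅x, y⁆, z⁆ * ⁅x, z⁆⁻¹)) := by
    generalize ⁅x, y⁆ = u
    generalize ⁅x, z⁆ = v
    simp only [commutatorElement_def]; group
  rw [e2, commutatorElement_eq_one_iff_commute.2 h3, h4.eq, h2.eq, h5.eq, mul_inv_cancel_right,
    mul_inv_cancel_right, mul_inv_cancel_right, h1.eq, mul_inv_cancel_right, one_mul,
    mul_assoc, h6.eq, ← mul_assoc, h7.eq] at e1
  exact mul_right_cancel e1

theorem mk_comm (d : ℕ) (x y : G) :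
    ((⁅x, y⁆ : G) : G ⧸ K.sub d) = ⁅(x : G ⧸ K.sub d), (y : G ⧸ K.sub d)⁆ := by
  simp [commutatorElement_def]

/-- The commutator `K_m × K_n → K_{m+n}`. -/
def commElt {m n : ℕ+} (x : K.sub m) (y : K.sub n) : K.sub (m + n : ℕ+) :=
  ⟨⁅(x : G), (y : G)⁆, K.comm_mem x.2 y.2⟩

theorem commElt_mul_right {m n : ℕ+} (x : K.sub m) (y z : K.sub n) :
    (QuotientGroup.mk (K.commElt x (y * z)) : K.GrMul (m + n : ℕ+)) =
      QuotientGroup.mk (K.commElt x y * K.commElt x z) := by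
  apply K.grMul_mk_eq
  simp only [commElt, Subgroup.coe_mul, QuotientGroup.mk_mul, mk_comm]
  apply commutator_mul_right'
  rw [← mk_comm]
  refine K.commute_mk (K.antitone ?_ (K.comm_mem y.2 (K.comm_mem x.2 z.2)))
  have := n.pos
  simp only [PNat.add_coe]
  omega

theorem commElt_mul_left {m n : ℕ+} (x y : K.sub m) (z : K.sub n) :
    (QuotientGroup.mk (K.commElt (x * y) z) : K.GrMul (m + n : ℕ+)) =
      QuotientGroup.mk (K.commElt x z * K.commElt y z) := by
  apply K.grMul_mk_eq
  simp only [commElt, Subgroup.coe_mul, QuotientGroup.mk_mul, mk_comm]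
  have := n.pos
  have := m.pos
  apply commutator_mul_left'
  · rw [← mk_comm]
    refine K.commute_mk (K.antitone ?_ (K.comm_mem x.2 (K.comm_mem y.2 z.2)))
    simp only [PNat.add_coe]
    omega
  · rw [← mk_comm, ← mk_comm]
    refine K.commute_mk (K.antitone ?_ (K.comm_mem (K.comm_mem x.2 z.2) (K.comm_mem y.2 z.2)))
    simp only [PNat.add_coe]
    omega

/-- For fixed `x ∈ K_m`, the homomorphism `yK_{n+1} ↦ [x, y]K_{m+n+1}`. -/
def bracketInner (m n : ℕ+) (x : K.sub m) : K.GrMul n →* K.GrMul (m + n : ℕ+) :=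
  QuotientGroup.lift _
    (MonoidHom.mk' (fun y : K.sub n => (QuotientGroup.mk (K.commElt x y) : K.GrMul (m + n : ℕ+)))
      (fun y z => by rw [K.commElt_mul_right]; rfl))
    (by
      intro y hy
      refine (QuotientGroup.eq_one_iff _).2 ?_
      exact K.comm_mem x.2 (n := (n : ℕ) + 1) (Subgroup.mem_subgroupOf.1 hy))

/-- The bihomomorphism `(xK_{m+1}, yK_{n+1}) ↦ [x, y]K_{m+n+1}`. -/
def bracketMul (m n : ℕ+) : K.GrMul m →* K.GrMul n →* K.GrMul (m + n : ℕ+) :=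
  QuotientGroup.lift _
    (MonoidHom.mk' (K.bracketInner m n)
      (fun x y => by
        ext z
        exact K.commElt_mul_left x y z))
    (by
      intro x hx
      ext z
      refine (QuotientGroup.eq_one_iff _).2 ?_
      have := K.comm_mem (Subgroup.mem_subgroupOf.1 hx) z.2
      refine Subgroup.mem_subgroupOf.2 ?_
      have e : ((m + n : ℕ+) : ℕ) + 1 = (m : ℕ) + 1 + (n : ℕ) := by
        simp only [PNat.add_coe]; omega
      rw [e]
      exact this)

/-- The bracket of the homogeneous parts, in additive notation. -/
def bracketHom (m n : ℕ+) : K.GrPos m →+ K.GrPos n →+ K.GrLie :=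
  AddMonoidHom.mk' (fun x => (K.grOf (m + n)).comp
      (MonoidHom.toAdditive (K.bracketMul m n (Additive.toMul x))))
    (fun x y => by
      refine AddMonoidHom.ext fun z => ?_
      change K.grOf (m + n) (Additive.ofMul
        (K.bracketMul m n (Additive.toMul x * Additive.toMul y) (Additive.toMul z))) = _
      rw [map_mul, MonoidHom.mul_apply, ofMul_mul, map_add]
      rfl)

/-- The biadditive Lie bracket of `⨁_{m ≥ 1} K_m / K_{m+1}`. -/
def bracketAdd : K.GrLie →+ K.GrLie →+ K.GrLie :=
  K.grLieLift fun m => (K.grLieLift fun n => (K.bracketHom m n).flip).flip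

theorem bracketAdd_cls {m n : ℕ+} (x : K.sub m) (y : K.sub n) :
    K.bracketAdd (K.cls m x) (K.cls n y) = K.cls (m + n) (K.commElt x y) := by
  unfold bracketAdd
  rw [grLieLift_cls, AddMonoidHom.flip_apply, grLieLift_cls]
  rfl

theorem bracketAdd_swap (x y : K.GrLie) : K.bracketAdd x y + K.bracketAdd y x = 0 := by
  induction x using K.grLie_induction with
  | zero => simp only [map_zero, AddMonoidHom.zero_apply, add_zero]
  | cls m x =>
    induction y using K.grLie_induction with
    | zero => simp only [map_zero, AddMonoidHom.zero_apply, add_zero]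
    | cls n y =>
      rw [bracketAdd_cls, bracketAdd_cls,
        K.cls_eq (add_comm n m) (x := K.commElt y x) (y := (K.commElt x y)⁻¹)
          (by
            simp only [commElt, Subgroup.coe_inv]
            rw [commutatorElement_inv]),
        ← cls_mul, mul_inv_cancel, cls_one]
    | add y z hy hz =>
      simp only [map_add, AddMonoidHom.add_apply]
      rw [add_add_add_comm, hy, hz, add_zero]
  | add u v hu hv =>
    simp only [map_add, AddMonoidHom.add_apply]
    rw [add_add_add_comm, hu, hv, add_zero]

theorem bracketAdd_self (x : K.GrLie) : K.bracketAdd x x = 0 := by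
  induction x using K.grLie_induction with
  | zero => simp only [map_zero]
  | cls m x =>
    rw [bracketAdd_cls,
      K.cls_eq rfl (x := K.commElt x x) (y := 1) (by simp [commElt]), cls_one]
  | add u v hu hv =>
    simp only [map_add, AddMonoidHom.add_apply]
    rw [hu, hv, zero_add, add_zero, add_comm, K.bracketAdd_swap]

theorem bracketAdd_jacobi (x y z : K.GrLie) :
    K.bracketAdd x (K.bracketAdd y z) =
      K.bracketAdd (K.bracketAdd x y) z + K.bracketAdd y (K.bracketAdd x z) := by
  induction x using K.grLie_induction with
  | zero => simp only [map_zero, AddMonoidHom.zero_apply, add_zero]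
  | add u v hu hv =>
    simp only [map_add, AddMonoidHom.add_apply]
    rw [hu, hv]; abel
  | cls a x =>
  induction y using K.grLie_induction with
  | zero => simp only [map_zero, AddMonoidHom.zero_apply, add_zero]
  | add u v hu hv =>
    simp only [map_add, AddMonoidHom.add_apply]
    rw [hu, hv]; abel
  | cls b y =>
  induction z using K.grLie_induction with
  | zero => simp only [map_zero, add_zero]
  | add u v hu hv =>
    simp only [map_add]
    rw [hu, hv]; abel
  | cls c z =>
  simp only [bracketAdd_cls]
  have ha := a.pos
  have hb := b.pos
  have hc := c.pos
  rw [K.cls_eq (m := b + (a + c)) (n := a + b + c) (by rw [← add_assoc, add_comm b a])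
    (x := K.commElt y (K.commElt x z))
    (y := ⟨⁅(y : G), ⁅(x : G), (z : G)⁆⁆, by
      have := K.comm_mem y.2 (K.comm_mem x.2 z.2)
      have e : ((a + b + c : ℕ+) : ℕ) = (b : ℕ) + ((a : ℕ) + (c : ℕ)) := by
        simp only [PNat.add_coe]; omega
      rw [e]; exact this⟩) rfl, ← cls_mul]
  refine K.cls_eq (add_assoc a b c).symm ?_
  simp only [commElt, Subgroup.coe_mul, QuotientGroup.mk_mul, mk_comm]
  have hxy := K.comm_mem x.2 y.2
  have hxz := K.comm_mem x.2 z.2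
  have hyz := K.comm_mem y.2 z.2
  have hyxz := K.comm_mem y.2 hxz
  have hxyz := K.comm_mem hxy z.2
  apply commutator_jacobi <;> simp only [← mk_comm] <;> apply K.commute_mk
  · exact K.antitone (by simp only [PNat.add_coe]; omega) (K.comm_mem hxy hyz)
  · exact K.antitone (by simp only [PNat.add_coe]; omega) (K.comm_mem hxz hyz)
  · exact K.antitone (by simp only [PNat.add_coe]; omega) (K.comm_mem hxy hxz)
  · exact K.antitone (by simp only [PNat.add_coe]; omega) (K.comm_mem hxy hyxz)
  · exact K.antitone (by simp only [PNat.add_coe]; omega) (K.comm_mem hxz hxyz)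
  · exact K.antitone (by simp only [PNat.add_coe]; omega) (K.comm_mem hyz hxyz)
  · exact K.antitone (by simp only [PNat.add_coe]; omega) (K.comm_mem hyxz hxyz)

/-- The graded Lie ring `gr₊(K) = ⨁_{m ≥ 1} K_m / K_{m+1}`. -/
instance : LieRing K.GrLie where
  bracket x y := K.bracketAdd x y
  add_lie x y z := by
    change K.bracketAdd (x + y) z = _
    rw [map_add]; rfl
  lie_add x y z := by
    change K.bracketAdd x (y + z) = _
    rw [map_add]
  lie_self x := K.bracketAdd_self x
  leibniz_lie x y z := K.bracketAdd_jacobi x y z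

theorem lie_cls {m n : ℕ+} (x : K.sub m) (y : K.sub n) :
    ⁅K.cls m x, K.cls n y⁆ = K.cls (m + n) (K.commElt x y) :=
  K.bracketAdd_cls x y

/-! #### The action of `K₀ / K₁` -/

/-- Conjugation by `g` on `K_m / K_{m+1}`. -/
def conjMul (m : ℕ+) (g : G) : K.GrMul m →* K.GrMul m :=
  QuotientGroup.map _ _
    (MonoidHom.mk' (fun y : K.sub m => (⟨g * y * g⁻¹, (K.normal m).conj_mem y y.2 g⟩ : K.sub m))
      (fun x y => by ext; simp))
    (fun y hy => (K.normal (m + 1)).conj_mem y hy g)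

/-- The action of `g ∈ K₀` on `⨁_{m ≥ 1} K_m / K_{m+1}` by conjugation. -/
def conjAdd (g : G) : K.GrLie →+ K.GrLie :=
  K.grLieLift fun m => (K.grOf m).comp (MonoidHom.toAdditive (K.conjMul m g))

theorem conjAdd_cls (g : G) (m : ℕ+) (x : K.sub m) :
    K.conjAdd g (K.cls m x) = K.cls m ⟨g * x * g⁻¹, (K.normal m).conj_mem x x.2 g⟩ := by
  unfold conjAdd
  rw [grLieLift_cls]
  rfl

/-- The action of `g ∈ K₀` on the graded Lie ring by conjugation, as a Lie homomorphism. -/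
def conjLie (g : G) : K.GrLie →ₗ⁅ℤ⁆ K.GrLie :=
  { (K.conjAdd g).toIntLinearMap with
    map_lie' := by
      intro x y
      change K.conjAdd g ⁅x, y⁆ = ⁅K.conjAdd g x, K.conjAdd g y⁆
      induction x using K.grLie_induction with
      | zero => simp only [map_zero, zero_lie]
      | add u v hu hv => simp only [map_add, add_lie, hu, hv]
      | cls m x =>
        induction y using K.grLie_induction with
        | zero => simp only [map_zero, lie_zero]
        | add u v hu hv => simp only [map_add, lie_add, hu, hv]
        | cls n y =>
          simp only [lie_cls, conjAdd_cls]
          refine K.cls_eq rfl (congrArg _ ?_)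
          simp only [commElt, commutatorElement_def]
          group }

theorem conjLie_cls (g : G) (m : ℕ+) (x : K.sub m) :
    K.conjLie g (K.cls m x) = K.cls m ⟨g * x * g⁻¹, (K.normal m).conj_mem x x.2 g⟩ :=
  K.conjAdd_cls g m x

/-- The graded Lie `ℚ`-algebra `gr₊^ℚ(K) = (⨁_{m ≥ 1} K_m / K_{m+1}) ⊗ ℚ`. -/
abbrev GrLieQ : Type _ := ℚ ⊗[ℤ] K.GrLie

/-- The element `xK_{m+1} ⊗ 1` of degree `m` of `gr₊^ℚ(K)`, for `x ∈ K_m`, `m ≥ 1`. -/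
def clsQ (m : ℕ+) (x : K.sub m) : K.GrLieQ := 1 ⊗ₜ[ℤ] K.cls m x

attribute [local instance 100] LieRing.ofAssociativeRing

/-- The universal enveloping algebra `U(gr₊^ℚ(K))`. -/
abbrev UPos : Type _ := UniversalEnvelopingAlgebra ℚ K.GrLieQ

theorem span_clsQ : Submodule.span ℚ {y : K.GrLieQ | ∃ m x, y = K.clsQ m x} = ⊤ := by
  rw [eq_top_iff]
  intro y _
  induction y using TensorProduct.induction_on with
  | zero => exact zero_mem _
  | add u v hu hv => exact add_mem (hu trivial) (hv trivial)
  | tmul q z =>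
    induction z using K.grLie_induction with
    | zero => rw [TensorProduct.tmul_zero]; exact zero_mem _
    | add u v hu hv => rw [TensorProduct.tmul_add]; exact add_mem (hu trivial) (hv trivial)
    | cls m x =>
      have : q ⊗ₜ[ℤ] K.cls m x = q • K.clsQ m x := by
        rw [clsQ, TensorProduct.smul_tmul', smul_eq_mul, mul_one]
      rw [this]
      exact Submodule.smul_mem _ _ (Submodule.subset_span ⟨m, x, rfl⟩)

theorem uPos_hom_ext {A : Type*} [Ring A] [Algebra ℚ A] {f g : K.UPos →ₐ[ℚ] A}
    (h : ∀ m x, f (UniversalEnvelopingAlgebra.ι ℚ (K.clsQ m x)) =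
      g (UniversalEnvelopingAlgebra.ι ℚ (K.clsQ m x))) : f = g := by
  apply UniversalEnvelopingAlgebra.hom_ext
  have key : (f.toLinearMap ∘ₗ (UniversalEnvelopingAlgebra.ι ℚ : K.GrLieQ →ₗ⁅ℚ⁆ K.UPos).toLinearMap) =
      (g.toLinearMap ∘ₗ (UniversalEnvelopingAlgebra.ι ℚ : K.GrLieQ →ₗ⁅ℚ⁆ K.UPos).toLinearMap) := by
    refine LinearMap.ext_on K.span_clsQ ?_
    rintro _ ⟨m, x, rfl⟩
    exact h m x
  ext y
  exact congrArg (fun φ : K.GrLieQ →ₗ[ℚ] A => φ y) key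

/-- The rational extension of the action of `g ∈ K₀`. -/
def conjLieQ (g : G) : K.GrLieQ →ₗ⁅ℚ⁆ K.GrLieQ :=
  { (K.conjLie g : K.GrLie →ₗ[ℤ] K.GrLie).baseChange ℚ with
    map_lie' := by
      intro x y
      exact (LieAlgebra.ExtendScalars.map (AlgHom.id ℤ ℚ) (K.conjLie g)).map_lie x y }

theorem conjLieQ_clsQ (g : G) (m : ℕ+) (x : K.sub m) :
    K.conjLieQ g (K.clsQ m x) = K.clsQ m ⟨g * x * g⁻¹, (K.normal m).conj_mem x x.2 g⟩ := by
  change (1 : ℚ) ⊗ₜ[ℤ] K.conjLie g (K.cls m x) = _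
  rw [conjLie_cls]
  rfl

/-- The algebra endomorphism of `U(gr₊^ℚ(K))` induced by the action of `g ∈ K₀`. -/
def conjU (g : G) : K.UPos →ₐ[ℚ] K.UPos :=
  UniversalEnvelopingAlgebra.lift ℚ ((UniversalEnvelopingAlgebra.ι ℚ).comp (K.conjLieQ g))

theorem conjU_ι (g : G) (m : ℕ+) (x : K.sub m) :
    K.conjU g (UniversalEnvelopingAlgebra.ι ℚ (K.clsQ m x)) =
      UniversalEnvelopingAlgebra.ι ℚ
        (K.clsQ m ⟨g * x * g⁻¹, (K.normal m).conj_mem x x.2 g⟩) := by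
  unfold conjU
  rw [UniversalEnvelopingAlgebra.lift_ι_apply, LieHom.comp_apply, conjLieQ_clsQ]

/-- The action of `K₀ / K₁` on `U(gr₊^ℚ(K))`. -/
def actU : G ⧸ K.sub 1 →* (K.UPos →ₐ[ℚ] K.UPos) :=
  QuotientGroup.lift (K.sub 1)
    { toFun := K.conjU
      map_one' := by
        apply K.uPos_hom_ext
        intro m x
        rw [conjU_ι, AlgHom.one_apply]
        congr 2
        ext
        simp
      map_mul' := by
        intro g h
        apply K.uPos_hom_ext
        intro m x
        rw [AlgHom.mul_apply, conjU_ι, conjU_ι, conjU_ι]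
        congr 2
        ext
        simp [mul_assoc] }
    (by
      intro g hg
      apply K.uPos_hom_ext
      intro m x
      change K.conjU g _ = _
      rw [conjU_ι, AlgHom.one_apply]
      congr 1
      unfold clsQ
      congr 1
      refine K.cls_eq rfl ?_
      have h := K.commute_mk (d := m + 1)
        (by rw [add_comm]; exact K.comm_mem hg x.2)
      simp only [QuotientGroup.mk_mul, QuotientGroup.mk_inv]
      rw [h.eq, mul_inv_cancel_right])

instance : MulSemiringAction (G ⧸ K.sub 1) K.UPos where
  smul g u := K.actU g u
  one_smul u := by change K.actU 1 u = u; rw [map_one]; rfl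
  mul_smul g h u := by
    change K.actU (g * h) u = K.actU g (K.actU h u)
    rw [map_mul]; rfl
  smul_zero g := map_zero (K.actU g)
  smul_add g := map_add (K.actU g)
  smul_one g := map_one (K.actU g)
  smul_mul g := map_mul (K.actU g)

theorem smul_uPos_def (g : G ⧸ K.sub 1) (u : K.UPos) : g • u = K.actU g u := rfl

instance : SMulCommClass (G ⧸ K.sub 1) ℚ K.UPos where
  smul_comm g q u := map_smul (K.actU g) q u

/-! #### The universal enveloping algebra of the associated eg-Lie `ℚ`-algebra -/

/-- The universal enveloping algebra `U(gr_•^ℚ(K)) = U(gr₊^ℚ(K)) ♯ ℚ[K₀/K₁]`: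
finite sums of elements `u · g` with `u ∈ U(gr₊^ℚ(K))` and `g ∈ K₀/K₁`, with the product
`(u · g) (u' · g') = u (ᵍu') · g g'` of the crossed product. -/
abbrev U : Type _ := SkewMonoidAlgebra K.UPos (G ⧸ K.sub 1)

/-- The element `u · g` of `U(gr_•^ℚ(K))`, as a linear function of `u`. -/
def uSingle (g : G ⧸ K.sub 1) : K.UPos →ₗ[ℚ] K.U where
  toFun u := SkewMonoidAlgebra.single g u
  map_add' u v := SkewMonoidAlgebra.single_add g u v
  map_smul' q u := (SkewMonoidAlgebra.smul_single q g u).symm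

theorem uSingle_mul (g h : G ⧸ K.sub 1) (u v : K.UPos) :
    K.uSingle g u * K.uSingle h v = K.uSingle (g * h) (u * K.actU g v) :=
  SkewMonoidAlgebra.single_mul_single

/-- `U(gr_•^ℚ(K))` is a `ℚ`-algebra. -/
instance : Algebra ℚ K.U :=
  Algebra.ofModule
    (by
      intro q x y
      induction x using SkewMonoidAlgebra.induction_on with
      | zero => simp
      | add u v hu hv => simp only [smul_add, add_mul, hu, hv]
      | single g u =>
        induction y using SkewMonoidAlgebra.induction_on with
        | zero => simp
        | add u v hu hv => simp only [smul_add, mul_add, hu, hv]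
        | single h v =>
          simp only [SkewMonoidAlgebra.smul_single, SkewMonoidAlgebra.single_mul_single,
            smul_mul_assoc])
    (by
      intro q x y
      induction x using SkewMonoidAlgebra.induction_on with
      | zero => simp
      | add u v hu hv => simp only [smul_add, add_mul, hu, hv]
      | single g u =>
        induction y using SkewMonoidAlgebra.induction_on with
        | zero => simp
        | add u v hu hv => simp only [smul_add, mul_add, hu, hv]
        | single h v =>
          simp only [SkewMonoidAlgebra.smul_single, SkewMonoidAlgebra.single_mul_single]
          rw [smul_comm g q v, mul_smul_comm])

/-- The comultiplication of `U(gr₊^ℚ(K))`, for which the elements of `gr₊^ℚ(K)` are primitive. -/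
def comulUPos : K.UPos →ₐ[ℚ] K.UPos ⊗[ℚ] K.UPos :=
  UniversalEnvelopingAlgebra.lift ℚ
    { toFun := fun x => UniversalEnvelopingAlgebra.ι ℚ x ⊗ₜ[ℚ] 1 +
        1 ⊗ₜ[ℚ] UniversalEnvelopingAlgebra.ι ℚ x
      map_add' := by
        intro x y
        rw [map_add, TensorProduct.add_tmul, TensorProduct.tmul_add, add_add_add_comm]
      map_smul' := by
        intro q x
        simp only [map_smul, TensorProduct.smul_tmul', TensorProduct.tmul_smul, smul_add,
          RingHom.id_apply]
      map_lie' := by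
        intro x y
        simp only [LieHom.map_lie, LieRing.of_associative_ring_bracket, mul_add, add_mul,
          Algebra.TensorProduct.tmul_mul_tmul, one_mul, mul_one, TensorProduct.sub_tmul,
          TensorProduct.tmul_sub]
        abel }

/-- The counit of `U(gr₊^ℚ(K))`. -/
def counitUPos : K.UPos →ₐ[ℚ] ℚ := UniversalEnvelopingAlgebra.lift ℚ 0

/-- The comultiplication of `U(gr_•^ℚ(K))`: `Δ(u · g) = ∑ (u' · g) ⊗ (u'' · g)`
where `Δ(u) = ∑ u' ⊗ u''`. -/
def comulU : K.U →ₗ[ℚ] K.U ⊗[ℚ] K.U :=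
  (Finsupp.lsum ℚ fun g : G ⧸ K.sub 1 =>
      TensorProduct.map (K.uSingle g) (K.uSingle g) ∘ₗ K.comulUPos.toLinearMap) ∘ₗ
    (SkewMonoidAlgebra.coeffLinearEquiv : K.U ≃ₗ[ℚ] _).toLinearMap

/-- The counit of `U(gr_•^ℚ(K))`: `ε(u · g) = ε(u)`. -/
def counitU : K.U →ₗ[ℚ] ℚ :=
  (Finsupp.lsum ℚ fun _ : G ⧸ K.sub 1 => K.counitUPos.toLinearMap) ∘ₗ
    (SkewMonoidAlgebra.coeffLinearEquiv : K.U ≃ₗ[ℚ] _).toLinearMap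

/-- The degree `n` part of `U(gr₊^ℚ(K))`: the span of the products `x₁ ⋯ x_p` of elements
`x_i` of degree `m_i` with `m₁ + ⋯ + m_p = n`. -/
def uPosDeg (n : ℕ) : Submodule ℚ K.UPos :=
  Submodule.span ℚ {u | ∃ l : List (Σ m : ℕ+, K.sub m),
    (l.map fun p => (p.1 : ℕ)).sum = n ∧
    u = (l.map fun p => UniversalEnvelopingAlgebra.ι ℚ (K.clsQ p.1 p.2)).prod}

/-- The degree `n` part of `U(gr_•^ℚ(K))`: the sums of elements `u · g`, where `u` has degree `n`
in `U(gr₊^ℚ(K))` and `g ∈ K₀/K₁` has degree `0`. -/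
def uDeg (n : ℕ) : Submodule ℚ K.U where
  carrier := {x | ∀ g, x.coeff g ∈ K.uPosDeg n}
  zero_mem' g := by simp
  add_mem' hx hy g := by simpa using add_mem (hx g) (hy g)
  smul_mem' q x hx g := by simpa using Submodule.smul_mem _ q (hx g)

theorem uSingle_mem_uDeg {n : ℕ} (g : G ⧸ K.sub 1) {u : K.UPos} (hu : u ∈ K.uPosDeg n) :
    K.uSingle g u ∈ K.uDeg n := by
  classical
  intro h
  change (SkewMonoidAlgebra.single g u).coeff h ∈ _
  rw [SkewMonoidAlgebra.coeff_single_apply]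
  split_ifs
  · exact hu
  · exact zero_mem _

theorem uPosDeg_mul {m n : ℕ} {u v : K.UPos} (hu : u ∈ K.uPosDeg m) (hv : v ∈ K.uPosDeg n) :
    u * v ∈ K.uPosDeg (m + n) := by
  have h : K.uPosDeg m * K.uPosDeg n ≤ K.uPosDeg (m + n) := by
    unfold uPosDeg
    rw [Submodule.span_mul_span]
    refine Submodule.span_mono ?_
    rintro _ ⟨_, ⟨l, hl, rfl⟩, _, ⟨l', hl', rfl⟩, rfl⟩
    exact ⟨l ++ l', by simp [hl, hl'], by simp⟩
  exact h (Submodule.mul_mem_mul hu hv)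

theorem actU_mem {n : ℕ} (g : G ⧸ K.sub 1) {u : K.UPos} (hu : u ∈ K.uPosDeg n) :
    K.actU g u ∈ K.uPosDeg n := by
  obtain ⟨g, rfl⟩ := QuotientGroup.mk_surjective g
  change K.conjU g u ∈ _
  unfold uPosDeg at hu
  induction hu using Submodule.span_induction with
  | zero => rw [map_zero]; exact zero_mem _
  | add x y _ _ hx hy => rw [map_add]; exact add_mem hx hy
  | smul q x _ hx => rw [map_smul]; exact Submodule.smul_mem _ _ hx
  | mem x hx =>
    obtain ⟨l, hl, rfl⟩ := hx
    refine Submodule.subset_span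
      ⟨l.map fun p => ⟨p.1, ⟨g * p.2 * g⁻¹, (K.normal p.1).conj_mem p.2 p.2.2 g⟩⟩, ?_, ?_⟩
    · rw [← hl, List.map_map]; rfl
    · rw [map_list_prod, List.map_map, List.map_map]
      congr 2
      funext p
      exact K.conjU_ι g p.1 p.2

theorem uDeg_eq_sum {x : K.U} : x = x.coeff.sum fun g u => K.uSingle g u :=
  (SkewMonoidAlgebra.sum_single x).symm

theorem uDeg_mul {m n : ℕ} {x y : K.U} (hx : x ∈ K.uDeg m) (hy : y ∈ K.uDeg n) :
    x * y ∈ K.uDeg (m + n) := by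
  rw [K.uDeg_eq_sum (x := x), K.uDeg_eq_sum (x := y), Finsupp.sum, Finsupp.sum,
    Finset.sum_mul_sum]
  refine Submodule.sum_mem _ fun g _ => Submodule.sum_mem _ fun h _ => ?_
  rw [uSingle_mul]
  exact K.uSingle_mem_uDeg _ (K.uPosDeg_mul (hx g) (K.actU_mem g (hy h)))

theorem one_mem_uDeg : (1 : K.U) ∈ K.uDeg 0 :=
  K.uSingle_mem_uDeg 1 (Submodule.subset_span ⟨[], by simp, by simp⟩)

/-- The degree-completion `Û(gr_•^ℚ(K)) = ∏_n U(gr_•^ℚ(K))_n`. A sequence `(x_n)` with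
`x_n` of degree `n` is written as the formal power series `∑ x_n tⁿ`, so that the sum and
the product of power series are those of the completion. -/
def UHat : Subalgebra ℚ (PowerSeries K.U) where
  carrier := {x | ∀ n, PowerSeries.coeff n x ∈ K.uDeg n}
  add_mem' hx hy n := by rw [map_add]; exact add_mem (hx n) (hy n)
  mul_mem' hx hy n := by
    rw [PowerSeries.coeff_mul]
    refine Submodule.sum_mem _ fun p hp => ?_
    rw [← Finset.HasAntidiagonal.mem_antidiagonal.1 hp]
    exact K.uDeg_mul (hx p.1) (hy p.2)
  algebraMap_mem' q n := by
    rw [Algebra.algebraMap_eq_smul_one, PowerSeries.coeff_smul, PowerSeries.coeff_one]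
    split_ifs with h
    · subst h; exact Submodule.smul_mem _ _ K.one_mem_uDeg
    · rw [smul_zero]; exact zero_mem _

/-- The degree `n` component of an element of `Û(gr_•^ℚ(K))`. -/
def comp (x : K.UHat) (n : ℕ) : K.U := PowerSeries.coeff n x.1

/-- `x ∈ Û(gr_•^ℚ(K))` is group-like if `Δ(x) = x ⊗ x` and `ε(x) = 1`. The equality
`Δ(x) = x ⊗ x` in the degree-completion of `U ⊗ U` is expressed in each total degree `n`. The
counit vanishes in positive degrees. -/
def IsGroupLikeHat (x : K.UHat) : Prop :=
  (∀ n, K.comulU (K.comp x n) =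
    ∑ p ∈ Finset.HasAntidiagonal.antidiagonal n, K.comp x p.1 ⊗ₜ[ℚ] K.comp x p.2) ∧
  K.counitU (K.comp x 0) = 1

/-- An expansion of `K`: a homomorphism `θ : K₀ → Û(gr_•^ℚ(K))` with group-like values such that
`θ(x) = (xK₁) + (deg > 0)` for `x ∈ K₀` and `θ(x) = 1 + (xK_{i+1}) + (deg > i)` for `x ∈ K_i`,
`i ≥ 1`. -/
structure IsExpansion (θ : G →* K.UHat) : Prop where
  groupLike : ∀ x, K.IsGroupLikeHat (θ x)
  leading_zero : ∀ x : G, K.comp (θ x) 0 = K.uSingle (QuotientGroup.mk x) 1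
  leading_pos : ∀ (i : ℕ+) (x : K.sub i),
    K.comp (θ x) 0 = 1 ∧ (∀ j : ℕ, 0 < j → j < i → K.comp (θ x) j = 0) ∧
    K.comp (θ x) i = K.uSingle 1 (UniversalEnvelopingAlgebra.ι ℚ (K.clsQ i x))

/-! ### The filtration of the group algebra and formality -/

/-- `I_m^ℚ = ker (ℚ[K₀] → ℚ[K₀/K_m])`. -/
def I (m : ℕ) : Submodule ℚ (MonoidAlgebra ℚ G) :=
  LinearMap.ker
    (MonoidAlgebra.mapDomainBialgHom ℚ (QuotientGroup.mk' (K.sub m))).toCoalgHom.toLinearMap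

/-- `J_0^ℚ = ℚ[K₀]` and `J_m^ℚ = ∑ I_{m₁}^ℚ ⋯ I_{m_p}^ℚ` for `m ≥ 1`, the sum being taken over
`p ≥ 1` and `m₁, …, m_p ≥ 1` with `m₁ + ⋯ + m_p ≥ m`. -/
def J : ℕ → Submodule ℚ (MonoidAlgebra ℚ G)
  | 0 => ⊤
  | m + 1 => ⨆ l : {l : List ℕ+ // l ≠ [] ∧ m + 1 ≤ (l.map fun i : ℕ+ => (i : ℕ)).sum},
      (l.1.map fun i : ℕ+ => K.I i).prod

theorem mem_I {m : ℕ} {x : MonoidAlgebra ℚ G} : x ∈ K.I m ↔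
    MonoidAlgebra.mapDomainBialgHom ℚ (QuotientGroup.mk' (K.sub m)) x = 0 := LinearMap.mem_ker

theorem prod_I_le {l : List ℕ+} {m : ℕ} (hl : l ≠ [])
    (hm : m ≤ (l.map fun i : ℕ+ => (i : ℕ)).sum) : (l.map fun i : ℕ+ => K.I i).prod ≤ K.J m := by
  cases m with
  | zero => exact le_top
  | succ m =>
    exact le_iSup (fun l : {l : List ℕ+ // l ≠ [] ∧ m + 1 ≤ (l.map fun i : ℕ+ => (i : ℕ)).sum} =>
      (l.1.map fun i : ℕ+ => K.I i).prod) ⟨l, hl, hm⟩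

theorem J_antitone : Antitone K.J := by
  intro m n h
  cases n with
  | zero => obtain rfl : m = 0 := by omega
            exact le_rfl
  | succ n => exact iSup_le fun l => K.prod_I_le l.2.1 (h.trans l.2.2)

theorem top_mul_I (m : ℕ) : ⊤ * K.I m ≤ K.I m := by
  refine Submodule.mul_le.2 fun a _ x hx => ?_
  rw [mem_I] at hx ⊢
  rw [map_mul, hx, mul_zero]

theorem I_mul_top (m : ℕ) : K.I m * ⊤ ≤ K.I m := by
  refine Submodule.mul_le.2 fun x hx a _ => ?_
  rw [mem_I] at hx ⊢
  rw [map_mul, hx, zero_mul]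

theorem top_mul_prod {l : List ℕ+} (hl : l ≠ []) :
    ⊤ * (l.map fun i : ℕ+ => K.I i).prod ≤ (l.map fun i : ℕ+ => K.I i).prod := by
  cases l with
  | nil => exact absurd rfl hl
  | cons i l =>
    rw [List.map_cons, List.prod_cons, ← mul_assoc]
    exact mul_le_mul' (K.top_mul_I i) le_rfl

theorem prod_mul_top {l : List ℕ+} (hl : l ≠ []) :
    (l.map fun i : ℕ+ => K.I i).prod * ⊤ ≤ (l.map fun i : ℕ+ => K.I i).prod := by
  obtain ⟨l, i, rfl⟩ := List.eq_nil_or_concat l |>.resolve_left hl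
  rw [List.concat_eq_append, List.map_append, List.prod_append, mul_assoc]
  refine mul_le_mul' le_rfl ?_
  simpa using K.I_mul_top i

theorem J_mul_le (m n : ℕ) : K.J m * K.J n ≤ K.J (m + n) := by
  cases m with
  | zero =>
    rw [zero_add]
    cases n with
    | zero => exact le_top
    | succ n =>
      change ⊤ * (⨆ l, _) ≤ _
      rw [Submodule.mul_iSup]
      exact iSup_le fun l => (K.top_mul_prod l.2.1).trans (K.prod_I_le l.2.1 l.2.2)
  | succ m =>
    cases n with
    | zero =>
      change (⨆ l, _) * ⊤ ≤ _
      rw [Submodule.iSup_mul]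
      exact iSup_le fun l => (K.prod_mul_top l.2.1).trans (K.prod_I_le l.2.1 l.2.2)
    | succ n =>
      change (⨆ l, _) * (⨆ l, _) ≤ _
      rw [Submodule.iSup_mul]
      refine iSup_le fun l => ?_
      rw [Submodule.mul_iSup]
      refine iSup_le fun l' => ?_
      rw [← List.prod_append, ← List.map_append]
      refine K.prod_I_le (by simp [l.2.1]) ?_
      rw [List.map_append, List.sum_append]
      exact add_le_add l.2.2 l'.2.2

theorem I_le_J (i : ℕ+) : K.I i ≤ K.J i := by
  have := K.prod_I_le (l := [i]) (m := i) (by simp) (by simp)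
  simpa using this

/-- The filtration `∑_{i+j=m} J_i ⊗ J_j` of `ℚ[K₀] ⊗ ℚ[K₀]`. -/
def J2 (m : ℕ) : Submodule ℚ (MonoidAlgebra ℚ G ⊗[ℚ] MonoidAlgebra ℚ G) :=
  ⨆ p : {p : ℕ × ℕ // p.1 + p.2 = m}, tensorSub (K.J p.1.1) (K.J p.1.2)

theorem tmul_mem_J2 {i j m : ℕ} (h : i + j = m) {x y : MonoidAlgebra ℚ G} (hx : x ∈ K.J i)
    (hy : y ∈ K.J j) : x ⊗ₜ y ∈ K.J2 m :=
  le_iSup (fun p : {p : ℕ × ℕ // p.1 + p.2 = m} => tensorSub (K.J p.1.1) (K.J p.1.2))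
    ⟨(i, j), h⟩ (Submodule.apply_mem_map₂ _ hx hy)

theorem J2_antitone : Antitone K.J2 := by
  intro m n h
  refine iSup_le ?_
  rintro ⟨⟨i, j⟩, hij⟩
  refine Submodule.map₂_le.2 fun x hx y hy => ?_
  dsimp only at hij hx hy
  exact K.tmul_mem_J2 (i := min i m) (j := m - min i m) (by omega)
    (K.J_antitone (min_le_left _ _) hx) (K.J_antitone (by omega) hy)

theorem J2_mul_le (m n : ℕ) : K.J2 m * K.J2 n ≤ K.J2 (m + n) := by
  unfold J2
  rw [Submodule.iSup_mul]
  refine iSup_le fun p => ?_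
  rw [Submodule.mul_iSup]
  refine iSup_le fun q => ?_
  unfold tensorSub
  rw [Submodule.map₂_eq_span_image2, Submodule.map₂_eq_span_image2, Submodule.span_mul_span,
    Submodule.span_le]
  rintro _ ⟨_, ⟨x, hx, y, hy, rfl⟩, _, ⟨x', hx', y', hy', rfl⟩, rfl⟩
  have e : (x ⊗ₜ[ℚ] y) * (x' ⊗ₜ[ℚ] y') = (x * x') ⊗ₜ[ℚ] (y * y') :=
    Algebra.TensorProduct.tmul_mul_tmul x x' y y'
  change (x ⊗ₜ[ℚ] y) * (x' ⊗ₜ[ℚ] y') ∈ K.J2 (m + n)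
  rw [e]
  refine K.tmul_mem_J2 (i := p.1.1 + q.1.1) (j := p.1.2 + q.1.2) ?_
    (K.J_mul_le _ _ (Submodule.mul_mem_mul hx hx')) (K.J_mul_le _ _ (Submodule.mul_mem_mul hy hy'))
  have := p.2
  have := q.2
  omega

theorem comul_I {i : ℕ+} {x : MonoidAlgebra ℚ G} (hx : x ∈ K.I i) :
    Coalgebra.comul (R := ℚ) x ∈ K.J2 i := by
  set π := MonoidAlgebra.mapDomainBialgHom ℚ (QuotientGroup.mk' (K.sub i)) with hπ
  have hsurj : Function.Surjective π.toCoalgHom.toLinearMap := by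
    intro y
    induction y using MonoidAlgebra.induction_linear with
    | zero => exact ⟨0, map_zero _⟩
    | add u v hu hv =>
      obtain ⟨u, rfl⟩ := hu
      obtain ⟨v, rfl⟩ := hv
      exact ⟨u + v, map_add _ u v⟩
    | single g q =>
      obtain ⟨g, rfl⟩ := QuotientGroup.mk_surjective g
      exact ⟨MonoidAlgebra.single g q, MonoidAlgebra.mapDomainBialgHom_single _ _ _⟩
  have hker : Coalgebra.comul (R := ℚ) x ∈ LinearMap.ker (TensorProduct.map
      π.toCoalgHom.toLinearMap
      π.toCoalgHom.toLinearMap) := by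
    have := CoalgHomClass.map_comp_comul_apply π x
    rw [K.mem_I.1 hx, map_zero] at this
    exact this
  have hex : Function.Exact (K.I i).subtype
      π.toCoalgHom.toLinearMap :=
    LinearMap.exact_subtype_ker_map _
  rw [TensorProduct.map_ker hex hsurj hex hsurj] at hker
  refine (sup_le ?_ ?_ :  _ ≤ K.J2 i) hker
  · rintro _ ⟨t, rfl⟩
    induction t using TensorProduct.induction_on with
    | zero => rw [map_zero]; exact zero_mem _
    | add u v hu hv => rw [map_add]; exact add_mem hu hv
    | tmul a b => exact K.tmul_mem_J2 (i := 0) (zero_add _) trivial (K.I_le_J i b.2)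
  · rintro _ ⟨t, rfl⟩
    induction t using TensorProduct.induction_on with
    | zero => rw [map_zero]; exact zero_mem _
    | add u v hu hv => rw [map_add]; exact add_mem hu hv
    | tmul a b => exact K.tmul_mem_J2 (j := 0) (add_zero _) (K.I_le_J i a.2) trivial

theorem comul_prod (l : List ℕ+) : (l.map fun i : ℕ+ => K.I i).prod ≤
    (K.J2 (l.map fun i : ℕ+ => (i : ℕ)).sum).comap (Coalgebra.comul (R := ℚ)) := by
  induction l with
  | nil =>
    rw [List.map_nil, List.prod_nil, Submodule.one_le, Submodule.mem_comap, Bialgebra.comul_one]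
    exact K.tmul_mem_J2 (i := 0) (j := 0) rfl trivial trivial
  | cons i l ih =>
    rw [List.map_cons, List.prod_cons, List.map_cons, List.sum_cons]
    refine Submodule.mul_le.2 fun x hx y hy => ?_
    rw [Submodule.mem_comap, Bialgebra.comul_mul]
    exact K.J2_mul_le _ _ (Submodule.mul_mem_mul (K.comul_I hx) (ih hy))

theorem counit_I {i : ℕ} {x : MonoidAlgebra ℚ G} (hx : x ∈ K.I i) :
    Coalgebra.counit (R := ℚ) x = 0 := by
  have := CoalgHomClass.counit_comp_apply
    (MonoidAlgebra.mapDomainBialgHom ℚ (QuotientGroup.mk' (K.sub i))) x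
  rw [← this, K.mem_I.1 hx, map_zero]

theorem antipode_I {i : ℕ} {x : MonoidAlgebra ℚ G} (hx : x ∈ K.I i) :
    HopfAlgebra.antipode ℚ x ∈ K.I i := by
  have key : ∀ x : MonoidAlgebra ℚ G,
      MonoidAlgebra.mapDomainBialgHom ℚ (QuotientGroup.mk' (K.sub i)) (HopfAlgebra.antipode ℚ x) =
      HopfAlgebra.antipode ℚ
        (MonoidAlgebra.mapDomainBialgHom ℚ (QuotientGroup.mk' (K.sub i)) x) := by
    intro x
    induction x using MonoidAlgebra.induction_linear with
    | zero => simp only [map_zero]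
    | add u v hu hv => simp only [map_add, hu, hv]
    | single g q => simp [MonoidAlgebra.antipode_single]
  rw [mem_I, key, K.mem_I.1 hx, map_zero]

theorem antipode_prod (l : List ℕ+) : (l.map fun i : ℕ+ => K.I i).prod ≤
    ((l.reverse.map fun i : ℕ+ => K.I i).prod).comap (HopfAlgebra.antipode ℚ) := by
  induction l with
  | nil =>
    rw [List.map_nil, List.prod_nil, Submodule.one_le, Submodule.mem_comap,
      HopfAlgebra.antipode_one]
    exact Submodule.one_le.1 le_rfl
  | cons i l ih =>
    rw [List.map_cons, List.prod_cons, List.reverse_cons, List.map_append, List.prod_append]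
    refine Submodule.mul_le.2 fun x hx y hy => ?_
    rw [Submodule.mem_comap, HopfAlgebra.antipode_mul_antidistrib]
    refine Submodule.mul_mem_mul (ih hy) ?_
    simpa using K.antipode_I hx

/-- The filtered Hopf algebra `J_*^ℚ(K)` on the group algebra `ℚ[K₀]`. -/
def groupAlgebraFiltration : HopfFiltration (MonoidAlgebra ℚ G) where
  J := K.J
  J_zero := rfl
  antitone := K.J_antitone
  mul_le := K.J_mul_le
  comul_mem m x hx := by
    change _ ∈ K.J2 m
    cases m with
    | zero =>
      have : K.J2 0 = ⊤ := by
        rw [eq_top_iff, ← TensorProduct.map₂_mk_top_top_eq_top]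
        exact Submodule.map₂_le.2 fun a _ b _ => K.tmul_mem_J2 (i := 0) (j := 0) rfl trivial trivial
      rw [this]
      trivial
    | succ m =>
      have : K.J (m + 1) ≤ (K.J2 (m + 1)).comap (Coalgebra.comul (R := ℚ)) :=
        iSup_le fun l => (K.comul_prod l.1).trans (Submodule.comap_mono (K.J2_antitone l.2.2))
      exact this hx
  counit_eq_zero m hm x hx := by
    obtain ⟨m, rfl⟩ : ∃ k, m = k + 1 := ⟨m - 1, by omega⟩
    have : K.J (m + 1) ≤ LinearMap.ker (Coalgebra.counit (R := ℚ) (A := MonoidAlgebra ℚ G)) := by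
      refine iSup_le ?_
      rintro ⟨l, hl, -⟩
      cases l with
      | nil => exact absurd rfl hl
      | cons i l =>
        rw [List.map_cons, List.prod_cons]
        refine Submodule.mul_le.2 fun a ha b _ => ?_
        rw [LinearMap.mem_ker, Bialgebra.counit_mul, K.counit_I ha, zero_mul]
    exact this hx
  antipode_mem m x hx := by
    cases m with
    | zero => trivial
    | succ m =>
      have : K.J (m + 1) ≤ (K.J (m + 1)).comap (HopfAlgebra.antipode ℚ) :=
        iSup_le fun l => (K.antipode_prod l.1).trans
          (Submodule.comap_mono (K.prod_I_le (by simpa using l.2.1) (by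
            rw [List.map_reverse, List.sum_reverse]; exact l.2.2)))
      exact this hx

/-- `K` is formal: the complete Hopf algebra `lim_k ℚ[K₀] / J_k^ℚ` is isomorphic to
`∏_k J_k^ℚ / J_{k+1}^ℚ` through an isomorphism whose associated graded is the identity. -/
def IsFormal : Prop := K.groupAlgebraFiltration.IsFormal

end ExtendedNSeries
end

/-!
The idea is to identify the completed crossed product `Û` with `∏ J_k / J_{k+1}` as a Hopf algebra.
Both conditions then say the same thing about a homomorphism `Φ : ℚ[K₀] → ∏ J_k / J_{k+1}`: that
`Φ` is compatible with comultiplications and counits, and that `Φ(a)` is the class of `a` up to terms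
of higher degree, for every `a ∈ J_n`.

* Formality is equivalent to the existence of such a `Φ`. An isomorphism of completions restricts to
  `ℚ[K₀]` (`HopfFiltration.IsFormal.exists_algHom`); conversely `Φ` extends to the completion, and a
  filtered map between complete filtered spaces which is the identity on the associated graded is
  bijective and strict (`HopfFiltration.isFormal_of_algHom`).

* The assignments `k ↦ k - 1` for `k ∈ K_m`, `m ≥ 1`, and `g ↦ g` in degree `0` define the comparison
  homomorphism `U → ∏ J_k / J_{k+1}` (`ExtendedNSeries.comparison`). It is onto in each degree,
  because `J_n` is spanned by the products `(k₁ - 1) ⋯ (k_p - 1) g` of weight at least `n`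
  (`ExtendedNSeries.J_eq_prodSpan`), and it is compatible with comultiplications and counits
  (`ExtendedNSeries.grHatComul_comparison`, `ExtendedNSeries.grHatCounit_comparison`). This is enough
  to obtain `Φ` from an expansion (`ExtendedNSeries.IsExpansion.isFormal`).

* To obtain an expansion from `Φ` the comparison homomorphism has to be inverted, so its injectivity
  is needed (`ExtendedNSeries.comparison_injective`). This is Quillen's theorem for the series `K_*`,
  and it has two ingredients.

  The first is that `(K_m / K_{m+1}) ⊗ ℚ` embeds into `J_m / J_{m+1}`
  (`ExtendedNSeries.eq_zero_of_symbLin_eq_zero`). It suffices to know that `J_n ∩ ℚ[K_m]` is spanned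
  by the products as above with all factors in `K_m`. For `m = 1` this follows from the projection to
  a coset. The passage from `K_w` to `K_{w+1}` is made by adjoining to a group `N` between `K_{w+1}`
  and `K_w` one element `t ∈ K_w` at a time
  (`ExtendedNSeries.grpSpan_inf_prodSpan_adjoin_le`), followed by Zorn's lemma. In the truncated
  algebra `ℚ[N] / J_n(N)` the elements of `N` are unipotent, so the generator `t^p` of `⟨t⟩ ∩ N` has
  a `p`-th root `r` (with `r = 1` if `⟨t⟩ ∩ N` is trivial), and `a t^j ↦ a r^j` extends the projection
  of `ℚ[N]` to this algebra to a linear map on `ℚ[N⟨t⟩]` which respects the filtrations.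

  The second ingredient is that a family of linear maps on `U(L)`, for a Lie algebra `L` over `ℚ`,
  whose common kernel is a coideal is jointly injective as soon as it is so on `ℚ ⊕ L`
  (`UniversalEnvelopingAlgebra.eq_zero_of_forall_eq_zero`). A nonzero element of the kernel of minimal length
  is primitive, since its reduced coproduct involves shorter products. The convolution square of the
  identity multiplies primitive elements by `2` and products of `n` elements of `L` by `2 ^ n` up to
  shorter ones, so a primitive element has length at most `1`.
-/

noncomputable section

/-! ### Formality through algebra homomorphisms on the uncompleted Hopf algebra -/

namespace HopfFiltration

variable {A : Type*} [Ring A] [HopfAlgebra ℚ A] (F : HopfFiltration A)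

/-- The element of `∏_k J_k / J_{k+1}` whose only nonzero component is the class of `a ∈ J_n`,
placed in degree `n`. -/
def mono (n : ℕ) (a : A) (ha : a ∈ F.J n) : F.GrHat := Pi.single n (F.grMk n ⟨a, ha⟩)

theorem grHat_ext {x y : F.GrHat} (h : ∀ n, F.grComp n x = F.grComp n y) : x = y := funext h

theorem grComp_mono_self (n : ℕ) (a : A) (ha : a ∈ F.J n) :
    F.grComp n (F.mono n a ha) = F.grMk n ⟨a, ha⟩ :=
  Pi.single_eq_same (M := F.Gr) n _

theorem grComp_mono_of_ne {n k : ℕ} (h : k ≠ n) (a : A) (ha : a ∈ F.J n) :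
    F.grComp k (F.mono n a ha) = 0 :=
  Pi.single_eq_of_ne (M := F.Gr) h _

theorem mono_eq_ofSeries (n : ℕ) (a : A) (ha : a ∈ F.J n)
    (h : ∀ k, PowerSeries.coeff k (PowerSeries.monomial n a) ∈ F.J k) :
    F.mono n a ha = F.ofSeries (PowerSeries.monomial n a) h := by
  refine F.grHat_ext fun k => ?_
  by_cases hk : k = n
  · subst hk
    rw [grComp_mono_self]
    change _ = F.grMk k _
    congr 1
    ext
    simp
  · rw [F.grComp_mono_of_ne hk]
    refine (F.grMk_eq_zero.2 ?_).symm
    simp [PowerSeries.coeff_monomial, hk]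

theorem coeff_monomial_mem {n : ℕ} {a : A} (ha : a ∈ F.J n) (k : ℕ) :
    PowerSeries.coeff k (PowerSeries.monomial n a) ∈ F.J k := by
  rw [PowerSeries.coeff_monomial]
  split_ifs with h
  · subst h; exact ha
  · exact zero_mem _

theorem mono_mul {m n : ℕ} {a b : A} (ha : a ∈ F.J m) (hb : b ∈ F.J n) :
    F.mono m a ha * F.mono n b hb = F.mono (m + n) (a * b) (F.mul_mem ha hb) := by
  rw [F.mono_eq_ofSeries m a ha (F.coeff_monomial_mem ha),
    F.mono_eq_ofSeries n b hb (F.coeff_monomial_mem hb),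
    F.mono_eq_ofSeries _ _ _ (F.coeff_monomial_mem (F.mul_mem ha hb)), ofSeries_mul]
  exact F.ofSeries_congr _ _ (PowerSeries.monomial_mul_monomial _ _ _ _)

theorem mono_one : F.mono 0 1 (F.mem_zero 1) = 1 := rfl

theorem mono_add {n : ℕ} {a b : A} (ha : a ∈ F.J n) (hb : b ∈ F.J n) :
    F.mono n (a + b) (add_mem ha hb) = F.mono n a ha + F.mono n b hb := by
  exact (congrArg (Pi.single (M := F.Gr) n) (map_add (F.grMk n) ⟨a, ha⟩ ⟨b, hb⟩)).trans
    (Pi.single_add (f := F.Gr) n _ _)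

theorem mono_sub {n : ℕ} {a b : A} (ha : a ∈ F.J n) (hb : b ∈ F.J n) :
    F.mono n (a - b) (sub_mem ha hb) = F.mono n a ha - F.mono n b hb := by
  rw [eq_sub_iff_add_eq, ← mono_add]
  congr 1
  exact sub_add_cancel a b

theorem mono_smul {n : ℕ} {a : A} (q : ℚ) (ha : a ∈ F.J n) :
    F.mono n (q • a) (Submodule.smul_mem _ q ha) = q • F.mono n a ha := by
  exact (congrArg (Pi.single (M := F.Gr) n) (map_smul (F.grMk n) q ⟨a, ha⟩)).trans
    (Pi.single_smul (f := F.Gr) n q _)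

theorem mono_congr {n : ℕ} {a b : A} (ha : a ∈ F.J n) (hb : b ∈ F.J n)
    (h : a - b ∈ F.J (n + 1)) : F.mono n a ha = F.mono n b hb := by
  unfold mono
  congr 1
  rw [← sub_eq_zero, ← map_sub]
  exact F.grMk_eq_zero.2 h

theorem mono_eq_zero {n : ℕ} {a : A} (ha : a ∈ F.J n) (h : a ∈ F.J (n + 1)) :
    F.mono n a ha = 0 := by
  unfold mono
  rw [F.grMk_eq_zero.2 h]
  exact Pi.single_zero n

theorem mono_cast {m n : ℕ} (h : m = n) {a : A} (ha : a ∈ F.J m) :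
    F.mono m a ha = F.mono n a (h ▸ ha) := by subst h; rfl

theorem mono_mem {n : ℕ} {a : A} (ha : a ∈ F.J n) : F.mono n a ha ∈ F.grHatGE n :=
  fun _ hk => F.grComp_mono_of_ne hk.ne a ha

theorem grHatGE_antitone {m n : ℕ} (h : m ≤ n) : F.grHatGE n ≤ F.grHatGE m :=
  fun _ hx k hk => hx k (hk.trans_le h)

theorem grComp_mul (x y : F.GrHat) (n : ℕ) :
    F.grComp n (x * y) = ∑ p : Finset.HasAntidiagonal.antidiagonal n,
      F.grMul p.1.1 p.1.2 n (Finset.HasAntidiagonal.mem_antidiagonal.1 p.2)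
        (F.grComp p.1.1 x) (F.grComp p.1.2 y) := rfl

theorem grHatGE_mul {m n : ℕ} {x y : F.GrHat} (hx : x ∈ F.grHatGE m) (hy : y ∈ F.grHatGE n) :
    x * y ∈ F.grHatGE (m + n) := by
  intro k hk
  rw [grComp_mul]
  refine Finset.sum_eq_zero ?_
  rintro ⟨⟨i, j⟩, hij⟩ -
  have := Finset.HasAntidiagonal.mem_antidiagonal.1 hij
  dsimp only at this ⊢
  by_cases hi : i < m
  · rw [hx i hi, map_zero, LinearMap.zero_apply]
  · rw [hy j (by omega), map_zero]

theorem grComp_mul_congr {x x' y y' : F.GrHat} {n : ℕ}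
    (hx : ∀ k ≤ n, F.grComp k x = F.grComp k x') (hy : ∀ k ≤ n, F.grComp k y = F.grComp k y') :
    F.grComp n (x * y) = F.grComp n (x' * y') := by
  rw [grComp_mul, grComp_mul]
  refine Finset.sum_congr rfl ?_
  rintro ⟨⟨i, j⟩, hij⟩ -
  have := Finset.HasAntidiagonal.mem_antidiagonal.1 hij
  dsimp only at this ⊢
  rw [hx i (by omega), hy j (by omega)]

/-- `Φ` agrees with the identity on the associated graded: `Φ(a)` is the class of `a` in degree
`n`, up to terms of higher degree, for `a ∈ J_n`. -/
def LeadingTermId (Φ : A →ₐ[ℚ] F.GrHat) : Prop :=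
  ∀ n a (ha : a ∈ F.J n), Φ a - F.mono n a ha ∈ F.grHatGE (n + 1)

/-- `Φ` is compatible with the comultiplications, in each bidegree. -/
def ComulCompat (Φ : A →ₐ[ℚ] F.GrHat) : Prop :=
  ∀ i j a, TensorProduct.map (F.grComp i ∘ₗ Φ.toLinearMap) (F.grComp j ∘ₗ Φ.toLinearMap)
    (Coalgebra.comul (R := ℚ) a) = F.grHatComul i j (Φ a)

/-- `Φ` is compatible with the counits. -/
def CounitCompat (Φ : A →ₐ[ℚ] F.GrHat) : Prop :=
  ∀ a, F.grHatCounit (Φ a) = Coalgebra.counit (R := ℚ) a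

variable {F} in
theorem LeadingTermId.map_mem {Φ : A →ₐ[ℚ] F.GrHat} (hΦ : F.LeadingTermId Φ) {n : ℕ} {a : A}
    (ha : a ∈ F.J n) : Φ a ∈ F.grHatGE n := by
  have h := add_mem (F.grHatGE_antitone (Nat.le_succ n) (hΦ n a ha)) (F.mono_mem ha)
  rwa [sub_add_cancel] at h

variable {F} in
theorem LeadingTermId.grComp_eq {Φ : A →ₐ[ℚ] F.GrHat} (hΦ : F.LeadingTermId Φ) {n : ℕ} {a : A}
    (ha : a ∈ F.J n) : F.grComp n (Φ a) = F.grMk n ⟨a, ha⟩ := by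
  have h := hΦ n a ha n (Nat.lt_succ_self n)
  rwa [map_sub, grComp_mono_self, sub_eq_zero] at h

theorem proj_surjective (m : ℕ) : Function.Surjective (F.proj m) :=
  Ideal.Quotient.mk_surjective

theorem proj_eq_proj {m : ℕ} {a b : A} : F.proj m a = F.proj m b ↔ a - b ∈ F.J m := by
  rw [← sub_eq_zero, ← map_sub, proj_eq_zero]

/-- An element of the completion is represented modulo `Ĵ_n` by an element of `A`. -/
theorem exists_approx (x : F.Completion) (n : ℕ) : ∃ a : A, ∀ k ≤ n, x.1 k = F.proj k a := by
  obtain ⟨a, ha⟩ := F.proj_surjective n (x.1 n)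
  refine ⟨a, fun k hk => ?_⟩
  rw [← x.2 k n hk, ← ha]
  rfl

/-- The degree `n` component of the extension of `Φ` to the completion, as a map on
`A / J_{n+1}`. -/
def levelExt {Φ : A →ₐ[ℚ] F.GrHat} (hΦ : F.LeadingTermId Φ) (n : ℕ) :
    A ⧸ F.ideal (n + 1) →ₗ[ℚ] F.Gr n :=
  idealLift _ (F.grComp n ∘ₗ Φ.toLinearMap) (fun _ hx => hΦ.map_mem hx n (Nat.lt_succ_self n))

theorem levelExt_proj {Φ : A →ₐ[ℚ] F.GrHat} (hΦ : F.LeadingTermId Φ) (n : ℕ) (a : A) :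
    F.levelExt hΦ n (F.proj (n + 1) a) = F.grComp n (Φ a) := rfl

/-- The extension of `Φ` to the completion, as a linear map. -/
def extLinear {Φ : A →ₐ[ℚ] F.GrHat} (hΦ : F.LeadingTermId Φ) : F.Completion →ₗ[ℚ] F.GrHat where
  toFun x := fun n => F.levelExt hΦ n (x.1 (n + 1))
  map_add' x y := funext fun n => map_add (F.levelExt hΦ n) (x.1 (n + 1)) (y.1 (n + 1))
  map_smul' q x := funext fun n => map_smul (F.levelExt hΦ n) q (x.1 (n + 1))

theorem grComp_extLinear {Φ : A →ₐ[ℚ] F.GrHat} (hΦ : F.LeadingTermId Φ) {n k : ℕ} (hk : k < n)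
    {x : F.Completion} {a : A} (h : ∀ k ≤ n, x.1 k = F.proj k a) :
    F.grComp k (F.extLinear hΦ x) = F.grComp k (Φ a) := by
  change F.levelExt hΦ k (x.1 (k + 1)) = _
  rw [h (k + 1) hk, levelExt_proj]

/-- The extension of `Φ` to the completion. -/
def ext {Φ : A →ₐ[ℚ] F.GrHat} (hΦ : F.LeadingTermId Φ) : F.Completion →ₐ[ℚ] F.GrHat :=
  AlgHom.ofLinearMap (F.extLinear hΦ)
    (by
      refine F.grHat_ext fun n => ?_
      rw [F.grComp_extLinear hΦ (Nat.lt_succ_self n) (x := 1) (a := 1) (fun _ _ => rfl), map_one])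
    (by
      intro x y
      refine F.grHat_ext fun n => ?_
      obtain ⟨a, ha⟩ := F.exists_approx x (n + 1)
      obtain ⟨b, hb⟩ := F.exists_approx y (n + 1)
      have hab : ∀ k ≤ n + 1, (x * y).1 k = F.proj k (a * b) := by
        intro k hk
        change x.1 k * y.1 k = _
        rw [ha k hk, hb k hk]
        rfl
      rw [F.grComp_extLinear hΦ (Nat.lt_succ_self n) hab, map_mul]
      exact F.grComp_mul_congr
        (fun k hk => (F.grComp_extLinear hΦ (Nat.lt_succ_of_le hk) ha).symm)
        (fun k hk => (F.grComp_extLinear hΦ (Nat.lt_succ_of_le hk) hb).symm))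

theorem grComp_ext {Φ : A →ₐ[ℚ] F.GrHat} (hΦ : F.LeadingTermId Φ) {n k : ℕ} (hk : k < n)
    {x : F.Completion} {a : A} (h : ∀ k ≤ n, x.1 k = F.proj k a) :
    F.grComp k (F.ext hΦ x) = F.grComp k (Φ a) :=
  F.grComp_extLinear hΦ hk h

theorem ext_ofA {Φ : A →ₐ[ℚ] F.GrHat} (hΦ : F.LeadingTermId Φ) (a : A) :
    F.ext hΦ (F.ofA a) = Φ a :=
  F.grHat_ext fun n => F.grComp_ext hΦ (Nat.lt_succ_self n) (fun _ _ => rfl)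

theorem ext_mem {Φ : A →ₐ[ℚ] F.GrHat} (hΦ : F.LeadingTermId Φ) {m : ℕ} {x : F.Completion}
    (hx : x ∈ F.hatJ m) : F.ext hΦ x ∈ F.grHatGE m := by
  obtain ⟨a, ha⟩ := F.exists_approx x m
  have ham : a ∈ F.J m := F.proj_eq_zero.1 ((ha m le_rfl).symm.trans hx)
  intro k hk
  rw [F.grComp_ext hΦ hk ha]
  exact hΦ.map_mem ham k hk

/-- The extension of `Φ` is strict for the filtrations, because it induces the identity on the
associated graded. -/
theorem mem_of_ext_mem {Φ : A →ₐ[ℚ] F.GrHat} (hΦ : F.LeadingTermId Φ) {m : ℕ} {x : F.Completion}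
    (hx : F.ext hΦ x ∈ F.grHatGE m) : x ∈ F.hatJ m := by
  induction m with
  | zero =>
    obtain ⟨a, ha⟩ := F.exists_approx x 0
    exact (ha 0 le_rfl).trans (F.proj_eq_zero.2 (F.mem_zero a))
  | succ m ih =>
    have hm := ih (F.grHatGE_antitone (Nat.le_succ m) hx)
    obtain ⟨a, ha⟩ := F.exists_approx x (m + 1)
    have ham : a ∈ F.J m := F.proj_eq_zero.1 ((ha m (Nat.le_succ m)).symm.trans hm)
    have h0 := hx m (Nat.lt_succ_self m)
    rw [F.grComp_ext hΦ (Nat.lt_succ_self m) ha, hΦ.grComp_eq ham, grMk_eq_zero] at h0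
    exact (ha (m + 1) le_rfl).trans (F.proj_eq_zero.2 h0)

theorem ext_injective {Φ : A →ₐ[ℚ] F.GrHat} (hΦ : F.LeadingTermId Φ) :
    Function.Injective (F.ext hΦ) := by
  rw [injective_iff_map_eq_zero]
  intro x hx
  refine Subtype.ext (funext fun m => ?_)
  exact F.mem_of_ext_mem hΦ (m := m) (by rw [hx]; exact zero_mem _)

/-- Successive approximation of a given element of `∏_k J_k / J_{k+1}`. -/
theorem ext_surjective {Φ : A →ₐ[ℚ] F.GrHat} (hΦ : F.LeadingTermId Φ) :
    Function.Surjective (F.ext hΦ) := by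
  intro y
  have step : ∀ n (a : A), (∀ k < n, F.grComp k (Φ a) = F.grComp k y) →
      ∃ b, b - a ∈ F.J n ∧ ∀ k < n + 1, F.grComp k (Φ b) = F.grComp k y := by
    intro n a ha
    obtain ⟨c, hc⟩ := Submodule.mkQ_surjective _ (F.grComp n y - F.grComp n (Φ a))
    refine ⟨a + c, by rw [add_sub_cancel_left]; exact c.2, fun k hk => ?_⟩
    rw [map_add, map_add]
    rcases Nat.lt_succ_iff_lt_or_eq.1 hk with hk | rfl
    · rw [hΦ.map_mem c.2 k hk, add_zero, ha k hk]
    · rw [hΦ.grComp_eq c.2]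
      change _ + Submodule.mkQ _ c = _
      rw [hc, add_sub_cancel]
  choose! nxt h1 h2 using step
  let s : ℕ → A := fun n => Nat.rec 0 (fun n a => nxt n a) n
  have hs : ∀ n, ∀ k < n, F.grComp k (Φ (s n)) = F.grComp k y := by
    intro n
    induction n with
    | zero => intro k hk; omega
    | succ n ih => exact h2 n (s n) ih
  have hd : ∀ n, s (n + 1) - s n ∈ F.J n := fun n => h1 n (s n) (hs n)
  have hd' : ∀ k l, k ≤ l → s l - s k ∈ F.J k := by
    intro k l hkl
    induction l, hkl using Nat.le_induction with
    | base => rw [sub_self]; exact zero_mem _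
    | succ l hkl ih =>
      rw [← sub_add_sub_cancel _ (s l)]
      exact add_mem (F.antitone hkl (hd l)) ih
  refine ⟨⟨fun n => F.proj n (s n), fun k l hkl => ?_⟩, F.grHat_ext fun n => ?_⟩
  · exact F.proj_eq_proj.2 (hd' k l hkl)
  · rw [F.grComp_ext hΦ (Nat.lt_succ_self n) (a := s (n + 1)), hs (n + 1) n (Nat.lt_succ_self n)]
    intro k hk
    exact (F.proj_eq_proj.2 (hd' k _ hk)).symm

/-- A filtered Hopf algebra is formal as soon as there is a Hopf algebra homomorphism to
`∏_k J_k / J_{k+1}` which is the identity on the associated graded: by completeness its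
extension to the completion is an isomorphism. -/
theorem isFormal_of_algHom (Φ : A →ₐ[ℚ] F.GrHat) (hΦ : F.LeadingTermId Φ)
    (hΔ : F.ComulCompat Φ) (hε : F.CounitCompat Φ) : F.IsFormal := by
  let e : F.Completion ≃ₐ[ℚ] F.GrHat :=
    AlgEquiv.ofBijective (F.ext hΦ) ⟨F.ext_injective hΦ, F.ext_surjective hΦ⟩
  have he : ∀ x, e x = F.ext hΦ x := fun _ => rfl
  have hmem : ∀ m, ∀ x ∈ F.hatJ m, e x ∈ F.grHatGE m := fun m x hx => F.ext_mem hΦ hx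
  have hlev : ∀ i, F.levelMap e.toLinearMap hmem i ∘ₗ F.proj (i + 1) =
      F.grComp i ∘ₗ Φ.toLinearMap := by
    intro i
    ext a
    change F.grComp i (F.ext hΦ (F.ofA a)) = _
    rw [ext_ofA]
    rfl
  refine ⟨⟨e, hmem, fun m y hy => ?_, fun i j x => ?_, fun x => ?_⟩, fun m x a hx => ?_⟩
  · refine F.mem_of_ext_mem hΦ ?_
    rw [← he, AlgEquiv.apply_symm_apply]
    exact hy
  · obtain ⟨a, ha⟩ := F.exists_approx x (i + 1 + (j + 1))
    have h1 : F.complComul (i + 1) (j + 1) x =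
        TensorProduct.map (F.proj (i + 1)) (F.proj (j + 1)) (Coalgebra.comul (R := ℚ) a) := by
      change F.comulLevel (i + 1) (j + 1) (x.1 (i + 1 + (j + 1))) = _
      rw [ha _ le_rfl]
      rfl
    rw [h1, ← LinearMap.comp_apply, ← TensorProduct.map_comp, hlev, hlev, hΔ i j a]
    change F.grComul i j (F.grComp (i + j) _) = F.grComul i j (F.grComp (i + j) _)
    rw [he, F.grComp_ext hΦ (by omega) ha]
  · obtain ⟨a, ha⟩ := F.exists_approx x 1
    have h1 : F.complCounit x = Coalgebra.counit (R := ℚ) a := by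
      change idealLift (F.ideal 1) Coalgebra.counit (F.counit_eq_zero 1 le_rfl) (x.1 1) = _
      rw [ha 1 le_rfl]
      rfl
    rw [h1, ← hε a]
    unfold grHatCounit
    rw [LinearMap.comp_apply, LinearMap.comp_apply, he, F.grComp_ext hΦ Nat.zero_lt_one ha]
  · have h1 : x.1 (m + 1) = F.proj (m + 1) a := sub_eq_zero.1 hx
    change F.levelExt hΦ m (x.1 (m + 1)) = _
    rw [h1, levelExt_proj]
    exact hΦ.grComp_eq a.2

/-- Conversely, an isomorphism as in the definition of formality restricts to a homomorphism on
the uncompleted Hopf algebra. -/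
theorem IsFormal.exists_algHom {F : HopfFiltration A} (h : F.IsFormal) :
    ∃ Φ : A →ₐ[ℚ] F.GrHat, F.LeadingTermId Φ ∧ F.ComulCompat Φ ∧ F.CounitCompat Φ := by
  obtain ⟨f, hf⟩ := h
  have hJ : ∀ n, ∀ a ∈ F.J n, F.ofA a ∈ F.hatJ n := fun n a ha => F.proj_eq_zero.2 ha
  refine ⟨(f.toAlgEquiv : F.Completion →ₐ[ℚ] F.GrHat).comp F.ofA, fun n a ha k hk => ?_,
    fun i j a => ?_, fun a => f.map_counit (F.ofA a)⟩
  · rw [map_sub, sub_eq_zero]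
    rcases Nat.lt_succ_iff_lt_or_eq.1 hk with hk | rfl
    · rw [F.grComp_mono_of_ne hk.ne]
      exact f.map_mem n _ (hJ n a ha) k hk
    · rw [grComp_mono_self]
      refine hf k (F.ofA a) ⟨a, ha⟩ ?_
      rw [sub_self]
      exact zero_mem _
  · exact (LinearMap.congr_fun (TensorProduct.map_comp
      (F.levelMap f.toAlgEquiv.toLinearMap f.map_mem i)
      (F.levelMap f.toAlgEquiv.toLinearMap f.map_mem j)
      (F.proj (i + 1)) (F.proj (j + 1))) (Coalgebra.comul (R := ℚ) a)).trans
      (f.map_comul i j (F.ofA a))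

end HopfFiltration

/-! ### Linear maps out of a group algebra -/

namespace MonoidAlgebra

variable {H M : Type*} [Group H] [AddCommGroup M] [Module ℚ M]

/-- The linear map on `ℚ[H]` with prescribed values on `H`. -/
def linExt (f : H → M) : MonoidAlgebra ℚ H →ₗ[ℚ] M :=
  Finsupp.linearCombination ℚ f ∘ₗ (coeffLinearEquiv ℚ : MonoidAlgebra ℚ H ≃ₗ[ℚ] _).toLinearMap

theorem linExt_of (f : H → M) (g : H) : linExt f (of ℚ H g) = f g := by
  change Finsupp.linearCombination ℚ f (Finsupp.single g 1) = f g
  rw [Finsupp.linearCombination_single, one_smul]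

theorem of_induction {p : MonoidAlgebra ℚ H → Prop} (x : MonoidAlgebra ℚ H)
    (of : ∀ g, p (of ℚ H g)) (add : ∀ x y, p x → p y → p (x + y))
    (smul : ∀ (q : ℚ) x, p x → p (q • x)) : p x :=
  MonoidAlgebra.induction_on (motive := p) x of add smul

theorem linHom_ext {f g : MonoidAlgebra ℚ H →ₗ[ℚ] M} (h : ∀ x, f (of ℚ H x) = g (of ℚ H x)) :
    f = g := by
  refine LinearMap.ext fun x => ?_
  induction x using of_induction with
  | of g => exact h g
  | add x y hx hy => rw [map_add, map_add, hx, hy]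
  | smul q x hx => rw [map_smul, map_smul, hx]

end MonoidAlgebra

open MonoidAlgebra (linExt linExt_of)

/-! ### Spanning sets of the filtration of the group algebra -/

namespace ExtendedNSeries

variable {G : Type*} [Group G] (K : ExtendedNSeries G)

/-- The filtered Hopf algebra `J_*` on `ℚ[K₀]`. -/
abbrev fil : HopfFiltration (MonoidAlgebra ℚ G) := K.groupAlgebraFiltration

/-- The element `k - 1` of the group algebra. -/
def inc (k : G) : MonoidAlgebra ℚ G := MonoidAlgebra.of ℚ G k - 1

/-- The product `(k₁ - 1) ⋯ (k_p - 1)`, for a list of elements `k_i ∈ K_{m_i}`. -/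
def incProd (l : List (Σ m : ℕ+, K.sub m)) : MonoidAlgebra ℚ G :=
  (l.map fun p => inc (p.2 : G)).prod

/-- The weight `m₁ + ⋯ + m_p` of a list of elements `k_i ∈ K_{m_i}`. -/
def wt (l : List (Σ m : ℕ+, K.sub m)) : ℕ := (l.map fun p => (p.1 : ℕ)).sum

theorem incProd_cons (p : Σ m : ℕ+, K.sub m) (l : List (Σ m : ℕ+, K.sub m)) :
    K.incProd (p :: l) = inc (p.2 : G) * K.incProd l := by simp [incProd]

theorem wt_cons (p : Σ m : ℕ+, K.sub m) (l : List (Σ m : ℕ+, K.sub m)) :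
    K.wt (p :: l) = p.1 + K.wt l := by simp [wt]

/-- The linear span of a subgroup `N` in the group algebra of `G`. -/
def grpSpan (N : Subgroup G) : Submodule ℚ (MonoidAlgebra ℚ G) :=
  Submodule.span ℚ (MonoidAlgebra.of ℚ G '' N)

/-- The linear span of the elements `(k₁ - 1) ⋯ (k_p - 1) g` with `k_i ∈ K_{m_i} ∩ N`, `g ∈ N` and
`m₁ + ⋯ + m_p ≥ n`. This is the `n`-th term of the filtration of `ℚ[N]` attached to the series
`(K_m ∩ N)_m`, viewed inside `ℚ[G]`. -/
def prodSpan (N : Subgroup G) (n : ℕ) : Submodule ℚ (MonoidAlgebra ℚ G) :=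
  Submodule.span ℚ {x | ∃ l : List (Σ m : ℕ+, K.sub m), (∀ p ∈ l, (p.2 : G) ∈ N) ∧
    n ≤ K.wt l ∧ ∃ g ∈ N, x = K.incProd l * MonoidAlgebra.of ℚ G g}

theorem of_mem_grpSpan {N : Subgroup G} {g : G} (hg : g ∈ N) :
    MonoidAlgebra.of ℚ G g ∈ grpSpan N :=
  Submodule.subset_span ⟨g, hg, rfl⟩

theorem incProd_mul_mem {N : Subgroup G} {n : ℕ} {l : List (Σ m : ℕ+, K.sub m)}
    (hl : ∀ p ∈ l, (p.2 : G) ∈ N) (hn : n ≤ K.wt l) {g : G} (hg : g ∈ N) :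
    K.incProd l * MonoidAlgebra.of ℚ G g ∈ K.prodSpan N n :=
  Submodule.subset_span ⟨l, hl, hn, g, hg, rfl⟩

theorem of_mem_prodSpan {N : Subgroup G} {g : G} (hg : g ∈ N) :
    MonoidAlgebra.of ℚ G g ∈ K.prodSpan N 0 := by
  have := K.incProd_mul_mem (N := N) (n := 0) (l := []) (by simp) (Nat.zero_le _) hg
  simpa [incProd] using this

theorem inc_mem_prodSpan {N : Subgroup G} {m : ℕ} (hm : 0 < m) {k : G} (hk : k ∈ K.sub m)
    (hN : k ∈ N) : inc k ∈ K.prodSpan N m := by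
  have := K.incProd_mul_mem (N := N) (n := m) (l := [⟨⟨m, hm⟩, ⟨k, hk⟩⟩]) (by simpa using hN)
    (by simp [wt]) N.one_mem
  rw [map_one, mul_one] at this
  simpa [incProd] using this

theorem prodSpan_antitone (N : Subgroup G) : Antitone (K.prodSpan N) := by
  intro m n h
  refine Submodule.span_mono ?_
  rintro _ ⟨l, hl, hn, g, hg, rfl⟩
  exact ⟨l, hl, h.trans hn, g, hg, rfl⟩

theorem prodSpan_mono {N N' : Subgroup G} (h : N ≤ N') (n : ℕ) :
    K.prodSpan N n ≤ K.prodSpan N' n := by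
  refine Submodule.span_mono ?_
  rintro _ ⟨l, hl, hn, g, hg, rfl⟩
  exact ⟨l, fun p hp => h (hl p hp), hn, g, h hg, rfl⟩

/-- Conjugation of a list of elements of the groups `K_m`. -/
def conjList (g : G) (l : List (Σ m : ℕ+, K.sub m)) : List (Σ m : ℕ+, K.sub m) :=
  l.map fun p => ⟨p.1, ⟨g * p.2 * g⁻¹, (K.normal p.1).conj_mem p.2 p.2.2 g⟩⟩

theorem wt_conjList (g : G) (l : List (Σ m : ℕ+, K.sub m)) : K.wt (K.conjList g l) = K.wt l := by
  simp [wt, conjList, Function.comp_def]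

theorem of_mul_inc (g k : G) :
    MonoidAlgebra.of ℚ G g * inc k = inc (g * k * g⁻¹) * MonoidAlgebra.of ℚ G g := by
  simp only [inc, mul_sub, sub_mul, ← map_mul, mul_one, one_mul, inv_mul_cancel_right]

theorem of_mul_incProd (g : G) (l : List (Σ m : ℕ+, K.sub m)) :
    MonoidAlgebra.of ℚ G g * K.incProd l =
      K.incProd (K.conjList g l) * MonoidAlgebra.of ℚ G g := by
  induction l with
  | nil => simp [incProd, conjList]
  | cons p l ih =>
    rw [incProd_cons, ← mul_assoc, of_mul_inc, mul_assoc, ih, ← mul_assoc]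
    simp only [conjList, List.map_cons, incProd_cons]

theorem prodSpan_mul_le (N : Subgroup G) (m n : ℕ) :
    K.prodSpan N m * K.prodSpan N n ≤ K.prodSpan N (m + n) := by
  unfold prodSpan
  rw [Submodule.span_mul_span]
  refine Submodule.span_mono ?_
  rintro _ ⟨_, ⟨l, hl, hm, g, hg, rfl⟩, _, ⟨l', hl', hn, h, hh, rfl⟩, rfl⟩
  refine ⟨l ++ K.conjList g l', ?_, ?_, g * h, N.mul_mem hg hh, ?_⟩
  · intro p hp
    rcases List.mem_append.1 hp with hp | hp
    · exact hl p hp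
    · obtain ⟨q, hq, rfl⟩ := List.mem_map.1 hp
      exact N.mul_mem (N.mul_mem hg (hl' q hq)) (N.inv_mem hg)
  · have : K.wt (l ++ K.conjList g l') = K.wt l + K.wt l' := by
      rw [← K.wt_conjList g l']
      simp [wt]
    rw [this]
    exact add_le_add hm hn
  · have : K.incProd (l ++ K.conjList g l') = K.incProd l * K.incProd (K.conjList g l') := by
      simp [incProd]
    dsimp only
    rw [this, map_mul, mul_assoc, mul_assoc, ← mul_assoc (MonoidAlgebra.of ℚ G g), of_mul_incProd]
    simp only [mul_assoc]

theorem inc_mem_I {m : ℕ} {k : G} (hk : k ∈ K.sub m) : inc k ∈ K.I m := by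
  rw [mem_I, inc, map_sub, map_one, MonoidAlgebra.of_apply,
    MonoidAlgebra.mapDomainBialgHom_single, sub_eq_zero, MonoidAlgebra.one_def]
  congr 1
  exact (QuotientGroup.eq_one_iff k).2 hk

theorem inc_mem_J {m : ℕ} {k : G} (hk : k ∈ K.sub m) : inc k ∈ K.fil.J m := by
  cases m with
  | zero => trivial
  | succ m => exact K.I_le_J ⟨m + 1, m.succ_pos⟩ (K.inc_mem_I hk)

theorem incProd_mem_J (l : List (Σ m : ℕ+, K.sub m)) : K.incProd l ∈ K.fil.J (K.wt l) := by
  induction l with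
  | nil => trivial
  | cons p l ih =>
    rw [incProd_cons, wt_cons]
    exact K.J_mul_le _ _ (Submodule.mul_mem_mul (K.inc_mem_J p.2.2) ih)

theorem incProd_mul_of_mem_J (l : List (Σ m : ℕ+, K.sub m)) (g : G) :
    K.incProd l * MonoidAlgebra.of ℚ G g ∈ K.fil.J (K.wt l) :=
  K.J_mul_le (K.wt l) 0 (Submodule.mul_mem_mul (K.incProd_mem_J l) trivial)

theorem I_le_prodSpan (m : ℕ+) : K.I m ≤ K.prodSpan ⊤ m := by
  let s : G ⧸ K.sub m → G := Quotient.out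
  have hs : ∀ g : G, g * (s g)⁻¹ ∈ K.sub m := by
    intro g
    rw [← QuotientGroup.eq_one_iff, QuotientGroup.mk_mul, QuotientGroup.mk_inv,
      QuotientGroup.out_eq', mul_inv_cancel]
  let σ : MonoidAlgebra ℚ (G ⧸ K.sub m) →ₗ[ℚ] MonoidAlgebra ℚ G :=
    linExt fun c => MonoidAlgebra.of ℚ G (s c)
  have key : ∀ x, x - σ (MonoidAlgebra.mapDomainBialgHom ℚ (QuotientGroup.mk' (K.sub m)) x) ∈
      K.prodSpan ⊤ m := by
    intro x
    induction x using MonoidAlgebra.of_induction with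
    | of g =>
      rw [MonoidAlgebra.of_apply, MonoidAlgebra.mapDomainBialgHom_single]
      have h1 : σ (MonoidAlgebra.single (QuotientGroup.mk' (K.sub m) g) 1) =
          MonoidAlgebra.of ℚ G (s g) := linExt_of _ _
      have h2 : MonoidAlgebra.single g (1 : ℚ) - MonoidAlgebra.of ℚ G (s g) =
          inc (g * (s g)⁻¹) * MonoidAlgebra.of ℚ G (s g) := by
        rw [inc, sub_mul, one_mul, ← map_mul, inv_mul_cancel_right]
        rfl
      rw [h1, h2]
      have := K.prodSpan_mul_le ⊤ m 0 (Submodule.mul_mem_mul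
        (K.inc_mem_prodSpan m.pos (hs g) trivial) (K.of_mem_prodSpan (g := s g) trivial))
      simpa using this
    | add x y hx hy =>
      rw [map_add, map_add, add_sub_add_comm]
      exact add_mem hx hy
    | smul q x hx =>
      rw [map_smul, map_smul, ← smul_sub]
      exact Submodule.smul_mem _ _ hx
  intro x hx
  have := key x
  rwa [K.mem_I.1 hx, map_zero, _root_.sub_zero] at this

/-- The filtration `J_n` is spanned by the elements `(k₁ - 1) ⋯ (k_p - 1) g` with `k_i ∈ K_{m_i}`,
`g ∈ K₀` and `m₁ + ⋯ + m_p ≥ n`. -/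
theorem J_eq_prodSpan (n : ℕ) : K.J n = K.prodSpan ⊤ n := by
  apply le_antisymm
  · cases n with
    | zero =>
      intro x _
      induction x using MonoidAlgebra.of_induction with
      | of g => exact K.of_mem_prodSpan trivial
      | add x y hx hy => exact add_mem (hx trivial) (hy trivial)
      | smul q x hx => exact Submodule.smul_mem _ _ (hx trivial)
    | succ n =>
      have key : ∀ l : List ℕ+, (l.map fun i : ℕ+ => K.I i).prod ≤
          K.prodSpan ⊤ (l.map fun i : ℕ+ => (i : ℕ)).sum := by
        intro l
        induction l with
        | nil =>
          rw [List.map_nil, List.prod_nil, Submodule.one_le]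
          have := K.of_mem_prodSpan (N := ⊤) (g := 1) trivial
          rwa [map_one] at this
        | cons i l ih =>
          rw [List.map_cons, List.prod_cons, List.map_cons, List.sum_cons]
          exact (mul_le_mul' (K.I_le_prodSpan i) ih).trans (K.prodSpan_mul_le _ _ _)
      exact iSup_le fun l => (key l.1).trans (K.prodSpan_antitone _ l.2.2)
  · refine Submodule.span_le.2 ?_
    rintro _ ⟨l, -, hn, g, -, rfl⟩
    exact K.J_antitone hn (K.incProd_mul_of_mem_J l g)

open Classical in
/-- The projection of `ℚ[G]` to the span of the coset `c` of `K₁`. -/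
def cosetProj (c : G ⧸ K.sub 1) : MonoidAlgebra ℚ G →ₗ[ℚ] MonoidAlgebra ℚ G :=
  linExt fun g => if (g : G ⧸ K.sub 1) = c then MonoidAlgebra.of ℚ G g else 0

open Classical in
theorem cosetProj_of (c : G ⧸ K.sub 1) (g : G) : K.cosetProj c (MonoidAlgebra.of ℚ G g) =
    if (g : G ⧸ K.sub 1) = c then MonoidAlgebra.of ℚ G g else 0 :=
  linExt_of _ _

theorem cosetProj_inc_mul (c : G ⧸ K.sub 1) {k : G} (hk : k ∈ K.sub 1) (x : MonoidAlgebra ℚ G) :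
    K.cosetProj c (inc k * x) = inc k * K.cosetProj c x := by
  induction x using MonoidAlgebra.of_induction with
  | of g =>
    have h : ((k * g : G) : G ⧸ K.sub 1) = (g : G ⧸ K.sub 1) := by
      rw [QuotientGroup.mk_mul, (QuotientGroup.eq_one_iff k).2 hk, one_mul]
    rw [inc, sub_mul, sub_mul, one_mul, one_mul, ← map_mul, map_sub, cosetProj_of, cosetProj_of, h]
    split_ifs
    · rw [map_mul]
    · rw [mul_zero]
  | add x y hx hy => rw [mul_add, map_add, hx, hy, map_add, mul_add]
  | smul q x hx => rw [mul_smul_comm, map_smul, hx, map_smul, mul_smul_comm]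

theorem sub_le_one (m : ℕ+) : K.sub m ≤ K.sub 1 := K.antitone m.pos

open Classical in
theorem cosetProj_incProd_mul (c : G ⧸ K.sub 1) (l : List (Σ m : ℕ+, K.sub m)) (g : G) :
    K.cosetProj c (K.incProd l * MonoidAlgebra.of ℚ G g) =
      if (g : G ⧸ K.sub 1) = c then K.incProd l * MonoidAlgebra.of ℚ G g else 0 := by
  induction l with
  | nil => simpa [incProd] using K.cosetProj_of c g
  | cons p l ih =>
    rw [incProd_cons, mul_assoc, K.cosetProj_inc_mul c (K.sub_le_one _ p.2.2), ih]
    split_ifs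
    · rfl
    · rw [mul_zero]

theorem cosetProj_mem_J (c : G ⧸ K.sub 1) {n : ℕ} {x : MonoidAlgebra ℚ G}
    (hx : x ∈ K.fil.J n) : K.cosetProj c x ∈ K.fil.J n := by
  have : K.J n ≤ (K.J n).comap (K.cosetProj c) := by
    nth_rewrite 1 [J_eq_prodSpan]
    refine Submodule.span_le.2 ?_
    rintro _ ⟨l, -, hn, g, -, rfl⟩
    rw [SetLike.mem_coe, Submodule.mem_comap, cosetProj_incProd_mul]
    split_ifs
    · exact K.J_antitone hn (K.incProd_mul_of_mem_J l g)
    · exact zero_mem _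
  exact this hx

/-- `J_n ∩ ℚ[K₁]` is the `n`-th term of the filtration of `ℚ[K₁]`. -/
theorem mem_prodSpan_one {n : ℕ} {x : MonoidAlgebra ℚ G} (hx : x ∈ K.J n)
    (hx' : x ∈ grpSpan (K.sub 1)) : x ∈ K.prodSpan (K.sub 1) n := by
  have h1 : K.J n ≤ (K.prodSpan (K.sub 1) n).comap (K.cosetProj 1) := by
    rw [J_eq_prodSpan]
    refine Submodule.span_le.2 ?_
    rintro _ ⟨l, -, hn, g, -, rfl⟩
    rw [SetLike.mem_coe, Submodule.mem_comap, cosetProj_incProd_mul]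
    split_ifs with hg
    · exact K.incProd_mul_mem (fun p _ => K.sub_le_one _ p.2.2) hn
        ((QuotientGroup.eq_one_iff g).1 hg)
    · exact zero_mem _
  have h2 : grpSpan (K.sub 1) ≤ LinearMap.eqLocus (K.cosetProj 1) LinearMap.id := by
    refine Submodule.span_le.2 ?_
    rintro _ ⟨g, hg, rfl⟩
    exact (K.cosetProj_of 1 g).trans (if_pos ((QuotientGroup.eq_one_iff g).2 hg))
  have h3 : K.cosetProj 1 x = x := h2 hx'
  rw [← h3]
  exact h1 hx

end ExtendedNSeries

/-! ### Homogeneous elements of the completed associated graded -/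

namespace HopfFiltration

variable {A : Type*} [Ring A] [HopfAlgebra ℚ A] (F : HopfFiltration A)

/-- The elements of `∏_k J_k / J_{k+1}` concentrated in degree `n`. -/
def homog (n : ℕ) : Submodule ℚ F.GrHat where
  carrier := {x | ∃ a ha, x = F.mono n a ha}
  zero_mem' := ⟨0, zero_mem _, (F.mono_eq_zero (zero_mem _) (zero_mem _)).symm⟩
  add_mem' := by
    rintro _ _ ⟨a, ha, rfl⟩ ⟨b, hb, rfl⟩
    exact ⟨a + b, add_mem ha hb, (F.mono_add ha hb).symm⟩
  smul_mem' := by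
    rintro q _ ⟨a, ha, rfl⟩
    exact ⟨q • a, Submodule.smul_mem _ q ha, (F.mono_smul q ha).symm⟩

variable {F}

theorem grComp_eq_zero_of_homog {n k : ℕ} {x : F.GrHat} (hx : x ∈ F.homog n) (h : k ≠ n) :
    F.grComp k x = 0 := by
  obtain ⟨a, ha, rfl⟩ := hx
  exact F.grComp_mono_of_ne h a ha

theorem eq_zero_of_homog {n : ℕ} {x : F.GrHat} (hx : x ∈ F.homog n) (h : F.grComp n x = 0) :
    x = 0 := by
  refine F.grHat_ext fun k => ?_
  by_cases hk : k = n
  · subst hk; rw [h, map_zero]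
  · rw [grComp_eq_zero_of_homog hx hk, map_zero]

theorem grComp_mul_homog {i j n : ℕ} (h : i + j = n) {x y : F.GrHat} (hx : x ∈ F.homog i)
    (hy : y ∈ F.homog j) :
    F.grComp n (x * y) = F.grMul i j n h (F.grComp i x) (F.grComp j y) := by
  subst h
  obtain ⟨a, ha, rfl⟩ := hx
  obtain ⟨b, hb, rfl⟩ := hy
  rw [mono_mul, grComp_mono_self, grComp_mono_self, grComp_mono_self, grMul_mk]
  rfl

end HopfFiltration

/-! ### The comparison homomorphism -/

namespace ExtendedNSeries

attribute [local instance 100] LieRing.ofAssociativeRing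

variable {G : Type*} [Group G] (K : ExtendedNSeries G)

theorem inc_mul_sub (k l : G) : inc (k * l) - (inc k + inc l) = inc k * inc l := by
  simp only [inc, map_mul]
  noncomm_ring

theorem inc_commutator_sub (k l : G) :
    inc ⁅k, l⁆ - (inc k * inc l - inc l * inc k) = -(inc ⁅k, l⁆ * inc (l * k)) := by
  have h : MonoidAlgebra.of ℚ G ⁅k, l⁆ * (MonoidAlgebra.of ℚ G l * MonoidAlgebra.of ℚ G k) =
      MonoidAlgebra.of ℚ G k * MonoidAlgebra.of ℚ G l := by
    rw [← map_mul, ← map_mul, ← map_mul]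
    congr 1
    simp [commutatorElement_def]
  have h' : inc ⁅k, l⁆ * inc (l * k) = MonoidAlgebra.of ℚ G k * MonoidAlgebra.of ℚ G l -
      MonoidAlgebra.of ℚ G l * MonoidAlgebra.of ℚ G k - inc ⁅k, l⁆ := by
    simp only [inc, map_mul, mul_sub, sub_mul, mul_one, one_mul]
    rw [h]
  rw [h']
  simp only [inc]
  noncomm_ring

/-- The class of `k - 1` in degree `m`, as a homomorphism on `K_m / K_{m+1}`. -/
def symbPos (m : ℕ+) : K.GrPos m →+ K.fil.GrHat :=
  MonoidHom.toAdditiveLeft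
    (QuotientGroup.lift _
      (MonoidHom.mk'
        (fun k : K.sub m => Multiplicative.ofAdd (K.fil.mono m (inc (k : G)) (K.inc_mem_J k.2)))
        (fun k l => by
          rw [← ofAdd_add]
          refine congrArg Multiplicative.ofAdd ?_
          rw [← K.fil.mono_add]
          refine K.fil.mono_congr _ _ ?_
          rw [Subgroup.coe_mul, inc_mul_sub]
          refine K.fil.antitone (Nat.add_le_add_left m.pos m) ?_
          exact K.fil.mul_mem (K.inc_mem_J k.2) (K.inc_mem_J l.2)))
      (by
        intro k hk
        exact congrArg Multiplicative.ofAdd (K.fil.mono_eq_zero _ (K.inc_mem_J hk))))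

/-- The additive map `⨁ K_m / K_{m+1} → ∏ J_m / J_{m+1}` induced by `k ↦ k - 1`. -/
def symbAdd : K.GrLie →+ K.fil.GrHat := K.grLieLift K.symbPos

theorem symbAdd_cls (m : ℕ+) (k : K.sub m) :
    K.symbAdd (K.cls m k) = K.fil.mono m (inc (k : G)) (K.inc_mem_J k.2) :=
  K.grLieLift_cls _ m k

/-- The rational extension of `symbAdd`. -/
def symbLin : K.GrLieQ →ₗ[ℚ] K.fil.GrHat := LinearMap.liftBaseChange ℚ K.symbAdd.toIntLinearMap

theorem symbLin_clsQ (m : ℕ+) (k : K.sub m) :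
    K.symbLin (K.clsQ m k) = K.fil.mono m (inc (k : G)) (K.inc_mem_J k.2) := by
  unfold symbLin clsQ
  rw [LinearMap.liftBaseChange_tmul, one_smul]
  exact K.symbAdd_cls m k

theorem lie_clsQ {m n : ℕ+} (x : K.sub m) (y : K.sub n) :
    ⁅K.clsQ m x, K.clsQ n y⁆ = K.clsQ (m + n) (K.commElt x y) := by
  unfold clsQ
  rw [← lie_cls, LieAlgebra.ExtendScalars.bracket_tmul, one_mul]

theorem clsQ_induction {p : K.GrLieQ → Prop} (x : K.GrLieQ) (cls : ∀ m k, p (K.clsQ m k))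
    (zero : p 0) (add : ∀ x y, p x → p y → p (x + y)) (smul : ∀ (q : ℚ) x, p x → p (q • x)) :
    p x := by
  have hx : x ∈ Submodule.span ℚ {y : K.GrLieQ | ∃ m x, y = K.clsQ m x} := by
    rw [span_clsQ]; trivial
  induction hx using Submodule.span_induction with
  | zero => exact zero
  | add x y _ _ hx hy => exact add x y hx hy
  | smul q x _ hx => exact smul q x hx
  | mem x h =>
    obtain ⟨m, k, rfl⟩ := h
    exact cls m k

/-- The Lie algebra homomorphism `gr₊^ℚ(K) → ∏ J_m / J_{m+1}` induced by `k ↦ k - 1`. -/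
def symbLie : K.GrLieQ →ₗ⁅ℚ⁆ K.fil.GrHat :=
  { K.symbLin with
    map_lie' := by
      intro x y
      have z1 : ∀ y : K.GrLieQ, ⁅(0 : K.GrLieQ), y⁆ = 0 := fun y => zero_lie y
      have z2 : ∀ x : K.GrLieQ, ⁅x, (0 : K.GrLieQ)⁆ = 0 := fun x => lie_zero x
      have a1 : ∀ u v y : K.GrLieQ, ⁅u + v, y⁆ = ⁅u, y⁆ + ⁅v, y⁆ := fun u v y => add_lie u v y
      have a2 : ∀ x u v : K.GrLieQ, ⁅x, u + v⁆ = ⁅x, u⁆ + ⁅x, v⁆ := fun x u v => lie_add x u v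
      have s1 : ∀ (q : ℚ) (u y : K.GrLieQ), ⁅q • u, y⁆ = q • ⁅u, y⁆ := fun q u y => smul_lie q u y
      have s2 : ∀ (q : ℚ) (x u : K.GrLieQ), ⁅x, q • u⁆ = q • ⁅x, u⁆ := fun q x u => lie_smul q x u
      change K.symbLin ⁅x, y⁆ = ⁅K.symbLin x, K.symbLin y⁆
      induction x using K.clsQ_induction with
      | zero => rw [z1, map_zero, zero_lie]
      | add u v hu hv => rw [a1, map_add, hu, hv, map_add, add_lie]
      | smul q u hu => rw [s1, map_smul, hu, map_smul, smul_lie]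
      | cls m k =>
      induction y using K.clsQ_induction with
      | zero => rw [z2, map_zero, lie_zero]
      | add u v hu hv => rw [a2, map_add, hu, hv, map_add, lie_add]
      | smul q u hu => rw [s2, map_smul, hu, map_smul, lie_smul]
      | cls n l =>
      rw [lie_clsQ, symbLin_clsQ, symbLin_clsQ, symbLin_clsQ,
        LieRing.of_associative_ring_bracket, K.fil.mono_mul, K.fil.mono_mul,
        K.fil.mono_cast (add_comm (n : ℕ) m), ← K.fil.mono_sub]
      refine K.fil.mono_congr (n := m + n) _ _ ?_
      change inc ⁅(k : G), (l : G)⁆ - _ ∈ _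
      rw [inc_commutator_sub]
      refine neg_mem (K.J_mul_le (m + n) 1 (Submodule.mul_mem_mul
        (K.inc_mem_J (K.comm_mem k.2 l.2)) (K.inc_mem_J ?_)))
      exact mul_mem (K.sub_le_one n l.2) (K.sub_le_one m k.2) }

/-- The algebra homomorphism `U(gr₊^ℚ(K)) → ∏ J_m / J_{m+1}` induced by `k ↦ k - 1`. -/
def compPos : K.UPos →ₐ[ℚ] K.fil.GrHat := UniversalEnvelopingAlgebra.lift ℚ K.symbLie

theorem compPos_ι (m : ℕ+) (k : K.sub m) :
    K.compPos (UniversalEnvelopingAlgebra.ι ℚ (K.clsQ m k)) =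
      K.fil.mono m (inc (k : G)) (K.inc_mem_J k.2) := by
  unfold compPos
  rw [UniversalEnvelopingAlgebra.lift_ι_apply]
  exact K.symbLin_clsQ m k

/-- The homomorphism `K₀ → ∏ J_m / J_{m+1}` with values in degree `0`. -/
def compG : G →* K.fil.GrHat where
  toFun g := K.fil.mono 0 (MonoidAlgebra.of ℚ G g) (K.fil.mem_zero _)
  map_one' := by
    rw [← K.fil.mono_one]
    congr 1
  map_mul' g h := by
    rw [K.fil.mono_mul]
    congr 1
    rw [map_mul]

theorem compG_apply (g : G) :
    K.compG g = K.fil.mono 0 (MonoidAlgebra.of ℚ G g) (K.fil.mem_zero _) := rfl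

/-- The homomorphism `K₀ / K₁ → ∏ J_m / J_{m+1}` with values in degree `0`. -/
def compGrp : G ⧸ K.sub 1 →* K.fil.GrHat :=
  QuotientGroup.lift _ K.compG
    (by
      intro g hg
      change K.compG g = 1
      rw [compG_apply, ← K.fil.mono_one]
      exact K.fil.mono_congr _ _ (K.inc_mem_J hg))

theorem compPos_act (g : G ⧸ K.sub 1) (u : K.UPos) :
    K.compPos (g • u) * K.compGrp g = K.compGrp g * K.compPos u := by
  obtain ⟨g, rfl⟩ := QuotientGroup.mk_surjective g
  have h1 : ∀ g : G, K.compGrp (QuotientGroup.mk g) = K.compG g := fun _ => rfl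
  have h2 : K.compG g⁻¹ * K.compG g = 1 := by rw [← map_mul, inv_mul_cancel, map_one]
  have h3 : K.compG g * K.compG g⁻¹ = 1 := by rw [← map_mul, mul_inv_cancel, map_one]
  -- conjugation by the image of `g` is an algebra homomorphism, so it suffices to check generators
  let c : K.fil.GrHat →ₐ[ℚ] K.fil.GrHat :=
    AlgHom.ofLinearMap
      (LinearMap.mulRight ℚ (K.compG g⁻¹) ∘ₗ LinearMap.mulLeft ℚ (K.compG g))
      (by simp [h3])
      (by
        intro x y
        change K.compG g * (x * y) * K.compG g⁻¹ =
          K.compG g * x * K.compG g⁻¹ * (K.compG g * y * K.compG g⁻¹)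
        rw [← mul_assoc (K.compG g * x * K.compG g⁻¹), ← mul_assoc (K.compG g * x * K.compG g⁻¹),
          mul_assoc (K.compG g * x), h2, mul_one, ← mul_assoc])
  have hc : ∀ x, c x = K.compG g * x * K.compG g⁻¹ := fun _ => rfl
  have h4 : K.compPos.comp (K.conjU g) = c.comp K.compPos := by
    apply K.uPos_hom_ext
    intro m k
    rw [AlgHom.comp_apply, AlgHom.comp_apply, conjU_ι, compPos_ι, compPos_ι, hc, compG_apply,
      compG_apply, K.fil.mono_mul, K.fil.mono_mul, K.fil.mono_cast (m := 0 + m + 0) (n := m) (by simp)]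
    congr 1
    rw [of_mul_inc, mul_assoc (inc _), ← map_mul, mul_inv_cancel, map_one, mul_one]
  have h5 : K.compPos (K.conjU g u) = K.compG g * K.compPos u * K.compG g⁻¹ :=
    DFunLike.congr_fun h4 u
  change K.compPos (K.conjU g u) * K.compG g = K.compG g * _
  rw [h5, mul_assoc, h2, mul_one]

/-- The comparison homomorphism from `U(gr_•^ℚ(K)) = U(gr₊^ℚ(K)) ♯ ℚ[K₀/K₁]` to
`∏ J_m / J_{m+1}`, given by `k ↦ k - 1` in positive degrees and by `g ↦ g` in degree `0`. -/
def comparison : K.U →ₐ[ℚ] K.fil.GrHat :=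
  (SkewMonoidAlgebra.liftNCRingHom (K.compPos : K.UPos →+* K.fil.GrHat) K.compGrp
    (fun {u g} => K.compPos_act g u)).toRatAlgHom

theorem comparison_uSingle (g : G ⧸ K.sub 1) (u : K.UPos) :
    K.comparison (K.uSingle g u) = K.compPos u * K.compGrp g :=
  SkewMonoidAlgebra.liftNC_single _ _ _ _

/-- The product of the elements `k_i K_{m_i + 1} ⊗ 1` in `U(gr₊^ℚ(K))`. -/
def clsProd (l : List (Σ m : ℕ+, K.sub m)) : K.UPos :=
  (l.map fun p => UniversalEnvelopingAlgebra.ι ℚ (K.clsQ p.1 p.2)).prod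

theorem clsProd_cons (p : Σ m : ℕ+, K.sub m) (l : List (Σ m : ℕ+, K.sub m)) :
    K.clsProd (p :: l) = UniversalEnvelopingAlgebra.ι ℚ (K.clsQ p.1 p.2) * K.clsProd l := by
  simp [clsProd]

theorem clsProd_mem (l : List (Σ m : ℕ+, K.sub m)) : K.clsProd l ∈ K.uPosDeg (K.wt l) :=
  Submodule.subset_span ⟨l, rfl, rfl⟩

theorem compPos_clsProd (l : List (Σ m : ℕ+, K.sub m)) :
    K.compPos (K.clsProd l) = K.fil.mono (K.wt l) (K.incProd l) (K.incProd_mem_J l) := by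
  induction l with
  | nil =>
    exact (map_one K.compPos).trans K.fil.mono_one.symm
  | cons p l ih =>
    rw [clsProd_cons, map_mul, ih, compPos_ι, K.fil.mono_mul]
    rw [K.fil.mono_cast (K.wt_cons p l).symm]
    congr 1

theorem comparison_clsProd (g : G) (l : List (Σ m : ℕ+, K.sub m)) :
    K.comparison (K.uSingle (QuotientGroup.mk g) (K.clsProd l)) =
      K.fil.mono (K.wt l) (K.incProd l * MonoidAlgebra.of ℚ G g) (K.incProd_mul_of_mem_J l g) := by
  rw [comparison_uSingle, compPos_clsProd]
  change _ * K.compG g = _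
  rw [compG_apply, K.fil.mono_mul]
  rfl

theorem uPosDeg_eq (n : ℕ) :
    K.uPosDeg n = Submodule.span ℚ {u | ∃ l, K.wt l = n ∧ u = K.clsProd l} := rfl

/-- To prove a linear statement about elements of degree `n` of `U(gr_•^ℚ(K))` it suffices to
consider products of homogeneous generators. -/
theorem uDeg_le {n : ℕ} {S : Submodule ℚ K.U}
    (h : ∀ g l, K.wt l = n → K.uSingle (QuotientGroup.mk g) (K.clsProd l) ∈ S) :
    K.uDeg n ≤ S := by
  intro x hx
  rw [K.uDeg_eq_sum (x := x)]
  refine Submodule.sum_mem _ fun g _ => ?_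
  have h1 : K.uPosDeg n ≤ S.comap (K.uSingle g) := by
    obtain ⟨g, rfl⟩ := QuotientGroup.mk_surjective g
    rw [uPosDeg_eq]
    refine Submodule.span_le.2 ?_
    rintro _ ⟨l, hl, rfl⟩
    exact h g l hl
  exact h1 (hx g)

theorem comparison_mem_homog {n : ℕ} {x : K.U} (hx : x ∈ K.uDeg n) :
    K.comparison x ∈ K.fil.homog n := by
  have : K.uDeg n ≤ (K.fil.homog n).comap K.comparison.toLinearMap := by
    apply K.uDeg_le
    rintro g l rfl
    exact ⟨_, _, K.comparison_clsProd g l⟩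
  exact this hx

/-- The comparison homomorphism is onto in each degree. -/
theorem exists_comparison_eq (n : ℕ) (a : MonoidAlgebra ℚ G) (ha : a ∈ K.fil.J n) :
    ∃ x ∈ K.uDeg n, K.comparison x = K.fil.mono n a ha := by
  let S : Submodule ℚ (MonoidAlgebra ℚ G) :=
    { carrier := {a | ∃ ha : a ∈ K.fil.J n, ∃ x ∈ K.uDeg n, K.comparison x = K.fil.mono n a ha}
      zero_mem' := ⟨zero_mem _, 0, zero_mem _, by
        rw [map_zero, K.fil.mono_eq_zero _ (zero_mem _)]⟩
      add_mem' := by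
        rintro a b ⟨ha, x, hx, h⟩ ⟨hb, y, hy, h'⟩
        exact ⟨add_mem ha hb, x + y, add_mem hx hy, by rw [map_add, h, h', ← K.fil.mono_add]⟩
      smul_mem' := by
        rintro q a ⟨ha, x, hx, h⟩
        exact ⟨Submodule.smul_mem _ q ha, q • x, Submodule.smul_mem _ q hx, by
          rw [map_smul, h, ← K.fil.mono_smul]⟩ }
  have key : K.fil.J n ≤ S := by
    refine (K.J_eq_prodSpan n).le.trans ?_
    refine Submodule.span_le.2 ?_
    rintro _ ⟨l, -, hn, g, -, rfl⟩
    rcases hn.eq_or_lt with rfl | hn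
    · exact ⟨K.incProd_mul_of_mem_J l g, _, K.uSingle_mem_uDeg _ (K.clsProd_mem l),
        K.comparison_clsProd g l⟩
    · have h1 := K.fil.antitone hn (K.incProd_mul_of_mem_J l g)
      refine ⟨K.fil.antitone (Nat.le_succ n) h1, 0, zero_mem _, ?_⟩
      rw [map_zero, K.fil.mono_eq_zero _ h1]
  exact (key ha).2

/-- The extension of the comparison homomorphism to the degree-completion, as a linear map. -/
def compHatLin : K.UHat →ₗ[ℚ] K.fil.GrHat where
  toFun x := fun n => K.fil.grComp n (K.comparison (K.comp x n))
  map_add' x y := funext fun n => by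
    change _ = K.fil.grComp n (K.comparison (K.comp x n)) + K.fil.grComp n (K.comparison (K.comp y n))
    rw [← map_add, ← map_add]
    rfl
  map_smul' q x := funext fun n => by
    change _ = q • K.fil.grComp n (K.comparison (K.comp x n))
    rw [← map_smul, ← map_smul]
    rfl

theorem comp_mem (x : K.UHat) (n : ℕ) : K.comp x n ∈ K.uDeg n := x.2 n

theorem grComp_compHatLin (x : K.UHat) (n : ℕ) :
    K.fil.grComp n (K.compHatLin x) = K.fil.grComp n (K.comparison (K.comp x n)) := rfl

theorem comp_one_zero : K.comp 1 0 = 1 := PowerSeries.coeff_zero_one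

theorem comp_one_pos {n : ℕ} (hn : n ≠ 0) : K.comp 1 n = 0 := by
  change PowerSeries.coeff n (1 : PowerSeries K.U) = 0
  rw [PowerSeries.coeff_one, if_neg hn]

theorem comp_mul (x y : K.UHat) (n : ℕ) : K.comp (x * y) n =
    ∑ p ∈ Finset.HasAntidiagonal.antidiagonal n, K.comp x p.1 * K.comp y p.2 :=
  PowerSeries.coeff_mul n x.1 y.1

/-- The extension of the comparison homomorphism to the degree-completion. -/
def compHat : K.UHat →ₐ[ℚ] K.fil.GrHat :=
  AlgHom.ofLinearMap K.compHatLin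
    (by
      refine K.fil.grHat_ext fun n => ?_
      rw [grComp_compHatLin]
      by_cases hn : n = 0
      · subst hn
        rw [comp_one_zero, map_one]
      · rw [K.comp_one_pos hn, map_zero, map_zero]
        exact (K.fil.grComp_mono_of_ne hn 1 (K.fil.mem_zero 1)).symm)
    (by
      intro x y
      refine K.fil.grHat_ext fun n => ?_
      rw [grComp_compHatLin, comp_mul, map_sum, map_sum, K.fil.grComp_mul]
      refine (Finset.sum_coe_sort (Finset.HasAntidiagonal.antidiagonal n) (fun p =>
        K.fil.grComp n (K.comparison (K.comp x p.1 * K.comp y p.2)))).symm.trans ?_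
      refine Finset.sum_congr rfl fun p _ => ?_
      rw [map_mul, HopfFiltration.grComp_mul_homog
        (Finset.HasAntidiagonal.mem_antidiagonal.1 p.2)
        (K.comparison_mem_homog (K.comp_mem x p.1.1)) (K.comparison_mem_homog (K.comp_mem y p.1.2))]
      rfl)

theorem grComp_compHat (x : K.UHat) (n : ℕ) :
    K.fil.grComp n (K.compHat x) = K.fil.grComp n (K.comparison (K.comp x n)) := rfl

end ExtendedNSeries

/-! ### Compatibility of the comparison homomorphism with the comultiplications -/

namespace UniversalEnvelopingAlgebra

attribute [local instance 100] LieRing.ofAssociativeRing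

variable {L : Type*} [LieRing L] [LieAlgebra ℚ L]

theorem adjoin_range_ι :
    Algebra.adjoin ℚ (Set.range (ι ℚ : L → UniversalEnvelopingAlgebra ℚ L)) = ⊤ := by
  set S := Algebra.adjoin ℚ (Set.range (ι ℚ : L → UniversalEnvelopingAlgebra ℚ L)) with hS
  let f : L →ₗ⁅ℚ⁆ S :=
    { toFun := fun x => ⟨ι ℚ x, Algebra.subset_adjoin ⟨x, rfl⟩⟩
      map_add' := fun x y => Subtype.ext (map_add (ι ℚ) x y)
      map_smul' := fun q x => Subtype.ext (map_smul (ι ℚ) q x)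
      map_lie' := fun {x y} => Subtype.ext (LieHom.map_lie (ι ℚ) x y) }
  have h : S.val.comp (lift ℚ f) = AlgHom.id ℚ _ := by
    apply hom_ext
    ext x
    change S.val (lift ℚ f (ι ℚ x)) = ι ℚ x
    rw [lift_ι_apply]
    rfl
  rw [eq_top_iff]
  intro u _
  have := DFunLike.congr_fun h u
  rw [AlgHom.comp_apply, AlgHom.id_apply] at this
  rw [← this]
  exact (lift ℚ f u).2

theorem ι_mul_induction {p : UniversalEnvelopingAlgebra ℚ L → Prop}
    (u : UniversalEnvelopingAlgebra ℚ L) (one : p 1) (ι_mul : ∀ x u, p u → p (ι ℚ x * u))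
    (add : ∀ u v, p u → p v → p (u + v)) (smul : ∀ (q : ℚ) u, p u → p (q • u)) : p u := by
  have hu : u ∈ Algebra.adjoin ℚ (Set.range (ι ℚ : L → UniversalEnvelopingAlgebra ℚ L)) := by
    rw [adjoin_range_ι]; trivial
  rw [← Subalgebra.mem_toSubmodule, Algebra.adjoin_eq_span] at hu
  induction hu using Submodule.span_induction with
  | zero =>
    have := smul 0 1 one
    rwa [zero_smul] at this
  | add x y _ _ hx hy => exact add x y hx hy
  | smul q x _ hx => exact smul q x hx
  | mem x h =>
    induction h using Submonoid.closure_induction_left with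
    | one => exact one
    | mul_left x hx y _ hy =>
      obtain ⟨x, rfl⟩ := hx
      exact ι_mul x y hy

end UniversalEnvelopingAlgebra

namespace ExtendedNSeries

attribute [local instance 100] LieRing.ofAssociativeRing

variable {G : Type*} [Group G] (K : ExtendedNSeries G)

theorem clsProd_induction {p : K.UPos → Prop} (u : K.UPos) (prod : ∀ l, p (K.clsProd l))
    (add : ∀ u v, p u → p v → p (u + v)) (smul : ∀ (q : ℚ) u, p u → p (q • u)) : p u := by
  have h : ∀ u, u ∈ Submodule.span ℚ (Set.range K.clsProd) := by
    intro u
    induction u using UniversalEnvelopingAlgebra.ι_mul_induction with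
    | one => exact Submodule.subset_span ⟨[], rfl⟩
    | add u v hu hv => exact add_mem hu hv
    | smul q u hu => exact Submodule.smul_mem _ q hu
    | ι_mul x u hu =>
      induction x using K.clsQ_induction with
      | zero => rw [map_zero, zero_mul]; exact zero_mem _
      | add x y hx hy => rw [map_add, add_mul]; exact add_mem hx hy
      | smul q x hx => rw [map_smul, smul_mul_assoc]; exact Submodule.smul_mem _ q hx
      | cls m k =>
        induction hu using Submodule.span_induction with
        | zero => rw [mul_zero]; exact zero_mem _
        | add x y _ _ hx hy => rw [mul_add]; exact add_mem hx hy
        | smul q x _ hx => rw [mul_smul_comm]; exact Submodule.smul_mem _ q hx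
        | mem x h =>
          obtain ⟨l, rfl⟩ := h
          exact Submodule.subset_span ⟨⟨m, k⟩ :: l, K.clsProd_cons _ _⟩
  have hu : u ∈ Submodule.span ℚ (Set.range K.clsProd) := h u
  induction hu using Submodule.span_induction with
  | zero =>
    have := smul 0 _ (prod [])
    rwa [zero_smul] at this
  | add x y _ _ hx hy => exact add x y hx hy
  | smul q x _ hx => exact smul q x hx
  | mem x h =>
    obtain ⟨l, rfl⟩ := h
    exact prod l

theorem uSingle_induction {p : K.U → Prop} (x : K.U)
    (prod : ∀ g l, p (K.uSingle (QuotientGroup.mk g) (K.clsProd l)))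
    (add : ∀ u v, p u → p v → p (u + v)) (smul : ∀ (q : ℚ) u, p u → p (q • u)) : p x := by
  induction x using SkewMonoidAlgebra.induction_on with
  | zero =>
    have := smul 0 _ (prod 1 [])
    rwa [zero_smul] at this
  | add u v hu hv => exact add u v hu hv
  | single g u =>
    obtain ⟨g, rfl⟩ := QuotientGroup.mk_surjective g
    change p (K.uSingle (QuotientGroup.mk g) u)
    induction u using K.clsProd_induction with
    | prod l => exact prod g l
    | add u v hu hv => rw [map_add]; exact add _ _ hu hv
    | smul q u hu => rw [map_smul]; exact smul q _ hu

/-- The degree `i` component of the comparison homomorphism. -/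
def compDeg (i : ℕ) : K.U →ₗ[ℚ] K.fil.Gr i := K.fil.grComp i ∘ₗ K.comparison.toLinearMap

theorem compDeg_apply (i : ℕ) (u : K.U) : K.compDeg i u = K.fil.grComp i (K.comparison u) := rfl

/-- The pairs consisting of a tensor of total degree `n` in `U ⊗ U` and of an element of
`∑_{i+j=n} J_i ⊗ J_j` which represents its image under the comparison homomorphism modulo
`∑_{i+j=n+1} J_i ⊗ J_j`. Products in the algebra `(U ⊗ U) × (ℚ[K₀] ⊗ ℚ[K₀])` add the degrees. -/
def tensorRep (n : ℕ) :
    Submodule ℚ ((K.U ⊗[ℚ] K.U) × (MonoidAlgebra ℚ G ⊗[ℚ] MonoidAlgebra ℚ G)) :=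
  Submodule.span ℚ ({z | ∃ (s t : ℕ) (u v : K.U) (x y : MonoidAlgebra ℚ G) (hx : x ∈ K.fil.J s)
      (hy : y ∈ K.fil.J t), s + t = n ∧ K.comparison u = K.fil.mono s x hx ∧
      K.comparison v = K.fil.mono t y hy ∧ z = (u ⊗ₜ v, x ⊗ₜ y)} ∪
    {z | ∃ w ∈ K.J2 (n + 1), z = (0, w)})

theorem tensorRep_tmul {s t n : ℕ} {u v : K.U} {x y : MonoidAlgebra ℚ G} (hn : s + t = n)
    (hx : x ∈ K.fil.J s) (hy : y ∈ K.fil.J t) (hu : K.comparison u = K.fil.mono s x hx)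
    (hv : K.comparison v = K.fil.mono t y hy) :
    ((u ⊗ₜ v, x ⊗ₜ y) : (K.U ⊗[ℚ] K.U) × (MonoidAlgebra ℚ G ⊗[ℚ] MonoidAlgebra ℚ G)) ∈
      K.tensorRep n :=
  Submodule.subset_span (Or.inl ⟨s, t, u, v, x, y, hx, hy, hn, hu, hv, rfl⟩)

theorem tensorRep_zero {n : ℕ} {w : MonoidAlgebra ℚ G ⊗[ℚ] MonoidAlgebra ℚ G}
    (hw : w ∈ K.J2 (n + 1)) :
    ((0, w) : (K.U ⊗[ℚ] K.U) × (MonoidAlgebra ℚ G ⊗[ℚ] MonoidAlgebra ℚ G)) ∈ K.tensorRep n :=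
  Submodule.subset_span (Or.inr ⟨w, hw, rfl⟩)

theorem J2_mul_mem {m n k : ℕ} (h : k ≤ m + n) {z w : MonoidAlgebra ℚ G ⊗[ℚ] MonoidAlgebra ℚ G}
    (hz : z ∈ K.J2 m) (hw : w ∈ K.J2 n) : z * w ∈ K.J2 k :=
  K.J2_antitone h (K.J2_mul_le m n (Submodule.mul_mem_mul hz hw))

theorem tensorRep_mul_le (m n : ℕ) : K.tensorRep m * K.tensorRep n ≤ K.tensorRep (m + n) := by
  refine (Submodule.span_mul_span ℚ _ _).le.trans (Submodule.span_le.2 ?_)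
  rintro _ ⟨_, (⟨s, t, u, v, x, y, hx, hy, rfl, hu, hv, rfl⟩ | ⟨w, hw, rfl⟩), _,
    (⟨s', t', u', v', x', y', hx', hy', rfl, hu', hv', rfl⟩ | ⟨w', hw', rfl⟩), rfl⟩
  · change (u ⊗ₜ[ℚ] v * u' ⊗ₜ[ℚ] v', x ⊗ₜ[ℚ] y * x' ⊗ₜ[ℚ] y') ∈ _
    rw [Algebra.TensorProduct.tmul_mul_tmul, Algebra.TensorProduct.tmul_mul_tmul]
    refine K.tensorRep_tmul (s := s + s') (t := t + t') (by omega) (K.fil.mul_mem hx hx')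
      (K.fil.mul_mem hy hy') ?_ ?_
    · rw [map_mul, hu, hu', K.fil.mono_mul]
    · rw [map_mul, hv, hv', K.fil.mono_mul]
  · change (u ⊗ₜ[ℚ] v * 0, x ⊗ₜ[ℚ] y * w') ∈ _
    rw [mul_zero]
    exact K.tensorRep_zero (K.J2_mul_mem (by omega) (K.tmul_mem_J2 rfl hx hy) hw')
  · change (0 * u' ⊗ₜ[ℚ] v', w * x' ⊗ₜ[ℚ] y') ∈ _
    rw [zero_mul]
    exact K.tensorRep_zero (K.J2_mul_mem (by omega) hw (K.tmul_mem_J2 rfl hx' hy'))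
  · change (0 * 0, w * w') ∈ _
    rw [mul_zero]
    exact K.tensorRep_zero (K.J2_mul_mem (by omega) hw hw')

theorem map_proj_J2 {k l m : ℕ} (h : k + l ≤ m + 1)
    {z : MonoidAlgebra ℚ G ⊗[ℚ] MonoidAlgebra ℚ G} (hz : z ∈ K.J2 m) :
    TensorProduct.map (K.fil.proj k) (K.fil.proj l) z = 0 := by
  have : K.J2 m ≤ LinearMap.ker (TensorProduct.map (K.fil.proj k) (K.fil.proj l)) := by
    refine iSup_le ?_
    rintro ⟨⟨i, j⟩, hij⟩
    refine Submodule.map₂_le.2 ?_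
    intro a ha b hb
    rw [LinearMap.mem_ker, TensorProduct.mk_apply, TensorProduct.map_tmul]
    dsimp only at ha hb hij
    by_cases hk : k ≤ i
    · rw [K.fil.proj_eq_zero.2 (K.fil.antitone hk ha), TensorProduct.zero_tmul]
    · have hl : l ≤ j := by omega
      rw [K.fil.proj_eq_zero.2 (K.fil.antitone hl hb), TensorProduct.tmul_zero]
  exact this hz

theorem compDeg_of_eq_mono {u : K.U} {s : ℕ} {x : MonoidAlgebra ℚ G} {hx : x ∈ K.fil.J s}
    (hu : K.comparison u = K.fil.mono s x hx) : K.compDeg s u = K.fil.grMk s ⟨x, hx⟩ := by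
  rw [compDeg_apply, hu, K.fil.grComp_mono_self]

theorem compDeg_of_ne {u : K.U} {s i : ℕ} (h : i ≠ s) {x : MonoidAlgebra ℚ G}
    {hx : x ∈ K.fil.J s} (hu : K.comparison u = K.fil.mono s x hx) : K.compDeg i u = 0 := by
  rw [compDeg_apply, hu, K.fil.grComp_mono_of_ne h]

/-- The image of a tensor of total degree `n` is determined by its representative. -/
theorem map_compDeg_of_tensorRep {n : ℕ} {z} (hz : z ∈ K.tensorRep n) (i j : ℕ) :
    (i + j = n → K.fil.grInclTensor i j (TensorProduct.map (K.compDeg i) (K.compDeg j) z.1) =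
      TensorProduct.map (K.fil.proj (i + 1)) (K.fil.proj (j + 1)) z.2) ∧
    (i + j ≠ n → TensorProduct.map (K.compDeg i) (K.compDeg j) z.1 = 0) := by
  unfold tensorRep at hz
  induction hz using Submodule.span_induction with
  | zero =>
    change (i + j = n → K.fil.grInclTensor i j (TensorProduct.map _ _ 0) =
      TensorProduct.map _ _ 0) ∧ (i + j ≠ n → TensorProduct.map _ _ 0 = 0)
    simp only [map_zero, implies_true, and_self]
  | add z w _ _ hz hw =>
    refine ⟨fun h => ?_, fun h => ?_⟩
    · rw [Prod.fst_add, Prod.snd_add, map_add, map_add, map_add, hz.1 h, hw.1 h]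
    · rw [Prod.fst_add, map_add, hz.2 h, hw.2 h, add_zero]
  | smul q z _ hz =>
    refine ⟨fun h => ?_, fun h => ?_⟩
    · rw [Prod.smul_fst, Prod.smul_snd, map_smul, map_smul, map_smul, hz.1 h]
    · rw [Prod.smul_fst, map_smul, hz.2 h, smul_zero]
  | mem z hz =>
    rcases hz with ⟨s, t, u, v, x, y, hx, hy, rfl, hu, hv, rfl⟩ | ⟨w, hw, rfl⟩
    · dsimp only
      rw [TensorProduct.map_tmul, TensorProduct.map_tmul]
      by_cases hi : i = s
      · subst hi
        by_cases hj : j = t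
        · subst hj
          refine ⟨fun _ => ?_, fun h => absurd rfl h⟩
          rw [K.compDeg_of_eq_mono hu, K.compDeg_of_eq_mono hv]
          rfl
        · refine ⟨fun h => absurd (by omega) hj, fun _ => ?_⟩
          rw [K.compDeg_of_ne hj hv, TensorProduct.tmul_zero]
      · rw [K.compDeg_of_ne hi hu, TensorProduct.zero_tmul]
        refine ⟨fun h => ?_, fun _ => rfl⟩
        rw [map_zero]
        rcases lt_or_gt_of_ne hi with hi | hi
        · rw [K.fil.proj_eq_zero.2 (K.fil.antitone hi hx), TensorProduct.zero_tmul]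
        · rw [K.fil.proj_eq_zero.2 (K.fil.antitone (show j + 1 ≤ t by omega) hy),
            TensorProduct.tmul_zero]
    · dsimp only
      refine ⟨fun h => ?_, fun _ => map_zero _⟩
      rw [map_zero, map_zero, K.map_proj_J2 (by omega) hw]

theorem comulU_uSingle (g : G ⧸ K.sub 1) (u : K.UPos) : K.comulU (K.uSingle g u) =
    TensorProduct.map (K.uSingle g) (K.uSingle g) (K.comulUPos u) := by
  change (Finsupp.lsum ℚ fun g : G ⧸ K.sub 1 =>
      TensorProduct.map (K.uSingle g) (K.uSingle g) ∘ₗ K.comulUPos.toLinearMap)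
    (Finsupp.single g u) = _
  rw [Finsupp.lsum_single]
  rfl

theorem comulUPos_ι (x : K.GrLieQ) : K.comulUPos (UniversalEnvelopingAlgebra.ι ℚ x) =
    UniversalEnvelopingAlgebra.ι ℚ x ⊗ₜ 1 + 1 ⊗ₜ UniversalEnvelopingAlgebra.ι ℚ x := by
  unfold comulUPos
  rw [UniversalEnvelopingAlgebra.lift_ι_apply]
  rfl

theorem uSingle_one_mul (g : G ⧸ K.sub 1) (u v : K.UPos) :
    K.uSingle 1 u * K.uSingle g v = K.uSingle g (u * v) := by
  rw [uSingle_mul, one_mul, map_one, AlgHom.one_apply]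

theorem uSingle_one_one : K.uSingle 1 1 = 1 := rfl

theorem map_uSingle_mul (g : G ⧸ K.sub 1) (a b : K.UPos) (T : K.UPos ⊗[ℚ] K.UPos) :
    TensorProduct.map (K.uSingle g) (K.uSingle g) (a ⊗ₜ b * T) =
      K.uSingle 1 a ⊗ₜ K.uSingle 1 b * TensorProduct.map (K.uSingle g) (K.uSingle g) T := by
  induction T using TensorProduct.induction_on with
  | zero => rw [mul_zero, map_zero, mul_zero]
  | add x y hx hy => rw [mul_add, map_add, hx, hy, map_add, mul_add]
  | tmul c d =>
    rw [Algebra.TensorProduct.tmul_mul_tmul, TensorProduct.map_tmul, TensorProduct.map_tmul,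
      Algebra.TensorProduct.tmul_mul_tmul, uSingle_one_mul, uSingle_one_mul]

theorem comulU_uSingle_ι_mul (g : G ⧸ K.sub 1) (x : K.GrLieQ) (u : K.UPos) :
    K.comulU (K.uSingle g (UniversalEnvelopingAlgebra.ι ℚ x * u)) =
      (K.uSingle 1 (UniversalEnvelopingAlgebra.ι ℚ x) ⊗ₜ 1 +
        1 ⊗ₜ K.uSingle 1 (UniversalEnvelopingAlgebra.ι ℚ x)) * K.comulU (K.uSingle g u) := by
  rw [comulU_uSingle, comulU_uSingle, map_mul, comulUPos_ι, add_mul, map_add, map_uSingle_mul,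
    map_uSingle_mul, ← add_mul, uSingle_one_one]

theorem comul_of (g : G) : Coalgebra.comul (R := ℚ) (MonoidAlgebra.of ℚ G g) =
    MonoidAlgebra.of ℚ G g ⊗ₜ MonoidAlgebra.of ℚ G g := by
  rw [MonoidAlgebra.of_apply, MonoidAlgebra.comul_single]
  simp

theorem comul_inc (k : G) : Coalgebra.comul (R := ℚ) (inc k) =
    inc k ⊗ₜ 1 + 1 ⊗ₜ inc k + inc k ⊗ₜ[ℚ] inc k := by
  simp only [inc, map_sub, comul_of, Bialgebra.comul_one, Algebra.TensorProduct.one_def,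
    TensorProduct.sub_tmul, TensorProduct.tmul_sub]
  abel

theorem comparison_uSingle_ι (m : ℕ+) (k : K.sub m) :
    K.comparison (K.uSingle 1 (UniversalEnvelopingAlgebra.ι ℚ (K.clsQ m k))) =
      K.fil.mono m (inc (k : G)) (K.inc_mem_J k.2) := by
  rw [comparison_uSingle, compPos_ι, map_one, mul_one]

theorem comul_mem_tensorRep (g : G) (l : List (Σ m : ℕ+, K.sub m)) :
    (K.comulU (K.uSingle (QuotientGroup.mk g) (K.clsProd l)),
      Coalgebra.comul (R := ℚ) (K.incProd l * MonoidAlgebra.of ℚ G g)) ∈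
      K.tensorRep (K.wt l) := by
  induction l with
  | nil =>
    have h1 : K.comulU (K.uSingle (QuotientGroup.mk g) (K.clsProd [])) =
        K.uSingle (QuotientGroup.mk g) 1 ⊗ₜ K.uSingle (QuotientGroup.mk g) 1 := by
      rw [comulU_uSingle]
      change TensorProduct.map _ _ (K.comulUPos 1) = _
      rw [map_one, Algebra.TensorProduct.one_def, TensorProduct.map_tmul]
    have h2 : K.incProd [] * MonoidAlgebra.of ℚ G g = MonoidAlgebra.of ℚ G g := one_mul _
    have h3 : K.comparison (K.uSingle (QuotientGroup.mk g) 1) =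
        K.fil.mono 0 (MonoidAlgebra.of ℚ G g) (K.fil.mem_zero _) := by
      rw [comparison_uSingle, map_one, one_mul]
      rfl
    rw [h1, h2, comul_of]
    exact K.tensorRep_tmul rfl _ _ h3 h3
  | cons p l ih =>
    rw [clsProd_cons, comulU_uSingle_ι_mul, incProd_cons, mul_assoc, Bialgebra.comul_mul, wt_cons]
    refine K.tensorRep_mul_le _ _ (Submodule.mul_mem_mul (m := (_, _)) (n := (_, _)) ?_ ih)
    have hk := K.inc_mem_J p.2.2
    have h1 : K.comparison 1 = K.fil.mono 0 1 (K.fil.mem_zero 1) := map_one _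
    have e := add_mem (add_mem
      (K.tensorRep_tmul (add_zero _) hk (K.fil.mem_zero 1) (K.comparison_uSingle_ι p.1 p.2) h1)
      (K.tensorRep_tmul (zero_add _) (K.fil.mem_zero 1) hk h1 (K.comparison_uSingle_ι p.1 p.2)))
      (K.tensorRep_zero (n := p.1) (K.J2_antitone (show (p.1 : ℕ) + 1 ≤ p.1 + p.1 from
        Nat.add_le_add_left p.1.pos _) (K.tmul_mem_J2 rfl hk hk)))
    rw [Prod.mk_add_mk, Prod.mk_add_mk, add_zero, ← comul_inc] at e
    exact e

/-- The comparison homomorphism is compatible with the comultiplications. -/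
theorem grHatComul_comparison (i j : ℕ) (u : K.U) : K.fil.grHatComul i j (K.comparison u) =
    TensorProduct.map (K.compDeg i) (K.compDeg j) (K.comulU u) := by
  induction u using K.uSingle_induction with
  | add u v hu hv => rw [map_add, map_add, hu, hv, map_add, map_add]
  | smul q u hu => rw [map_smul, map_smul, hu, map_smul, map_smul]
  | prod g l =>
    have h := K.map_compDeg_of_tensorRep (K.comul_mem_tensorRep g l) i j
    rw [comparison_clsProd]
    change K.fil.grComul i j (K.fil.grComp (i + j) _) = _
    by_cases hij : i + j = K.wt l
    · apply K.fil.grInclTensor_injective i j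
      rw [h.1 hij, K.fil.mono_cast hij.symm, K.fil.grComp_mono_self,
        K.fil.grInclTensor_grComul]
    · rw [h.2 hij, K.fil.grComp_mono_of_ne hij, map_zero]

theorem counitU_uSingle (g : G ⧸ K.sub 1) (u : K.UPos) :
    K.counitU (K.uSingle g u) = K.counitUPos u := by
  change (Finsupp.lsum ℚ fun _ : G ⧸ K.sub 1 => K.counitUPos.toLinearMap)
    (Finsupp.single g u) = _
  rw [Finsupp.lsum_single]
  rfl

/-- The comparison homomorphism is compatible with the counits. -/
theorem grHatCounit_comparison (u : K.U) : K.fil.grHatCounit (K.comparison u) = K.counitU u := by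
  induction u using K.uSingle_induction with
  | add u v hu hv => rw [map_add, map_add, hu, hv, map_add]
  | smul q u hu => rw [map_smul, map_smul, hu, map_smul]
  | prod g l =>
    rw [comparison_clsProd, counitU_uSingle]
    unfold HopfFiltration.grHatCounit
    rw [LinearMap.comp_apply]
    cases l with
    | nil =>
      have h1 : K.fil.grComp 0 (K.fil.mono (K.wt []) (K.incProd [] * MonoidAlgebra.of ℚ G g)
          (K.incProd_mul_of_mem_J [] g)) = K.fil.grMk 0 ⟨_, K.incProd_mul_of_mem_J [] g⟩ :=
        K.fil.grComp_mono_self 0 _ _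
      rw [h1]
      change Coalgebra.counit (R := ℚ) (K.incProd [] * MonoidAlgebra.of ℚ G g) = K.counitUPos 1
      rw [map_one]
      change Coalgebra.counit (R := ℚ) (1 * MonoidAlgebra.of ℚ G g) = 1
      rw [one_mul, MonoidAlgebra.of_apply, MonoidAlgebra.counit_single]
      simp
    | cons p l =>
      have hp := p.1.pos
      rw [K.fil.grComp_mono_of_ne (by rw [wt_cons]; omega), map_zero, clsProd_cons, map_mul]
      unfold counitUPos
      rw [UniversalEnvelopingAlgebra.lift_ι_apply]
      simp

end ExtendedNSeries

/-! ### From expansions to formality -/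

namespace ExtendedNSeries

variable {G : Type*} [Group G] {K : ExtendedNSeries G}

/-- The algebra homomorphism `ℚ[K₀] → ∏ J_m / J_{m+1}` attached to a homomorphism
`θ : K₀ → Û(gr_•^ℚ(K))`. -/
def expHom (θ : G →* K.UHat) : MonoidAlgebra ℚ G →ₐ[ℚ] K.fil.GrHat :=
  K.compHat.comp (MonoidAlgebra.lift ℚ K.UHat G θ)

theorem expHom_of (θ : G →* K.UHat) (g : G) :
    expHom θ (MonoidAlgebra.of ℚ G g) = K.compHat (θ g) := by
  unfold expHom
  rw [AlgHom.comp_apply, MonoidAlgebra.lift_of]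

theorem compDeg_of_mem {u : K.U} {n i : ℕ} (hu : u ∈ K.uDeg n) (h : i ≠ n) :
    K.compDeg i u = 0 :=
  HopfFiltration.grComp_eq_zero_of_homog (K.comparison_mem_homog hu) h

theorem map_compDeg_sum (x y : K.UHat) (n i j : ℕ) :
    TensorProduct.map (K.compDeg i) (K.compDeg j)
      (∑ p ∈ Finset.HasAntidiagonal.antidiagonal n, K.comp x p.1 ⊗ₜ[ℚ] K.comp y p.2) =
    if i + j = n then K.compDeg i (K.comp x i) ⊗ₜ K.compDeg j (K.comp y j) else 0 := by
  have h0 : ∀ p : ℕ × ℕ, p ≠ (i, j) →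
      K.compDeg i (K.comp x p.1) ⊗ₜ[ℚ] K.compDeg j (K.comp y p.2) = 0 := by
    rintro ⟨s, t⟩ hp
    by_cases hs : i = s
    · have ht : j ≠ t := fun ht => hp (by rw [hs, ht])
      rw [compDeg_of_mem (K.comp_mem y t) ht, TensorProduct.tmul_zero]
    · rw [compDeg_of_mem (K.comp_mem x s) hs, TensorProduct.zero_tmul]
  rw [map_sum]
  simp only [TensorProduct.map_tmul]
  split_ifs with h
  · rw [Finset.sum_eq_single (i, j) (fun p _ hp => h0 p hp)
      (fun hp => absurd (Finset.HasAntidiagonal.mem_antidiagonal.2 h) hp)]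
  · refine Finset.sum_eq_zero fun p hp => h0 p ?_
    rintro rfl
    exact h (Finset.HasAntidiagonal.mem_antidiagonal.1 hp)

theorem lead_mul {Φ : MonoidAlgebra ℚ G →ₐ[ℚ] K.fil.GrHat} {m n k : ℕ} (hk : m + n = k)
    {a b : MonoidAlgebra ℚ G} (ha : a ∈ K.fil.J m) (hb : b ∈ K.fil.J n) (hab : a * b ∈ K.fil.J k)
    (h : Φ a - K.fil.mono m a ha ∈ K.fil.grHatGE (m + 1))
    (h' : Φ b - K.fil.mono n b hb ∈ K.fil.grHatGE (n + 1)) :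
    Φ (a * b) - K.fil.mono k (a * b) hab ∈ K.fil.grHatGE (k + 1) := by
  subst hk
  have hΦb : Φ b ∈ K.fil.grHatGE n := by
    have := add_mem (K.fil.grHatGE_antitone (Nat.le_succ n) h') (K.fil.mono_mem hb)
    rwa [sub_add_cancel] at this
  have e : Φ (a * b) - K.fil.mono (m + n) (a * b) (K.fil.mul_mem ha hb) =
      (Φ a - K.fil.mono m a ha) * Φ b + K.fil.mono m a ha * (Φ b - K.fil.mono n b hb) := by
    rw [map_mul, ← K.fil.mono_mul ha hb, sub_mul, mul_sub, sub_add_sub_cancel]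
  rw [e]
  refine add_mem ?_ ?_
  · have := K.fil.grHatGE_mul h hΦb
    rwa [add_right_comm] at this
  · have := K.fil.grHatGE_mul (K.fil.mono_mem ha) h'
    rwa [← add_assoc] at this

theorem IsExpansion.lead_inc {θ : G →* K.UHat} (hθ : K.IsExpansion θ) (m : ℕ+) (k : K.sub m) :
    expHom θ (inc (k : G)) - K.fil.mono m (inc (k : G)) (K.inc_mem_J k.2) ∈
      K.fil.grHatGE (m + 1) := by
  obtain ⟨h0, h1, h2⟩ := hθ.leading_pos m k
  have hm := m.pos
  intro j hj
  have e : expHom θ (inc (k : G)) = K.compHat (θ k) - 1 := by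
    rw [inc, map_sub, expHom_of, map_one]
  rw [map_sub, e, map_sub, grComp_compHat]
  by_cases hj0 : j = 0
  · subst hj0
    rw [h0, map_one, sub_self, K.fil.grComp_mono_of_ne (by omega), sub_self]
  · have h3 : K.fil.grComp j 1 = 0 := K.fil.grComp_mono_of_ne hj0 1 (K.fil.mem_zero 1)
    rw [h3, _root_.sub_zero]
    rcases Nat.lt_succ_iff_lt_or_eq.1 hj with hj | rfl
    · rw [h1 j (Nat.pos_of_ne_zero hj0) hj, map_zero, map_zero,
        K.fil.grComp_mono_of_ne hj.ne, sub_self]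
    · rw [h2, comparison_uSingle_ι]
      exact sub_self _

theorem IsExpansion.lead_of {θ : G →* K.UHat} (hθ : K.IsExpansion θ) (g : G) :
    expHom θ (MonoidAlgebra.of ℚ G g) -
      K.fil.mono 0 (MonoidAlgebra.of ℚ G g) (K.fil.mem_zero _) ∈ K.fil.grHatGE 1 := by
  intro j hj
  obtain rfl : j = 0 := by omega
  rw [map_sub, expHom_of, grComp_compHat, hθ.leading_zero, comparison_uSingle, map_one, one_mul]
  exact sub_self _

theorem IsExpansion.leadingTermId {θ : G →* K.UHat} (hθ : K.IsExpansion θ) :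
    K.fil.LeadingTermId (expHom θ) := by
  have h1 : ∀ l : List (Σ m : ℕ+, K.sub m), expHom θ (K.incProd l) -
      K.fil.mono (K.wt l) (K.incProd l) (K.incProd_mem_J l) ∈ K.fil.grHatGE (K.wt l + 1) := by
    intro l
    induction l with
    | nil =>
      have : expHom θ 1 - K.fil.mono 0 1 (K.fil.mem_zero 1) ∈ K.fil.grHatGE (0 + 1) := by
        rw [map_one, K.fil.mono_one, sub_self]
        exact zero_mem _
      exact this
    | cons p l ih =>
      exact lead_mul (K.wt_cons p l).symm (K.inc_mem_J p.2.2) (K.incProd_mem_J l)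
        (K.incProd_mem_J (p :: l)) (hθ.lead_inc p.1 p.2) ih
  intro n a ha
  let S : Submodule ℚ (MonoidAlgebra ℚ G) :=
    { carrier := {a | ∃ ha : a ∈ K.fil.J n,
        expHom θ a - K.fil.mono n a ha ∈ K.fil.grHatGE (n + 1)}
      zero_mem' := ⟨zero_mem _, by
        rw [map_zero, K.fil.mono_eq_zero _ (zero_mem _), sub_self]; exact zero_mem _⟩
      add_mem' := by
        rintro a b ⟨ha, h⟩ ⟨hb, h'⟩
        refine ⟨add_mem ha hb, ?_⟩
        rw [map_add, K.fil.mono_add ha hb, add_sub_add_comm]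
        exact add_mem h h'
      smul_mem' := by
        rintro q a ⟨ha, h⟩
        refine ⟨Submodule.smul_mem _ q ha, ?_⟩
        rw [map_smul, K.fil.mono_smul q ha, ← smul_sub]
        exact Submodule.smul_mem _ q h }
  have key : K.fil.J n ≤ S := by
    refine (K.J_eq_prodSpan n).le.trans (Submodule.span_le.2 ?_)
    rintro _ ⟨l, -, hn, g, -, rfl⟩
    have h2 := lead_mul (add_zero _) (K.incProd_mem_J l) (K.fil.mem_zero _)
      (K.incProd_mul_of_mem_J l g) (h1 l) (hθ.lead_of g)
    rcases hn.eq_or_lt with rfl | hn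
    · exact ⟨K.incProd_mul_of_mem_J l g, h2⟩
    · have h3 := K.fil.antitone hn (K.incProd_mul_of_mem_J l g)
      refine ⟨K.fil.antitone (Nat.le_succ n) h3, ?_⟩
      rw [K.fil.mono_eq_zero _ h3, _root_.sub_zero]
      have h4 := add_mem (K.fil.grHatGE_antitone (Nat.le_succ _) h2)
        (K.fil.mono_mem (K.incProd_mul_of_mem_J l g))
      rw [sub_add_cancel] at h4
      exact K.fil.grHatGE_antitone hn h4
  exact (key ha).2

theorem IsExpansion.comulCompat {θ : G →* K.UHat} (hθ : K.IsExpansion θ) :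
    K.fil.ComulCompat (expHom θ) := by
  intro i j a
  induction a using MonoidAlgebra.of_induction with
  | add x y hx hy => simp only [map_add, hx, hy]
  | smul q x hx => simp only [map_smul, hx]
  | of g =>
    rw [comul_of, TensorProduct.map_tmul]
    change K.fil.grComp i (expHom θ _) ⊗ₜ K.fil.grComp j (expHom θ _) = _
    rw [expHom_of]
    have h1 : K.fil.grHatComul i j (K.compHat (θ g)) =
        K.fil.grHatComul i j (K.comparison (K.comp (θ g) (i + j))) := rfl
    rw [h1, grHatComul_comparison, (hθ.groupLike g).1 (i + j), map_compDeg_sum, if_pos rfl]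
    rfl

theorem IsExpansion.counitCompat {θ : G →* K.UHat} (hθ : K.IsExpansion θ) :
    K.fil.CounitCompat (expHom θ) := by
  intro a
  induction a using MonoidAlgebra.of_induction with
  | add x y hx hy => simp only [map_add, hx, hy]
  | smul q x hx => simp only [map_smul, hx]
  | of g =>
    have h1 : K.fil.grHatCounit (K.compHat (θ g)) =
        K.fil.grHatCounit (K.comparison (K.comp (θ g) 0)) := rfl
    rw [expHom_of, h1, grHatCounit_comparison, (hθ.groupLike g).2, MonoidAlgebra.of_apply,
      MonoidAlgebra.counit_single]
    simp

theorem IsExpansion.isFormal {θ : G →* K.UHat} (hθ : K.IsExpansion θ) : K.IsFormal :=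
  K.fil.isFormal_of_algHom (expHom θ) hθ.leadingTermId hθ.comulCompat hθ.counitCompat

end ExtendedNSeries

/-! ### Roots of unipotent elements -/

open Polynomial in
/-- A `p`-th root of `X` modulo `(X - 1)^n`, congruent to `1` modulo `X - 1`. -/
theorem exists_polynomial_root (n : ℕ) {p : ℕ} (hp : p ≠ 0) :
    ∃ P : ℚ[X], (X - 1 : ℚ[X]) ∣ P - 1 ∧ (X - 1 : ℚ[X]) ^ n ∣ P ^ p - X := by
  -- the exponent `n + 1` is positive, so that congruences modulo `(X - 1) ^ (n + 1)` imply
  -- congruences modulo `X - 1`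
  let I : Ideal ℚ[X] := Ideal.span {(X - 1 : ℚ[X]) ^ (n + 1)}
  let ξ : ℚ[X] ⧸ I := Ideal.Quotient.mk I X
  let f : (ℚ[X] ⧸ I)[X] := X ^ p - C ξ
  have hI : ∀ a : ℚ[X], (Ideal.Quotient.mk I a = 0) ↔ (X - 1 : ℚ[X]) ^ (n + 1) ∣ a := fun a =>
    Ideal.Quotient.eq_zero_iff_mem.trans Ideal.mem_span_singleton
  have h1 : IsNilpotent (aeval (1 : ℚ[X] ⧸ I) f) := by
    have : aeval (1 : ℚ[X] ⧸ I) f = -(ξ - 1) := by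
      simp [f]
    rw [this]
    refine IsNilpotent.neg ⟨n + 1, ?_⟩
    have h3 : (ξ - 1) ^ (n + 1) = Ideal.Quotient.mk I ((X - 1) ^ (n + 1)) := by
      rw [map_pow, map_sub, map_one]
    rw [h3, hI]
  have h2 : IsUnit (aeval (1 : ℚ[X] ⧸ I) (derivative f)) := by
    have : aeval (1 : ℚ[X] ⧸ I) (derivative f) = algebraMap ℚ (ℚ[X] ⧸ I) (p : ℚ) := by
      simp [f, Polynomial.derivative_X_pow]
    rw [this]
    exact (IsUnit.mk0 (p : ℚ) (Nat.cast_ne_zero.2 hp)).map _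
  obtain ⟨r, ⟨hr1, hr2⟩, -⟩ := existsUnique_nilpotent_sub_and_aeval_eq_zero h1 h2
  obtain ⟨P, rfl⟩ := Ideal.Quotient.mk_surjective r
  refine ⟨P, ?_, ?_⟩
  · obtain ⟨k, hk⟩ := hr1
    rw [← map_one (Ideal.Quotient.mk I), ← map_sub, ← map_pow, hI] at hk
    have hprime : Prime (X - 1 : ℚ[X]) := by
      have := prime_X_sub_C (1 : ℚ)
      rwa [map_one] at this
    have h3 : (X - 1 : ℚ[X]) ∣ (1 - P) ^ k := (dvd_pow_self _ n.succ_ne_zero).trans hk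
    rw [← neg_sub 1 P, dvd_neg]
    exact hprime.dvd_of_dvd_pow h3
  · have h3 : Ideal.Quotient.mk I (P ^ p - X) = 0 := by
      rw [map_sub, map_pow]
      simpa [f, ξ] using hr2
    exact (pow_dvd_pow _ n.le_succ).trans ((hI _).1 h3)

/-! ### The rational group algebra of a subgroup, modulo a term of the filtration -/

namespace ExtendedNSeries

variable {G : Type*} [Group G] (K : ExtendedNSeries G)

/-- The inclusion `ℚ[N] → ℚ[G]`. -/
def incl (N : Subgroup G) : MonoidAlgebra ℚ N →ₐ[ℚ] MonoidAlgebra ℚ G :=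
  MonoidAlgebra.lift ℚ _ N ((MonoidAlgebra.of ℚ G).comp N.subtype)

theorem incl_of {N : Subgroup G} (a : N) :
    incl N (MonoidAlgebra.of ℚ N a) = MonoidAlgebra.of ℚ G (a : G) := by
  unfold incl
  rw [MonoidAlgebra.lift_of]
  rfl

theorem grpSpan_le_range (N : Subgroup G) : grpSpan N ≤ LinearMap.range (incl N).toLinearMap := by
  refine Submodule.span_le.2 ?_
  rintro _ ⟨g, hg, rfl⟩
  exact ⟨_, incl_of ⟨g, hg⟩⟩

theorem incl_mem (N : Subgroup G) (x : MonoidAlgebra ℚ N) : incl N x ∈ K.prodSpan N 0 := by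
  induction x using MonoidAlgebra.of_induction with
  | of a => rw [incl_of]; exact K.of_mem_prodSpan a.2
  | add x y hx hy => rw [map_add]; exact add_mem hx hy
  | smul q x hx => rw [map_smul]; exact Submodule.smul_mem _ q hx

theorem prodSpan_mul_mem {N : Subgroup G} {i j : ℕ} {x y : MonoidAlgebra ℚ G}
    (hx : x ∈ K.prodSpan N i) (hy : y ∈ K.prodSpan N j) : x * y ∈ K.prodSpan N (i + j) :=
  K.prodSpan_mul_le N i j (Submodule.mul_mem_mul hx hy)

/-- The `n`-th term of the filtration of `ℚ[N]`, as an ideal. -/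
def resIdeal (N : Subgroup G) (n : ℕ) : Ideal (MonoidAlgebra ℚ N) where
  carrier := {x | incl N x ∈ K.prodSpan N n}
  zero_mem' := by
    change incl N 0 ∈ K.prodSpan N n
    rw [map_zero]; exact zero_mem _
  add_mem' {x y} hx hy := by
    change incl N (x + y) ∈ K.prodSpan N n
    rw [map_add]; exact add_mem hx hy
  smul_mem' a x hx := by
    change incl N (a * x) ∈ K.prodSpan N n
    rw [map_mul]
    have := K.prodSpan_mul_mem (i := 0) (j := n) (K.incl_mem N a) hx
    rwa [zero_add] at this

theorem mem_resIdeal {N : Subgroup G} {n : ℕ} {x : MonoidAlgebra ℚ N} :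
    x ∈ K.resIdeal N n ↔ incl N x ∈ K.prodSpan N n := Iff.rfl

instance (N : Subgroup G) (n : ℕ) : (K.resIdeal N n).IsTwoSided where
  mul_mem_of_left {x} a hx := by
    rw [mem_resIdeal, map_mul]
    exact K.prodSpan_mul_mem (i := n) (j := 0) hx (K.incl_mem N a)

/-- The truncated group algebra `ℚ[N] / J_n(N)`. -/
abbrev ResQuot (N : Subgroup G) (n : ℕ) : Type _ := MonoidAlgebra ℚ N ⧸ K.resIdeal N n

/-- The projection `ℚ[N] → ℚ[N] / J_n(N)`. -/
def resMk (N : Subgroup G) (n : ℕ) : MonoidAlgebra ℚ N →ₐ[ℚ] K.ResQuot N n :=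
  Ideal.Quotient.mkₐ ℚ (K.resIdeal N n)

theorem resMk_surjective (N : Subgroup G) (n : ℕ) : Function.Surjective (K.resMk N n) :=
  Ideal.Quotient.mk_surjective

theorem resMk_eq_zero {N : Subgroup G} {n : ℕ} {x : MonoidAlgebra ℚ N} :
    K.resMk N n x = 0 ↔ incl N x ∈ K.prodSpan N n :=
  Ideal.Quotient.eq_zero_iff_mem

/-- The filtration of `ℚ[N] / J_n(N)`. -/
def resFil (N : Subgroup G) (n i : ℕ) : Submodule ℚ (K.ResQuot N n) :=
  ((K.prodSpan N i).comap (incl N).toLinearMap).map (K.resMk N n).toLinearMap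

theorem resMk_mem {N : Subgroup G} {n i : ℕ} {x : MonoidAlgebra ℚ N}
    (hx : incl N x ∈ K.prodSpan N i) : K.resMk N n x ∈ K.resFil N n i := ⟨x, hx, rfl⟩

theorem resFil_antitone (N : Subgroup G) (n : ℕ) : Antitone (K.resFil N n) := fun _ _ h =>
  Submodule.map_mono (Submodule.comap_mono (K.prodSpan_antitone N h))

theorem mem_resFil_zero {N : Subgroup G} {n : ℕ} (x : K.ResQuot N n) : x ∈ K.resFil N n 0 := by
  obtain ⟨x, rfl⟩ := K.resMk_surjective N n x
  exact K.resMk_mem (K.incl_mem N x)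

theorem resFil_mul {N : Subgroup G} {n i j : ℕ} {x y : K.ResQuot N n} (hx : x ∈ K.resFil N n i)
    (hy : y ∈ K.resFil N n j) : x * y ∈ K.resFil N n (i + j) := by
  obtain ⟨x, hx, rfl⟩ := hx
  obtain ⟨y, hy, rfl⟩ := hy
  refine ⟨x * y, ?_, map_mul (K.resMk N n) x y⟩
  change incl N (x * y) ∈ K.prodSpan N (i + j)
  rw [map_mul]
  exact K.prodSpan_mul_mem hx hy

theorem resFil_mul_left {N : Subgroup G} {n i : ℕ} {x : K.ResQuot N n} (hx : x ∈ K.resFil N n i)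
    (y : K.ResQuot N n) : y * x ∈ K.resFil N n i := by
  have := K.resFil_mul (K.mem_resFil_zero y) hx
  rwa [zero_add] at this

theorem resFil_mul_right {N : Subgroup G} {n i : ℕ} {x : K.ResQuot N n} (hx : x ∈ K.resFil N n i)
    (y : K.ResQuot N n) : x * y ∈ K.resFil N n i :=
  K.resFil_mul (i := i) (j := 0) hx (K.mem_resFil_zero y)

theorem eq_zero_of_mem_resFil {N : Subgroup G} {n : ℕ} {x : K.ResQuot N n}
    (hx : x ∈ K.resFil N n n) : x = 0 := by
  obtain ⟨x, hx, rfl⟩ := hx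
  exact K.resMk_eq_zero.2 hx

/-- The image of `a ∈ N` in the truncated group algebra. -/
def resOf (N : Subgroup G) (n : ℕ) : N →* (K.ResQuot N n)ˣ :=
  ((K.resMk N n : MonoidAlgebra ℚ N →* K.ResQuot N n).comp (MonoidAlgebra.of ℚ N)).toHomUnits

theorem coe_resOf {N : Subgroup G} {n : ℕ} (a : N) :
    (K.resOf N n a : K.ResQuot N n) = K.resMk N n (MonoidAlgebra.of ℚ N a) := rfl

theorem resOf_sub_one_mem {N : Subgroup G} {n m : ℕ} (hm : 0 < m) {a : N}
    (ha : (a : G) ∈ K.sub m) : (K.resOf N n a : K.ResQuot N n) - 1 ∈ K.resFil N n m := by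
  rw [coe_resOf, ← map_one (K.resMk N n), ← map_sub]
  refine K.resMk_mem ?_
  rw [map_sub, incl_of, map_one]
  exact K.inc_mem_prodSpan hm ha a.2

theorem resFil_one_pow {N : Subgroup G} {n : ℕ} {x : K.ResQuot N n} (hx : x ∈ K.resFil N n 1)
    (k : ℕ) : x ^ k ∈ K.resFil N n k := by
  induction k with
  | zero => exact K.mem_resFil_zero _
  | succ k ih => rw [pow_succ]; exact K.resFil_mul ih hx

/-! ### Conjugation on the truncated group algebra -/

/-- Conjugation by an element `h` which normalizes `N`. -/
def conjN {N : Subgroup G} (h : G) (hh : ∀ a ∈ N, h * a * h⁻¹ ∈ N) : N →* N :=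
  MonoidHom.mk' (fun a => ⟨h * a * h⁻¹, hh a a.2⟩) (fun a b => by ext; simp)

theorem incl_conjN {N : Subgroup G} (h : G) (hh : ∀ a ∈ N, h * a * h⁻¹ ∈ N)
    (x : MonoidAlgebra ℚ N) :
    incl N (MonoidAlgebra.mapDomainAlgHom ℚ ℚ (conjN h hh) x) =
      MonoidAlgebra.of ℚ G h * incl N x * MonoidAlgebra.of ℚ G h⁻¹ := by
  induction x using MonoidAlgebra.of_induction with
  | of a =>
    have : MonoidAlgebra.mapDomainAlgHom ℚ ℚ (conjN h hh) (MonoidAlgebra.of ℚ N a) =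
        MonoidAlgebra.of ℚ N (conjN h hh a) := by simp
    rw [this, incl_of, incl_of, ← map_mul, ← map_mul]
    rfl
  | add x y hx hy => rw [map_add, map_add, hx, hy, map_add, mul_add, add_mul]
  | smul q x hx => rw [map_smul, map_smul, hx, map_smul, mul_smul_comm, smul_mul_assoc]

theorem of_mul_mul_of_inv (h : G) (l : List (Σ m : ℕ+, K.sub m)) (g : G) :
    MonoidAlgebra.of ℚ G h * (K.incProd l * MonoidAlgebra.of ℚ G g) * MonoidAlgebra.of ℚ G h⁻¹ =
      K.incProd (K.conjList h l) * MonoidAlgebra.of ℚ G (h * g * h⁻¹) := by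
  rw [← mul_assoc, of_mul_incProd, map_mul, map_mul]
  simp only [mul_assoc]

theorem conj_mem_prodSpan {N : Subgroup G} {h : G} (hh : ∀ a ∈ N, h * a * h⁻¹ ∈ N) {n : ℕ}
    {x : MonoidAlgebra ℚ G} (hx : x ∈ K.prodSpan N n) :
    MonoidAlgebra.of ℚ G h * x * MonoidAlgebra.of ℚ G h⁻¹ ∈ K.prodSpan N n := by
  have : K.prodSpan N n ≤ (K.prodSpan N n).comap
      (LinearMap.mulRight ℚ (MonoidAlgebra.of ℚ G h⁻¹) ∘ₗ
        LinearMap.mulLeft ℚ (MonoidAlgebra.of ℚ G h)) := by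
    refine Submodule.span_le.2 ?_
    rintro _ ⟨l, hl, hn, g, hg, rfl⟩
    change MonoidAlgebra.of ℚ G h * _ * MonoidAlgebra.of ℚ G h⁻¹ ∈ K.prodSpan N n
    rw [of_mul_mul_of_inv]
    refine K.incProd_mul_mem ?_ (by rwa [wt_conjList]) (hh g hg)
    intro p hp
    obtain ⟨q, hq, rfl⟩ := List.mem_map.1 hp
    exact hh _ (hl q hq)
  exact this hx

/-- Conjugation by `h` on the truncated group algebra. -/
def resConj {N : Subgroup G} (n : ℕ) (h : G) (hh : ∀ a ∈ N, h * a * h⁻¹ ∈ N) :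
    K.ResQuot N n →ₐ[ℚ] K.ResQuot N n :=
  Ideal.quotientMapₐ (K.resIdeal N n) (MonoidAlgebra.mapDomainAlgHom ℚ ℚ (conjN h hh))
    (by
      intro x hx
      rw [Ideal.mem_comap, mem_resIdeal, incl_conjN]
      exact K.conj_mem_prodSpan hh hx)

theorem resConj_resMk {N : Subgroup G} {n : ℕ} {h : G} (hh : ∀ a ∈ N, h * a * h⁻¹ ∈ N)
    (x : MonoidAlgebra ℚ N) : K.resConj n h hh (K.resMk N n x) =
      K.resMk N n (MonoidAlgebra.mapDomainAlgHom ℚ ℚ (conjN h hh) x) := rfl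

theorem resConj_resOf {N : Subgroup G} {n : ℕ} {h : G} (hh : ∀ a ∈ N, h * a * h⁻¹ ∈ N) (a : N) :
    K.resConj n h hh (K.resOf N n a) = K.resOf N n ⟨h * a * h⁻¹, hh a a.2⟩ := by
  rw [coe_resOf, coe_resOf, resConj_resMk]
  congr 1
  simp
  rfl

section Conjugation

variable {K}
variable {w : ℕ} {N : Subgroup G}

theorem normalizes (h1 : K.sub (w + 1) ≤ N) (h2 : N ≤ K.sub w) (hw : 0 < w) {h : G} (hh : h ∈ K.sub w) : ∀ a ∈ N, h * a * h⁻¹ ∈ N := by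
  intro a ha
  have h3 : ⁅h, a⁆ ∈ N := h1 (K.antitone (by omega) (K.comm_mem hh (h2 ha)))
  have := N.mul_mem h3 ha
  simpa [commutatorElement_def] using this

/-- Conjugation by an element of `K_w` is the identity up to terms of weight increased by `w`. -/
theorem conj_sub_mem (h1 : K.sub (w + 1) ≤ N) (h2 : N ≤ K.sub w) (hw : 0 < w) {h : G}
    (hh : h ∈ K.sub w) {s : ℕ}
    {x : MonoidAlgebra ℚ G} (hx : x ∈ K.prodSpan N s) :
    MonoidAlgebra.of ℚ G h * x * MonoidAlgebra.of ℚ G h⁻¹ - x ∈ K.prodSpan N (w + s) := by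
  have hN := normalizes h1 h2 hw hh
  have hone : MonoidAlgebra.of ℚ G h⁻¹ * MonoidAlgebra.of ℚ G h = 1 := by
    rw [← map_mul, inv_mul_cancel, map_one]
  -- the operation is a twisted derivation
  have der : ∀ {i j : ℕ} {x y : MonoidAlgebra ℚ G}, x ∈ K.prodSpan N i → y ∈ K.prodSpan N j →
      MonoidAlgebra.of ℚ G h * x * MonoidAlgebra.of ℚ G h⁻¹ - x ∈ K.prodSpan N (w + i) →
      MonoidAlgebra.of ℚ G h * y * MonoidAlgebra.of ℚ G h⁻¹ - y ∈ K.prodSpan N (w + j) →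
      MonoidAlgebra.of ℚ G h * (x * y) * MonoidAlgebra.of ℚ G h⁻¹ - x * y ∈
        K.prodSpan N (w + (i + j)) := by
    intro i j x y hx hy hx' hy'
    have e : MonoidAlgebra.of ℚ G h * (x * y) * MonoidAlgebra.of ℚ G h⁻¹ - x * y =
        (MonoidAlgebra.of ℚ G h * x * MonoidAlgebra.of ℚ G h⁻¹ - x) *
          (MonoidAlgebra.of ℚ G h * y * MonoidAlgebra.of ℚ G h⁻¹) +
        x * (MonoidAlgebra.of ℚ G h * y * MonoidAlgebra.of ℚ G h⁻¹ - y) := by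
      have e1 : (MonoidAlgebra.of ℚ G h * x * MonoidAlgebra.of ℚ G h⁻¹) *
          (MonoidAlgebra.of ℚ G h * y * MonoidAlgebra.of ℚ G h⁻¹) =
          MonoidAlgebra.of ℚ G h * (x * y) * MonoidAlgebra.of ℚ G h⁻¹ := by
        calc _ = MonoidAlgebra.of ℚ G h * x * (MonoidAlgebra.of ℚ G h⁻¹ * MonoidAlgebra.of ℚ G h) *
              y * MonoidAlgebra.of ℚ G h⁻¹ := by simp only [mul_assoc]
          _ = _ := by rw [hone, mul_one]; simp only [mul_assoc]
      rw [sub_mul, e1, mul_sub, sub_add_sub_cancel]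
    rw [e]
    refine add_mem ?_ ?_
    · rw [← add_assoc]
      exact K.prodSpan_mul_mem hx' (K.conj_mem_prodSpan hN hy)
    · rw [add_left_comm]
      exact K.prodSpan_mul_mem hx hy'
  have dof : ∀ {m : ℕ} {k : G}, k ∈ K.sub m → k ∈ N → 0 < m →
      MonoidAlgebra.of ℚ G h * MonoidAlgebra.of ℚ G k * MonoidAlgebra.of ℚ G h⁻¹ -
        MonoidAlgebra.of ℚ G k ∈ K.prodSpan N (w + m) := by
    intro m k hk hkN hm
    have e : MonoidAlgebra.of ℚ G h * MonoidAlgebra.of ℚ G k * MonoidAlgebra.of ℚ G h⁻¹ -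
        MonoidAlgebra.of ℚ G k = inc ⁅h, k⁆ * MonoidAlgebra.of ℚ G k := by
      rw [inc, sub_mul, one_mul, ← map_mul, ← map_mul, ← map_mul]
      congr 2
      simp [commutatorElement_def]
    rw [e]
    have h3 := K.comm_mem hh hk
    exact K.prodSpan_mul_mem (i := w + m) (j := 0)
      (K.inc_mem_prodSpan (by omega) h3 (h1 (K.antitone (by omega) h3))) (K.of_mem_prodSpan hkN)
  have dinc : ∀ {m : ℕ} {k : G}, k ∈ K.sub m → k ∈ N → 0 < m →
      MonoidAlgebra.of ℚ G h * inc k * MonoidAlgebra.of ℚ G h⁻¹ - inc k ∈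
        K.prodSpan N (w + m) := by
    intro m k hk hkN hm
    have hone' : MonoidAlgebra.of ℚ G h * MonoidAlgebra.of ℚ G h⁻¹ = 1 := by
      rw [← map_mul, mul_inv_cancel, map_one]
    have := dof hk hkN hm
    rw [inc, mul_sub, sub_mul, mul_one, hone', sub_sub_sub_cancel_right]
    exact this
  have : K.prodSpan N s ≤ (K.prodSpan N (w + s)).comap
      (LinearMap.mulRight ℚ (MonoidAlgebra.of ℚ G h⁻¹) ∘ₗ
        LinearMap.mulLeft ℚ (MonoidAlgebra.of ℚ G h) - LinearMap.id) := by
    refine Submodule.span_le.2 ?_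
    rintro _ ⟨l, hl, hn, g, hg, rfl⟩
    change MonoidAlgebra.of ℚ G h * (K.incProd l * MonoidAlgebra.of ℚ G g) *
      MonoidAlgebra.of ℚ G h⁻¹ - K.incProd l * MonoidAlgebra.of ℚ G g ∈ K.prodSpan N (w + s)
    refine K.prodSpan_antitone N (Nat.add_le_add_left hn w) ?_
    clear hn
    induction l with
    | nil =>
      change MonoidAlgebra.of ℚ G h * (1 * _) * _ - 1 * _ ∈ K.prodSpan N (w + 0)
      rw [one_mul]
      exact K.prodSpan_antitone N (by omega) (dof (h2 hg) hg hw)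
    | cons p l ih =>
      have hl' : ∀ q ∈ l, (q.2 : G) ∈ N := fun q hq => hl q (List.mem_cons_of_mem _ hq)
      have hp : (p.2 : G) ∈ N := hl p List.mem_cons_self
      rw [incProd_cons, wt_cons, mul_assoc (inc _)]
      exact der (K.inc_mem_prodSpan p.1.pos p.2.2 hp) (K.incProd_mul_mem hl' le_rfl hg)
        (dinc p.2.2 hp p.1.pos) (ih hl')
  exact this hx

end Conjugation

end ExtendedNSeries

/-! ### Adjoining an element to a subgroup between `K_{w+1}` and `K_w` -/

namespace ExtendedNSeries

variable {G : Type*} [Group G] {K : ExtendedNSeries G} {w : ℕ} {N : Subgroup G} {t : G}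

/-- The group of units of `ℚ[N] / J_n(N)` which are congruent to `1` modulo weight `i`. -/
def unipotentUnits (K : ExtendedNSeries G) (N : Subgroup G) (n i : ℕ) :
    Subgroup (K.ResQuot N n)ˣ where
  carrier := {u | (u : K.ResQuot N n) - 1 ∈ K.resFil N n i}
  one_mem' := by simp
  mul_mem' {u v} hu hv := by
    have e : ((u * v : (K.ResQuot N n)ˣ) : K.ResQuot N n) - 1 = (u - 1) * v + (v - 1) := by
      rw [Units.val_mul, sub_mul, one_mul, sub_add_sub_cancel]
    change ((u * v : (K.ResQuot N n)ˣ) : K.ResQuot N n) - 1 ∈ K.resFil N n i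
    rw [e]
    exact add_mem (K.resFil_mul_right hu _) hv
  inv_mem' {u} hu := by
    have e : ((u⁻¹ : (K.ResQuot N n)ˣ) : K.ResQuot N n) - 1 =
        -((u⁻¹ : (K.ResQuot N n)ˣ) * (u - 1)) := by
      rw [mul_sub, Units.inv_mul, mul_one, neg_sub]
    change ((u⁻¹ : (K.ResQuot N n)ˣ) : K.ResQuot N n) - 1 ∈ K.resFil N n i
    rw [e]
    exact neg_mem (K.resFil_mul_left hu _)

theorem mem_unipotentUnits {n i : ℕ} {u : (K.ResQuot N n)ˣ} :
    u ∈ K.unipotentUnits N n i ↔ (u : K.ResQuot N n) - 1 ∈ K.resFil N n i := Iff.rfl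

/-- A unit of `ℚ[N] / J_n(N)` which can play the role of `t`: it is invariant under conjugation by
the powers of `t`, and its powers agree with those of `t` which belong to `N`. -/
theorem exists_resRoot (h1 : K.sub (w + 1) ≤ N) (h2 : N ≤ K.sub w) (hw : 0 < w)
    (ht : t ∈ K.sub w) (n : ℕ) :
    ∃ r : (K.ResQuot N n)ˣ, r ∈ K.unipotentUnits N n w ∧
      (∀ j : ℤ, K.resConj n (t ^ j) (normalizes h1 h2 hw (zpow_mem ht j)) r = r) ∧
      ∀ (k : ℤ) (h : t ^ k ∈ N), K.resOf N n ⟨t ^ k, h⟩ = r ^ k := by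
  obtain ⟨a, ha⟩ := Int.subgroup_cyclic
    ((Subgroup.toAddSubgroup N).comap (zmultiplesHom (Additive G) (Additive.ofMul t)))
  have hmem : ∀ k : ℤ, t ^ k ∈ N ↔ a ∣ k := by
    intro k
    rw [← Int.mem_zmultiples_iff, AddSubgroup.zmultiples_eq_closure, ← ha]
    rfl
  by_cases ha0 : a = 0
  · refine ⟨1, one_mem _, fun j => by simp, fun k h => ?_⟩
    have hk : k = 0 := by rw [hmem, ha0] at h; exact zero_dvd_iff.1 h
    subst hk
    have e : (⟨t ^ (0 : ℤ), h⟩ : N) = 1 := Subtype.ext (zpow_zero t)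
    rw [e, map_one, one_zpow]
  · have hp : a.natAbs ≠ 0 := Int.natAbs_ne_zero.2 ha0
    obtain ⟨P, hP1, hP2⟩ := exists_polynomial_root n hp
    have hta : t ^ (a.natAbs : ℤ) ∈ N := (hmem _).2 (Int.dvd_natAbs.2 dvd_rfl)
    let y : (K.ResQuot N n)ˣ := K.resOf N n ⟨t ^ (a.natAbs : ℤ), hta⟩
    have hy : (y : K.ResQuot N n) - 1 ∈ K.resFil N n w := K.resOf_sub_one_mem hw (h2 hta)
    let r : K.ResQuot N n := Polynomial.aeval (y : K.ResQuot N n) P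
    have hr1 : r - 1 ∈ K.resFil N n w := by
      obtain ⟨Q, hQ⟩ := hP1
      have : r - 1 = (y - 1) * Polynomial.aeval (y : K.ResQuot N n) Q := by
        have := congrArg (Polynomial.aeval (y : K.ResQuot N n)) hQ
        simpa using this
      rw [this]
      exact K.resFil_mul_right hy _
    have hr2 : r ^ a.natAbs = y := by
      obtain ⟨Q, hQ⟩ := hP2
      have h3 : ((y : K.ResQuot N n) - 1) ^ n = 0 :=
        K.eq_zero_of_mem_resFil (K.resFil_one_pow (K.resFil_antitone N n hw hy) n)
      have := congrArg (Polynomial.aeval (y : K.ResQuot N n)) hQ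
      rw [map_mul, map_pow, map_sub, map_sub, map_pow, Polynomial.aeval_X, map_one, h3,
        zero_mul, sub_eq_zero] at this
      exact this
    have hru : IsUnit r := (isUnit_pow_iff hp).1 (hr2 ▸ y.isUnit)
    refine ⟨hru.unit, hr1, fun j => ?_, fun k h => ?_⟩
    · have hc : K.resConj n (t ^ j) (normalizes h1 h2 hw (zpow_mem ht j)) y = y := by
        rw [K.resConj_resOf]
        congr 2
        ext
        simp only
        group
      change K.resConj n (t ^ j) _ (Polynomial.aeval (y : K.ResQuot N n) P) = _
      rw [← Polynomial.aeval_algHom_apply, hc]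
      rfl
    · obtain ⟨b, rfl⟩ := Int.natAbs_dvd.2 ((hmem k).1 h)
      have h3 : hru.unit ^ (a.natAbs : ℤ) = y := by
        ext
        rw [zpow_natCast, Units.val_pow_eq_pow_val]
        exact hr2
      have e : (⟨t ^ ((a.natAbs : ℤ) * b), h⟩ : N) = ⟨t ^ (a.natAbs : ℤ), hta⟩ ^ b :=
        Subtype.ext (by rw [Subgroup.coe_zpow, ← zpow_mul])
      rw [e, map_zpow, zpow_mul, h3]

/-- The subgroup `N ⟨t⟩`, where `t` normalizes `N`. -/
def adjoin (N : Subgroup G) (t : G) (hN : ∀ j : ℤ, ∀ a ∈ N, t ^ j * a * (t ^ j)⁻¹ ∈ N) :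
    Subgroup G where
  carrier := {g | ∃ a ∈ N, ∃ j : ℤ, g = a * t ^ j}
  one_mem' := ⟨1, N.one_mem, 0, by simp⟩
  mul_mem' := by
    rintro _ _ ⟨a, ha, i, rfl⟩ ⟨b, hb, j, rfl⟩
    exact ⟨_, N.mul_mem ha (hN i b hb), i + j, by group⟩
  inv_mem' := by
    rintro _ ⟨a, ha, i, rfl⟩
    exact ⟨_, hN (-i) _ (N.inv_mem ha), -i, by group⟩

open Classical in
/-- The map `N ⟨t⟩ → ℚ[N] / J_n(N)` sending `a t^j` to `a r^j`, extended by zero to `G`. The pair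
`(a, j)` is chosen; the value does not depend on it when the powers of `r` and of `t` agree in `N`,
see `adjoinMap_apply`. -/
def adjoinMap (K : ExtendedNSeries G) (N : Subgroup G) (t : G) (n : ℕ) (r : (K.ResQuot N n)ˣ)
    (g : G) : K.ResQuot N n :=
  if h : ∃ p : N × ℤ, g = p.1 * t ^ p.2 then
    ((K.resOf N n h.choose.1 * r ^ h.choose.2 : (K.ResQuot N n)ˣ) : K.ResQuot N n) else 0

theorem adjoinMap_apply {n : ℕ} {r : (K.ResQuot N n)ˣ}
    (hr : ∀ (k : ℤ) (h : t ^ k ∈ N), K.resOf N n ⟨t ^ k, h⟩ = r ^ k) (a : N) (j : ℤ) :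
    K.adjoinMap N t n r (a * t ^ j) = ((K.resOf N n a * r ^ j : (K.ResQuot N n)ˣ) :) := by
  have h : ∃ p : N × ℤ, (a : G) * t ^ j = p.1 * t ^ p.2 := ⟨(a, j), rfl⟩
  rw [adjoinMap, dif_pos h]
  congr 1
  generalize hb : h.choose = p
  have hp : (a : G) * t ^ j = p.1 * t ^ p.2 := hb ▸ h.choose_spec
  obtain ⟨b, k⟩ := p
  simp only at hp ⊢
  have h3 : t ^ (k - j) = (b⁻¹ * a : N) := by
    rw [zpow_sub, Subgroup.coe_mul, Subgroup.coe_inv, eq_inv_mul_iff_mul_eq, ← mul_assoc, ← hp,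
      mul_inv_cancel_right]
  have h4 : t ^ (k - j) ∈ N := h3 ▸ (b⁻¹ * a).2
  have h5 := hr (k - j) h4
  have h6 : (⟨t ^ (k - j), h4⟩ : N) = b⁻¹ * a := Subtype.ext h3
  rw [h6, map_mul, map_inv, inv_mul_eq_iff_eq_mul] at h5
  rw [h5, mul_assoc, ← zpow_add, sub_add_cancel]

theorem of_mul_mem_grpSpan {g : G} (hg : g ∈ N) {x : MonoidAlgebra ℚ G} (hx : x ∈ grpSpan N) :
    MonoidAlgebra.of ℚ G g * x ∈ grpSpan N := by
  have : grpSpan N ≤ (grpSpan N).comap (LinearMap.mulLeft ℚ (MonoidAlgebra.of ℚ G g)) := by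
    refine Submodule.span_le.2 ?_
    rintro _ ⟨h, hh, rfl⟩
    change MonoidAlgebra.of ℚ G g * MonoidAlgebra.of ℚ G h ∈ grpSpan N
    rw [← map_mul]
    exact of_mem_grpSpan (N.mul_mem hg hh)
  exact this hx

theorem inc_mul_mem_grpSpan {g : G} (hg : g ∈ N) {x : MonoidAlgebra ℚ G} (hx : x ∈ grpSpan N) :
    inc g * x ∈ grpSpan N := by
  rw [inc, sub_mul, one_mul]
  exact sub_mem (of_mul_mem_grpSpan hg hx) hx

/-- Adjoining to `N` an element of `K_w` does not enlarge the trace of the filtration on `ℚ[N]`. -/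
theorem grpSpan_inf_prodSpan_adjoin_le (h1 : K.sub (w + 1) ≤ N) (h2 : N ≤ K.sub w) (hw : 0 < w)
    (ht : t ∈ K.sub w) (n : ℕ) :
    grpSpan N ⊓ K.prodSpan
      (adjoin N t fun j => normalizes h1 h2 hw (zpow_mem ht j)) n ≤ K.prodSpan N n := by
  obtain ⟨r, hr1, hr2, hr3⟩ := exists_resRoot h1 h2 hw ht n
  have hN : ∀ j : ℤ, ∀ a ∈ N, t ^ j * a * (t ^ j)⁻¹ ∈ N := fun j =>
    normalizes h1 h2 hw (zpow_mem ht j)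
  let N' := adjoin N t hN
  let Φ : MonoidAlgebra ℚ G →ₗ[ℚ] K.ResQuot N n := linExt (K.adjoinMap N t n r)
  have Φof : ∀ (a : N) (j : ℤ), Φ (MonoidAlgebra.of ℚ G (a * t ^ j)) =
      K.resOf N n a * (r ^ j : (K.ResQuot N n)ˣ) := by
    intro a j
    rw [← Units.val_mul]
    exact (linExt_of _ _).trans (adjoinMap_apply hr3 a j)
  have hrc : ∀ j k : ℤ, K.resConj n (t ^ j) (hN j) (r ^ k : (K.ResQuot N n)ˣ) =
      (r ^ k : (K.ResQuot N n)ˣ) := by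
    intro j k
    have : Units.map (K.resConj n (t ^ j) (hN j) : K.ResQuot N n →* K.ResQuot N n) r = r :=
      Units.ext (hr2 j)
    have h := congrArg (fun u : (K.ResQuot N n)ˣ => ((u ^ k : (K.ResQuot N n)ˣ) : K.ResQuot N n))
      this
    simp only [← map_zpow] at h
    exact h
  -- left multiplication by elements of `N ⟨t⟩`
  have Φmul : ∀ (a : N) (j : ℤ) {x : MonoidAlgebra ℚ G}, x ∈ grpSpan N' →
      Φ (MonoidAlgebra.of ℚ G (a * t ^ j) * x) =
        K.resOf N n a * K.resConj n (t ^ j) (hN j) (Φ x) * (r ^ j : (K.ResQuot N n)ˣ) := by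
    intro a j x hx
    induction hx using Submodule.span_induction with
    | mem x hx =>
      obtain ⟨_, ⟨b, hb, k, rfl⟩, rfl⟩ := hx
      have e : (a : G) * t ^ j * (b * t ^ k) =
          ((a * ⟨t ^ j * b * (t ^ j)⁻¹, hN j b hb⟩ : N) : G) * t ^ (j + k) := by
        rw [Subgroup.coe_mul, zpow_add]
        simp only
        group
      rw [← map_mul, e, Φof, Φof ⟨b, hb⟩, map_mul, map_mul, hrc, K.resConj_resOf, add_comm,
        zpow_add, Units.val_mul, Units.val_mul]
      simp only [mul_assoc]
    | zero => simp
    | add x y _ _ hx hy => rw [mul_add, map_add, hx, hy, map_add, map_add, mul_add, add_mul]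
    | smul q x _ hx =>
      rw [mul_smul_comm, map_smul, hx, map_smul, map_smul, mul_smul_comm, smul_mul_assoc]
  have Φmul_left : ∀ (a : N) {x : MonoidAlgebra ℚ G}, x ∈ grpSpan N' →
      Φ (MonoidAlgebra.of ℚ G a * x) = K.resOf N n a * Φ x := by
    intro a x hx
    induction hx using Submodule.span_induction with
    | mem x hx =>
      obtain ⟨_, ⟨b, hb, k, rfl⟩, rfl⟩ := hx
      have e : (a : G) * (b * t ^ k) = ((a * ⟨b, hb⟩ : N) : G) * t ^ k := by
        rw [Subgroup.coe_mul, mul_assoc]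
      rw [← map_mul, e, Φof, Φof ⟨b, hb⟩, map_mul, Units.val_mul, mul_assoc]
    | zero => simp
    | add x y _ _ hx hy => rw [mul_add, map_add, hx, hy, map_add, mul_add]
    | smul q x _ hx => rw [mul_smul_comm, map_smul, hx, map_smul, mul_smul_comm]
  have hconj : ∀ (j : ℤ) {s : ℕ} {x : K.ResQuot N n}, x ∈ K.resFil N n s →
      K.resConj n (t ^ j) (hN j) x - x ∈ K.resFil N n (w + s) := by
    rintro j s _ ⟨x, hx, rfl⟩
    have e : K.resConj n (t ^ j) (hN j) (K.resMk N n x) - K.resMk N n x = K.resMk N n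
        (MonoidAlgebra.mapDomainAlgHom ℚ ℚ (conjN (t ^ j) (hN j)) x - x) := by
      rw [map_sub, K.resConj_resMk]
    change K.resConj n (t ^ j) (hN j) (K.resMk N n x) - K.resMk N n x ∈ _
    rw [e]
    refine K.resMk_mem ?_
    rw [map_sub, incl_conjN]
    exact conj_sub_mem h1 h2 hw (zpow_mem ht j) hx
  -- left multiplication by `k - 1`, `k ∈ K_m`, raises the weight by `m`
  have hinc : ∀ {m s : ℕ} {k : G} {x : MonoidAlgebra ℚ G}, 0 < m → k ∈ K.sub m → k ∈ N' →
      x ∈ grpSpan N' → Φ x ∈ K.resFil N n s → Φ (inc k * x) ∈ K.resFil N n (m + s) := by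
    intro m s k x hm hk hkN hx hΦ
    rw [inc, sub_mul, one_mul, map_sub]
    by_cases hmw : w < m
    · have hkN' : k ∈ N := h1 (K.antitone hmw hk)
      have e : Φ (MonoidAlgebra.of ℚ G k * x) - Φ x = (K.resOf N n ⟨k, hkN'⟩ - 1) * Φ x := by
        rw [sub_mul, one_mul, ← Φmul_left ⟨k, hkN'⟩ hx]
      rw [e]
      exact K.resFil_mul (K.resOf_sub_one_mem hm hk) hΦ
    · refine K.resFil_antitone N n (show m + s ≤ w + s by omega) ?_
      obtain ⟨a, ha, j, rfl⟩ := hkN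
      have h3 := hconj j hΦ
      have h4 : K.resConj n (t ^ j) (hN j) (Φ x) ∈ K.resFil N n s := by
        have := add_mem (K.resFil_antitone N n (show s ≤ w + s by omega) h3) hΦ
        rwa [sub_add_cancel] at this
      have h5 : ((r ^ j : (K.ResQuot N n)ˣ) : K.ResQuot N n) - 1 ∈ K.resFil N n w :=
        mem_unipotentUnits.1 (zpow_mem hr1 j)
      have h6 : (K.resOf N n ⟨a, ha⟩ : K.ResQuot N n) - 1 ∈ K.resFil N n w :=
        K.resOf_sub_one_mem hw (h2 ha)
      have e : Φ (MonoidAlgebra.of ℚ G (a * t ^ j) * x) - Φ x =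
          (K.resOf N n ⟨a, ha⟩ - 1) * K.resConj n (t ^ j) (hN j) (Φ x) *
              (r ^ j : (K.ResQuot N n)ˣ) +
            (K.resConj n (t ^ j) (hN j) (Φ x) - Φ x) * (r ^ j : (K.ResQuot N n)ˣ) +
            Φ x * ((r ^ j : (K.ResQuot N n)ˣ) - 1) := by
        rw [Φmul ⟨a, ha⟩ j hx]
        noncomm_ring
      rw [e]
      refine add_mem (add_mem ?_ ?_) ?_
      · exact K.resFil_mul_right (K.resFil_mul h6 h4) _
      · exact K.resFil_mul_right h3 _
      · rw [add_comm w s]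
        exact K.resFil_mul hΦ h5
  have hprod : ∀ (l : List (Σ m : ℕ+, K.sub m)), (∀ p ∈ l, (p.2 : G) ∈ N') → ∀ g ∈ N',
      K.incProd l * MonoidAlgebra.of ℚ G g ∈ grpSpan N' ∧
        Φ (K.incProd l * MonoidAlgebra.of ℚ G g) ∈ K.resFil N n (K.wt l) := by
    intro l hl g hg
    induction l with
    | nil =>
      have e : K.incProd [] * MonoidAlgebra.of ℚ G g = MonoidAlgebra.of ℚ G g := one_mul _
      rw [e]
      exact ⟨of_mem_grpSpan hg, K.mem_resFil_zero _⟩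
    | cons p l ih =>
      obtain ⟨ih1, ih2⟩ := ih fun q hq => hl q (List.mem_cons_of_mem _ hq)
      have hp : (p.2 : G) ∈ N' := hl p List.mem_cons_self
      rw [incProd_cons, wt_cons, mul_assoc]
      exact ⟨inc_mul_mem_grpSpan hp ih1, hinc p.1.pos p.2.2 hp ih1 ih2⟩
  have hΦ : ∀ x ∈ K.prodSpan N' n, Φ x = 0 := by
    intro x hx
    have : K.prodSpan N' n ≤ LinearMap.ker Φ := by
      refine Submodule.span_le.2 ?_
      rintro _ ⟨l, hl, hn, g, hg, rfl⟩
      exact K.eq_zero_of_mem_resFil (K.resFil_antitone N n hn (hprod l hl g hg).2)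
    exact this hx
  have hincl : Φ ∘ₗ (incl N).toLinearMap = (K.resMk N n).toLinearMap := by
    refine MonoidAlgebra.linHom_ext fun a => ?_
    change Φ (incl N (MonoidAlgebra.of ℚ N a)) = _
    have := Φof a 0
    rw [zpow_zero, zpow_zero, mul_one, Units.val_one, mul_one] at this
    rw [incl_of, this]
    rfl
  rintro x ⟨hx1, hx2⟩
  obtain ⟨x, rfl⟩ := grpSpan_le_range N hx1
  refine K.resMk_eq_zero.1 ?_
  rw [← hΦ _ hx2]
  exact (LinearMap.congr_fun hincl x).symm

end ExtendedNSeries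

/-! ### Injectivity on the rational graded Lie algebra -/

namespace ExtendedNSeries

variable {G : Type*} [Group G] (K : ExtendedNSeries G)

theorem grpSpan_mono {N N' : Subgroup G} (h : N ≤ N') : grpSpan N ≤ grpSpan N' :=
  Submodule.span_mono (Set.image_mono h)

theorem exists_mem_prodSpan_of_chain {c : Set (Subgroup G)} (hc : IsChain (· ≤ ·) c)
    (hne : c.Nonempty) {n : ℕ} {x : MonoidAlgebra ℚ G} (hx : x ∈ K.prodSpan (sSup c) n) :
    ∃ N ∈ c, x ∈ K.prodSpan N n := by
  have hmem : ∀ {g : G}, g ∈ sSup c ↔ ∃ N ∈ c, g ∈ N :=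
    Subgroup.mem_sSup_of_directedOn hne hc.directedOn
  induction hx using Submodule.span_induction with
  | zero => exact ⟨hne.some, hne.some_mem, zero_mem _⟩
  | smul q x _ hx =>
    obtain ⟨N, hN, hx⟩ := hx
    exact ⟨N, hN, Submodule.smul_mem _ q hx⟩
  | add x y _ _ hx hy =>
    obtain ⟨N, hN, hx⟩ := hx
    obtain ⟨N', hN', hy⟩ := hy
    obtain ⟨M, hM, h, h'⟩ := hc.directedOn N hN N' hN'
    exact ⟨M, hM, add_mem (K.prodSpan_mono h n hx) (K.prodSpan_mono h' n hy)⟩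
  | mem x hx =>
    obtain ⟨l, hl, hn, g, hg, rfl⟩ := hx
    have key : ∃ N ∈ c, ∀ p ∈ l, (p.2 : G) ∈ N := by
      clear hn
      induction l with
      | nil => exact ⟨hne.some, hne.some_mem, by simp⟩
      | cons p l ih =>
        obtain ⟨N, hN, h⟩ := ih fun q hq => hl q (List.mem_cons_of_mem _ hq)
        obtain ⟨N', hN', h'⟩ := hmem.1 (hl p List.mem_cons_self)
        obtain ⟨M, hM, h1, h2⟩ := hc.directedOn N hN N' hN'
        refine ⟨M, hM, fun q hq => ?_⟩
        rcases List.mem_cons.1 hq with rfl | hq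
        · exact h2 h'
        · exact h1 (h q hq)
    obtain ⟨N, hN, h⟩ := key
    obtain ⟨N', hN', h'⟩ := hmem.1 hg
    obtain ⟨M, hM, h1, h2⟩ := hc.directedOn N hN N' hN'
    exact ⟨M, hM, K.incProd_mul_mem (fun q hq => h1 (h q hq)) hn (h2 h')⟩

/-- The filtration of `ℚ[K_w]` induces the filtration of `ℚ[K_{w+1}]`: pass from `K_{w+1}` to `K_w`
by adjoining one element at a time. -/
theorem grpSpan_inf_prodSpan_le {w : ℕ} (hw : 0 < w) (n : ℕ) :
    grpSpan (K.sub (w + 1)) ⊓ K.prodSpan (K.sub w) n ≤ K.prodSpan (K.sub (w + 1)) n := by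
  let S : Set (Subgroup G) := {N | K.sub (w + 1) ≤ N ∧ N ≤ K.sub w ∧
    grpSpan (K.sub (w + 1)) ⊓ K.prodSpan N n ≤ K.prodSpan (K.sub (w + 1)) n}
  obtain ⟨N, -, hN⟩ := zorn_le_nonempty₀ S
    (by
      intro c hcS hc y hy
      refine ⟨sSup c, ⟨?_, ?_, ?_⟩, fun z hz => le_sSup hz⟩
      · exact (hcS hy).1.trans (le_sSup hy)
      · exact sSup_le fun z hz => (hcS hz).2.1
      · rintro x ⟨hx, hx'⟩
        obtain ⟨M, hM, h⟩ := K.exists_mem_prodSpan_of_chain hc ⟨y, hy⟩ hx'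
        exact (hcS hM).2.2 ⟨hx, h⟩)
    (K.sub (w + 1)) ⟨le_rfl, K.antitone (Nat.le_succ w), inf_le_right⟩
  obtain ⟨h1, h2, h3⟩ := hN.prop
  have h4 : K.sub w ≤ N := by
    intro t ht
    have hconj : ∀ j : ℤ, ∀ a ∈ N, t ^ j * a * (t ^ j)⁻¹ ∈ N := fun j =>
      normalizes h1 h2 hw (zpow_mem ht j)
    have hle : N ≤ adjoin N t hconj := fun a ha => ⟨a, ha, 0, by simp⟩
    have hmem : adjoin N t hconj ∈ S := by
      refine ⟨h1.trans hle, ?_, ?_⟩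
      · rintro _ ⟨a, ha, j, rfl⟩
        exact mul_mem (h2 ha) (zpow_mem ht j)
      · rintro x ⟨hx, hx'⟩
        exact h3 ⟨hx, grpSpan_inf_prodSpan_adjoin_le h1 h2 hw ht n ⟨grpSpan_mono h1 hx, hx'⟩⟩
    exact hN.le_of_ge hmem hle ⟨1, N.one_mem, 1, by simp⟩
  rw [le_antisymm h2 h4] at h3
  exact h3

/-- `J_n ∩ ℚ[K_m]` is the `n`-th term of the filtration of `ℚ[K_m]`, for `m ≥ 1`. -/
theorem mem_prodSpan_sub {m : ℕ} (hm : 0 < m) {n : ℕ} {x : MonoidAlgebra ℚ G} (hx : x ∈ K.fil.J n)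
    (hx' : x ∈ grpSpan (K.sub m)) : x ∈ K.prodSpan (K.sub m) n := by
  induction m, hm using Nat.le_induction with
  | base => exact K.mem_prodSpan_one hx hx'
  | succ m hm ih =>
    exact K.grpSpan_inf_prodSpan_le hm n
      ⟨hx', ih (grpSpan_mono (K.antitone (Nat.le_succ m)) hx')⟩

theorem clsQ_mul (m : ℕ+) (x y : K.sub m) : K.clsQ m (x * y) = K.clsQ m x + K.clsQ m y := by
  unfold clsQ
  rw [cls_mul, TensorProduct.tmul_add]

theorem clsQ_eq_zero {m : ℕ+} {x : K.sub m} (hx : (x : G) ∈ K.sub (m + 1)) : K.clsQ m x = 0 := by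
  unfold clsQ
  rw [K.cls_eq (n := m) rfl (y := 1), cls_one, TensorProduct.tmul_zero]
  exact (QuotientGroup.eq_one_iff _).2 hx

open Classical in
/-- The linear map on `ℚ[K₀]` given on `K_m` by the projection to `(K_m / K_{m+1}) ⊗ ℚ`, and by
zero outside of `K_m`. -/
def clsLin (m : ℕ+) : MonoidAlgebra ℚ G →ₗ[ℚ] K.GrLieQ :=
  linExt fun g => if h : g ∈ K.sub m then K.clsQ m ⟨g, h⟩ else 0

theorem clsLin_of (m : ℕ+) (g : K.sub m) :
    K.clsLin m (MonoidAlgebra.of ℚ G g) = K.clsQ m g :=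
  (linExt_of _ _).trans (dif_pos g.2)

theorem clsLin_inc_mul (m : ℕ+) (k : K.sub m) {x : MonoidAlgebra ℚ G}
    (hx : x ∈ grpSpan (K.sub m)) :
    K.clsLin m (inc (k : G) * x) = Coalgebra.counit (R := ℚ) x • K.clsQ m k := by
  induction hx using Submodule.span_induction with
  | zero => rw [mul_zero, map_zero, map_zero, zero_smul]
  | add x y _ _ hx hy => rw [mul_add, map_add, hx, hy, map_add, add_smul]
  | smul q x _ hx => rw [mul_smul_comm, map_smul, hx, map_smul, smul_eq_mul, mul_smul]
  | mem x hx =>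
    obtain ⟨g, hg, rfl⟩ := hx
    have h1 : Coalgebra.counit (R := ℚ) (MonoidAlgebra.of ℚ G g) = 1 := by simp
    rw [h1, one_smul, inc, sub_mul, one_mul, ← map_mul, map_sub]
    have h2 := K.clsLin_of m (k * ⟨g, hg⟩)
    have h3 := K.clsLin_of m ⟨g, hg⟩
    rw [Subgroup.coe_mul] at h2
    rw [h2, h3, clsQ_mul, add_sub_cancel_right]

theorem counit_inc_mul (k : G) (x : MonoidAlgebra ℚ G) :
    Coalgebra.counit (R := ℚ) (inc k * x) = 0 := by
  rw [Bialgebra.counit_mul]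
  simp [inc]

theorem incProd_mul_of_mem_grpSpan {N : Subgroup G} {l : List (Σ m : ℕ+, K.sub m)}
    (hl : ∀ p ∈ l, (p.2 : G) ∈ N) {g : G} (hg : g ∈ N) :
    K.incProd l * MonoidAlgebra.of ℚ G g ∈ grpSpan N := by
  induction l with
  | nil =>
    have e : K.incProd [] * MonoidAlgebra.of ℚ G g = MonoidAlgebra.of ℚ G g := one_mul _
    rw [e]
    exact of_mem_grpSpan hg
  | cons p l ih =>
    rw [incProd_cons, mul_assoc]
    exact inc_mul_mem_grpSpan (hl p List.mem_cons_self)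
      (ih fun q hq => hl q (List.mem_cons_of_mem _ hq))

/-- The projection `K_m → (K_m / K_{m+1}) ⊗ ℚ` extends to a linear map on `ℚ[K_m]` which vanishes
on `J_{m+1}`. -/
theorem clsLin_eq_zero {m : ℕ+} {x : MonoidAlgebra ℚ G} (hx : x ∈ K.fil.J (m + 1))
    (hx' : x ∈ grpSpan (K.sub m)) : K.clsLin m x = 0 := by
  have h : K.prodSpan (K.sub m) (m + 1) ≤ LinearMap.ker (K.clsLin m) := by
    refine Submodule.span_le.2 ?_
    rintro _ ⟨l, hl, hn, g, hg, rfl⟩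
    rw [SetLike.mem_coe, LinearMap.mem_ker]
    match l, hl, hn with
    | [], _, hn => exact absurd hn (Nat.not_succ_le_zero _)
    | p :: l, hl, hn =>
      have hl' : ∀ q ∈ l, (q.2 : G) ∈ K.sub m := fun q hq => hl q (List.mem_cons_of_mem _ hq)
      have hp : (p.2 : G) ∈ K.sub m := hl p List.mem_cons_self
      rw [incProd_cons, mul_assoc]
      rw [K.clsLin_inc_mul m ⟨p.2, hp⟩ (K.incProd_mul_of_mem_grpSpan hl' hg)]
      match l, hn with
      | [], hn =>
        rw [clsQ_eq_zero, smul_zero]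
        refine K.antitone ?_ p.2.2
        simpa [wt] using hn
      | q :: l, _ => rw [incProd_cons, mul_assoc, counit_inc_mul, zero_smul]
  exact h (K.mem_prodSpan_sub m.pos hx hx')

open Classical in
/-- The projection of `gr₊^ℚ(K)` to its degree `m` part. -/
def lieProj (m : ℕ+) : K.GrLieQ →ₗ[ℚ] K.GrLieQ :=
  LinearMap.baseChange ℚ
    (K.grLieLift fun n => if n = m then K.grOf n else 0).toIntLinearMap

open Classical in
theorem lieProj_clsQ (m n : ℕ+) (k : K.sub n) :
    K.lieProj m (K.clsQ n k) = if n = m then K.clsQ n k else 0 := by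
  unfold lieProj clsQ
  rw [LinearMap.baseChange_tmul, AddMonoidHom.coe_toIntLinearMap, grLieLift_cls]
  split_ifs
  · rfl
  · exact TensorProduct.tmul_zero _ _

theorem exists_sum_lieProj (v : K.GrLieQ) : ∃ s : Finset ℕ+, ∀ t, s ⊆ t →
    ∑ m ∈ t, K.lieProj m v = v := by
  classical
  induction v using K.clsQ_induction with
  | zero => exact ⟨∅, fun t _ => by simp⟩
  | add x y hx hy =>
    obtain ⟨s, hs⟩ := hx
    obtain ⟨s', hs'⟩ := hy
    refine ⟨s ∪ s', fun t ht => ?_⟩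
    simp only [map_add]
    rw [Finset.sum_add_distrib, hs t (Finset.union_subset_left ht),
      hs' t (Finset.union_subset_right ht)]
  | smul q x hx =>
    obtain ⟨s, hs⟩ := hx
    refine ⟨s, fun t ht => ?_⟩
    simp only [map_smul]
    rw [← Finset.smul_sum, hs t ht]
  | cls m k =>
    refine ⟨{m}, fun t ht => ?_⟩
    simp only [lieProj_clsQ]
    rw [Finset.sum_ite_eq t m, if_pos (ht (Finset.mem_singleton_self m))]

/-- The degree `m` component of the image of `v` is represented by an element of `ℚ[K_m]`, from
which `clsLin` recovers the degree `m` part of `v`. -/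
theorem exists_grComp_symbLin (m : ℕ+) (v : K.GrLieQ) : ∃ (x : MonoidAlgebra ℚ G)
    (hx : x ∈ K.fil.J m), x ∈ grpSpan (K.sub m) ∧
      K.fil.grComp m (K.symbLin v) = K.fil.grMk m ⟨x, hx⟩ ∧ K.clsLin m x = K.lieProj m v := by
  classical
  induction v using K.clsQ_induction with
  | zero =>
    refine ⟨0, zero_mem _, zero_mem _, ?_, by rw [map_zero, map_zero]⟩
    rw [map_zero, map_zero]
    exact (map_zero (K.fil.grMk m)).symm
  | add v w hv hw =>
    obtain ⟨x, hx, hx1, hx2, hx3⟩ := hv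
    obtain ⟨y, hy, hy1, hy2, hy3⟩ := hw
    refine ⟨x + y, add_mem hx hy, add_mem hx1 hy1, ?_, by rw [map_add, map_add, hx3, hy3]⟩
    rw [map_add, map_add, hx2, hy2, ← map_add]
    rfl
  | smul q v hv =>
    obtain ⟨x, hx, hx1, hx2, hx3⟩ := hv
    refine ⟨q • x, Submodule.smul_mem _ q hx, Submodule.smul_mem _ q hx1, ?_,
      by rw [map_smul, map_smul, hx3]⟩
    rw [map_smul, map_smul, hx2, ← map_smul]
    rfl
  | cls n k =>
    by_cases h : n = m
    · subst h
      refine ⟨inc (k : G), K.inc_mem_J k.2, sub_mem (of_mem_grpSpan k.2) ?_, ?_, ?_⟩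
      · rw [← map_one (MonoidAlgebra.of ℚ G)]
        exact of_mem_grpSpan (one_mem _)
      · rw [symbLin_clsQ, K.fil.grComp_mono_self]
      · have h1 : K.clsLin n 1 = 0 := by
          have := K.clsLin_of n 1
          rw [Subgroup.coe_one, map_one, K.clsQ_eq_zero (one_mem _)] at this
          exact this
        rw [lieProj_clsQ, if_pos rfl, inc, map_sub, clsLin_of, h1, _root_.sub_zero]
    · refine ⟨0, zero_mem _, zero_mem _, ?_, ?_⟩
      · rw [symbLin_clsQ, K.fil.grComp_mono_of_ne fun e => h (PNat.coe_injective e.symm)]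
        exact (map_zero (K.fil.grMk m)).symm
      · rw [lieProj_clsQ, if_neg h, map_zero]

/-- The map `gr₊^ℚ(K) → ∏ J_m / J_{m+1}` is injective. -/
theorem eq_zero_of_symbLin_eq_zero {v : K.GrLieQ}
    (h : ∀ m : ℕ+, K.fil.grComp m (K.symbLin v) = 0) : v = 0 := by
  obtain ⟨s, hs⟩ := K.exists_sum_lieProj v
  rw [← hs s subset_rfl]
  refine Finset.sum_eq_zero fun m _ => ?_
  obtain ⟨x, hx, hx1, hx2, hx3⟩ := K.exists_grComp_symbLin m v
  rw [← hx3]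
  rw [h m] at hx2
  exact K.clsLin_eq_zero (K.fil.grMk_eq_zero.1 hx2.symm) hx1

end ExtendedNSeries

/-! ### Jointly injective families and tensor products -/

namespace TensorProduct

variable {M N : Type*} [AddCommGroup M] [Module ℚ M] [AddCommGroup N] [Module ℚ N]
  {I : Type*} {X : I → Type*} [∀ i, AddCommGroup (X i)] [∀ i, Module ℚ (X i)]

theorem eq_zero_of_forall_rTensor {p : ∀ i, M →ₗ[ℚ] X i} (hp : ∀ x, (∀ i, p i x = 0) → x = 0)
    {z : M ⊗[ℚ] N} (hz : ∀ i, (p i).rTensor N z = 0) : z = 0 := by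
  classical
  let b := Module.Basis.ofVectorSpace ℚ N
  have nat : ∀ i k (z : M ⊗[ℚ] N), equivFinsuppOfBasisRight b ((p i).rTensor N z) k =
      p i (equivFinsuppOfBasisRight b z k) := by
    intro i k z
    induction z using TensorProduct.induction_on with
    | zero => simp
    | add x y hx hy => simp only [map_add, Finsupp.add_apply, hx, hy]
    | tmul x y =>
      rw [LinearMap.rTensor_tmul, equivFinsuppOfBasisRight_apply_tmul_apply,
        equivFinsuppOfBasisRight_apply_tmul_apply, map_smul]
  apply (equivFinsuppOfBasisRight b).injective
  rw [map_zero]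
  ext k
  refine hp _ fun i => ?_
  rw [← nat, hz, map_zero]
  rfl

/-- If a family of linear maps `p_i` on `M` is jointly injective, then so is the family of the
linear maps `p_i ⊗ p_j` on `M ⊗ M`. -/
theorem eq_zero_of_forall_map {p : ∀ i, M →ₗ[ℚ] X i} (hp : ∀ x, (∀ i, p i x = 0) → x = 0)
    {z : M ⊗[ℚ] M} (hz : ∀ i j, TensorProduct.map (p i) (p j) z = 0) : z = 0 := by
  have h1 : ∀ j, (p j).lTensor M z = 0 := by
    intro j
    refine eq_zero_of_forall_rTensor hp fun i => ?_
    rw [← LinearMap.comp_apply, LinearMap.rTensor_comp_lTensor]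
    exact hz i j
  have h2 : TensorProduct.comm ℚ M M z = 0 := by
    refine eq_zero_of_forall_rTensor hp fun j => ?_
    have nat : ∀ z, (p j).rTensor M (TensorProduct.comm ℚ M M z) =
        TensorProduct.comm ℚ M (X j) ((p j).lTensor M z) := by
      intro z
      induction z using TensorProduct.induction_on with
      | zero => simp
      | add x y hx hy => simp only [map_add, hx, hy]
      | tmul x y => simp
    rw [nat, h1, map_zero]
  exact (TensorProduct.comm ℚ M M).injective (h2.trans (map_zero _).symm)

/-- Joint injectivity on a subspace `S` passes to the subspace `S ⊗ S`. -/
theorem eq_zero_of_mem_tensorSub {A : Type*} [Ring A] [Algebra ℚ A] {p : ∀ i, A →ₗ[ℚ] X i}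
    {S : Submodule ℚ A} (hp : ∀ x ∈ S, (∀ i, p i x = 0) → x = 0) {z : A ⊗[ℚ] A}
    (hzS : z ∈ tensorSub S S) (hz : ∀ i j, TensorProduct.map (p i) (p j) z = 0) : z = 0 := by
  have h1 : tensorSub S S ≤ LinearMap.range (TensorProduct.map S.subtype S.subtype) :=
    Submodule.map₂_le.2 fun a ha b hb => ⟨⟨a, ha⟩ ⊗ₜ ⟨b, hb⟩, rfl⟩
  obtain ⟨z, rfl⟩ := h1 hzS
  rw [eq_zero_of_forall_map (p := fun i => p i ∘ₗ S.subtype) (z := z), map_zero]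
  · intro x hx
    exact Subtype.ext (hp x x.2 hx)
  · intro i j
    rw [TensorProduct.map_comp, LinearMap.comp_apply]
    exact hz i j

end TensorProduct

/-! ### Primitive elements of enveloping algebras -/

namespace UniversalEnvelopingAlgebra

attribute [local instance 100] LieRing.ofAssociativeRing

variable {L : Type*} [LieRing L] [LieAlgebra ℚ L]

variable (L) in
/-- The span of the products of at most `n` elements of `L`. -/
def ιPow (n : ℕ) : Submodule ℚ (UniversalEnvelopingAlgebra ℚ L) :=
  (1 ⊔ LinearMap.range (ι ℚ : L →ₗ⁅ℚ⁆ UniversalEnvelopingAlgebra ℚ L).toLinearMap) ^ n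

theorem ιPow_mono : Monotone (ιPow L) := by
  refine monotone_nat_of_le_succ fun n => ?_
  unfold ιPow
  rw [pow_succ]
  nth_rewrite 1 [← mul_one (_ ^ n)]
  exact mul_le_mul_right le_sup_left _

theorem ιPow_mul_mem {m n : ℕ} {u v : UniversalEnvelopingAlgebra ℚ L} (hu : u ∈ ιPow L m)
    (hv : v ∈ ιPow L n) : u * v ∈ ιPow L (m + n) := by
  unfold ιPow
  rw [pow_add]
  exact Submodule.mul_mem_mul hu hv

theorem one_mem_ιPow (n : ℕ) : 1 ∈ ιPow L n := by
  refine ιPow_mono (Nat.zero_le n) ?_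
  unfold ιPow
  rw [pow_zero]
  exact Submodule.one_le.1 le_rfl

theorem ι_mem_ιPow (x : L) : ι ℚ x ∈ ιPow L 1 := by
  unfold ιPow
  rw [pow_one]
  exact Submodule.mem_sup_right ⟨x, rfl⟩

theorem ι_mul_mem_ιPow (x : L) {n : ℕ} {u : UniversalEnvelopingAlgebra ℚ L} (hu : u ∈ ιPow L n) :
    ι ℚ x * u ∈ ιPow L (n + 1) := by
  rw [add_comm]
  exact ιPow_mul_mem (ι_mem_ιPow x) hu

theorem mem_ιPow_zero {u : UniversalEnvelopingAlgebra ℚ L} (hu : u ∈ ιPow L 0) :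
    ∃ q : ℚ, u = q • 1 := by
  unfold ιPow at hu
  rw [pow_zero, Submodule.mem_one] at hu
  obtain ⟨q, rfl⟩ := hu
  exact ⟨q, Algebra.algebraMap_eq_smul_one q⟩

theorem ιPow_succ_le {n : ℕ} {T : Submodule ℚ (UniversalEnvelopingAlgebra ℚ L)}
    (h1 : ιPow L n ≤ T) (h2 : ∀ x, ∀ u ∈ ιPow L n, ι ℚ x * u ∈ T) : ιPow L (n + 1) ≤ T := by
  unfold ιPow
  rw [pow_succ']
  refine Submodule.mul_le.2 fun a ha u hu => ?_
  obtain ⟨b, hb, c, ⟨x, rfl⟩, rfl⟩ := Submodule.mem_sup.1 ha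
  obtain ⟨q, rfl⟩ := Submodule.mem_one.1 hb
  rw [add_mul]
  refine add_mem ?_ (h2 x u hu)
  rw [← Algebra.smul_def]
  exact Submodule.smul_mem _ q (h1 hu)

theorem exists_mem_ιPow (u : UniversalEnvelopingAlgebra ℚ L) : ∃ n, u ∈ ιPow L n := by
  induction u using ι_mul_induction with
  | one => exact ⟨0, one_mem_ιPow 0⟩
  | ι_mul x u hu =>
    obtain ⟨n, hn⟩ := hu
    exact ⟨n + 1, ι_mul_mem_ιPow x hn⟩
  | add u v hu hv =>
    obtain ⟨m, hm⟩ := hu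
    obtain ⟨n, hn⟩ := hv
    exact ⟨max m n, add_mem (ιPow_mono (le_max_left m n) hm) (ιPow_mono (le_max_right m n) hn)⟩
  | smul q u hu =>
    obtain ⟨n, hn⟩ := hu
    exact ⟨n, Submodule.smul_mem _ q hn⟩

theorem commutator_mem_ιPow (x : L) {n : ℕ} {u : UniversalEnvelopingAlgebra ℚ L}
    (hu : u ∈ ιPow L n) : ι ℚ x * u - u * ι ℚ x ∈ ιPow L n := by
  let D : UniversalEnvelopingAlgebra ℚ L →ₗ[ℚ] UniversalEnvelopingAlgebra ℚ L :=
    LinearMap.mulLeft ℚ (ι ℚ x) - LinearMap.mulRight ℚ (ι ℚ x)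
  suffices h : ιPow L n ≤ (ιPow L n).comap D from h hu
  clear hu u
  induction n with
  | zero =>
    intro u hu
    obtain ⟨q, rfl⟩ := mem_ιPow_zero hu
    change ι ℚ x * (q • 1) - (q • 1) * ι ℚ x ∈ ιPow L 0
    rw [mul_smul_comm, smul_mul_assoc, mul_one, one_mul, sub_self]
    exact zero_mem _
  | succ n ih =>
    refine ιPow_succ_le (ih.trans (Submodule.comap_mono (ιPow_mono (Nat.le_succ n)))) ?_
    intro y u hu
    change ι ℚ x * (ι ℚ y * u) - ι ℚ y * u * ι ℚ x ∈ ιPow L (n + 1)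
    have e : ι ℚ x * (ι ℚ y * u) - ι ℚ y * u * ι ℚ x =
        ι ℚ ⁅x, y⁆ * u + ι ℚ y * (ι ℚ x * u - u * ι ℚ x) := by
      rw [LieHom.map_lie, LieRing.of_associative_ring_bracket]
      noncomm_ring
    rw [e]
    exact add_mem (ι_mul_mem_ιPow _ hu) (ι_mul_mem_ιPow _ (ih hu))

variable (L) in
/-- The span of the tensors `u ⊗ v`, where `u` and `v` are products of at most `i` and `j` elements
of `L`, with `i + j = n`. -/
def ιPow₂ (n : ℕ) : Submodule ℚ (UniversalEnvelopingAlgebra ℚ L ⊗[ℚ] UniversalEnvelopingAlgebra ℚ L) :=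
  Submodule.span ℚ {z | ∃ i j, i + j = n ∧ ∃ u ∈ ιPow L i, ∃ v ∈ ιPow L j, z = u ⊗ₜ v}

theorem tmul_mem_ιPow₂ {i j n : ℕ} (h : i + j = n) {u v : UniversalEnvelopingAlgebra ℚ L}
    (hu : u ∈ ιPow L i) (hv : v ∈ ιPow L j) : u ⊗ₜ v ∈ ιPow₂ L n :=
  Submodule.subset_span ⟨i, j, h, u, hu, v, hv, rfl⟩

/-- The multiplication `U ⊗ U → U`. -/
local notation "μ" => LinearMap.mul' ℚ (UniversalEnvelopingAlgebra ℚ L)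

theorem ιPow₂_le {n : ℕ}
    {T : Submodule ℚ (UniversalEnvelopingAlgebra ℚ L ⊗[ℚ] UniversalEnvelopingAlgebra ℚ L)}
    (h : ∀ i j, i + j = n → ∀ u ∈ ιPow L i, ∀ v ∈ ιPow L j, u ⊗ₜ v ∈ T) : ιPow₂ L n ≤ T := by
  refine Submodule.span_le.2 ?_
  rintro _ ⟨i, j, hij, u, hu, v, hv, rfl⟩
  exact h i j hij u hu v hv

theorem ιPow₂_mono : Monotone (ιPow₂ L) :=
  monotone_nat_of_le_succ fun n => ιPow₂_le fun i j h _ hu _ hv =>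
    tmul_mem_ιPow₂ (i := i) (j := j + 1) (by omega) hu (ιPow_mono (Nat.le_succ j) hv)

section Comul

variable {Δ : UniversalEnvelopingAlgebra ℚ L →ₐ[ℚ]
    UniversalEnvelopingAlgebra ℚ L ⊗[ℚ] UniversalEnvelopingAlgebra ℚ L}

theorem comul_mem_ιPow₂ (hΔ : ∀ x, Δ (ι ℚ x) = ι ℚ x ⊗ₜ 1 + 1 ⊗ₜ ι ℚ x) {n : ℕ}
    {u : UniversalEnvelopingAlgebra ℚ L} (hu : u ∈ ιPow L n) : Δ u ∈ ιPow₂ L n := by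
  suffices h : ιPow L n ≤ (ιPow₂ L n).comap Δ.toLinearMap from h hu
  clear hu u
  induction n with
  | zero =>
    intro u hu
    obtain ⟨q, rfl⟩ := mem_ιPow_zero hu
    change Δ (q • 1) ∈ ιPow₂ L 0
    rw [map_smul, map_one]
    exact Submodule.smul_mem _ q (tmul_mem_ιPow₂ (add_zero 0) (one_mem_ιPow 0) (one_mem_ιPow 0))
  | succ n ih =>
    refine ιPow_succ_le (ih.trans (Submodule.comap_mono (ιPow₂_mono (Nat.le_succ n)))) ?_
    intro x u hu
    change Δ (ι ℚ x * u) ∈ ιPow₂ L (n + 1)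
    rw [map_mul, hΔ]
    have h : ιPow₂ L n ≤ (ιPow₂ L (n + 1)).comap
        (LinearMap.mulLeft ℚ (ι ℚ x ⊗ₜ[ℚ] 1 + 1 ⊗ₜ[ℚ] ι ℚ x)) := by
      refine ιPow₂_le fun i j h u hu v hv => ?_
      change (ι ℚ x ⊗ₜ 1 + 1 ⊗ₜ ι ℚ x) * (u ⊗ₜ v) ∈ ιPow₂ L (n + 1)
      rw [add_mul, Algebra.TensorProduct.tmul_mul_tmul, Algebra.TensorProduct.tmul_mul_tmul,
        one_mul, one_mul]
      exact add_mem
        (tmul_mem_ιPow₂ (i := i + 1) (j := j) (by omega) (ι_mul_mem_ιPow x hu) hv)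
        (tmul_mem_ιPow₂ (i := i) (j := j + 1) (by omega) hu (ι_mul_mem_ιPow x hv))
    exact h (ih hu)

/-- The square of the identity for the convolution product multiplies products of `n` elements of
`L` by `2 ^ n`, up to shorter products. -/
theorem mul_comul_sub_mem (hΔ : ∀ x, Δ (ι ℚ x) = ι ℚ x ⊗ₜ 1 + 1 ⊗ₜ ι ℚ x) {n : ℕ}
    {u : UniversalEnvelopingAlgebra ℚ L} (hu : u ∈ ιPow L (n + 1)) :
    μ (Δ u) - (2 : ℚ) ^ (n + 1) • u ∈ ιPow L n := by
  -- moving a factor `x` in front of `z` costs a commutator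
  have hcomm : ∀ (x : L) {n : ℕ} {z}, z ∈ ιPow₂ L n →
      μ ((1 ⊗ₜ ι ℚ x) * z) - ι ℚ x * μ z ∈ ιPow L n := by
    intro x n z hz
    have h : ιPow₂ L n ≤ (ιPow L n).comap
        (μ ∘ₗ LinearMap.mulLeft ℚ (1 ⊗ₜ[ℚ] ι ℚ x) - LinearMap.mulLeft ℚ (ι ℚ x) ∘ₗ μ) := by
      refine ιPow₂_le fun i j h u hu v hv => ?_
      change μ ((1 ⊗ₜ ι ℚ x) * (u ⊗ₜ v)) - ι ℚ x * μ (u ⊗ₜ v) ∈ ιPow L n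
      have e : μ ((1 ⊗ₜ ι ℚ x) * (u ⊗ₜ v)) - ι ℚ x * μ (u ⊗ₜ v) =
          -((ι ℚ x * u - u * ι ℚ x) * v) := by
        rw [Algebra.TensorProduct.tmul_mul_tmul, LinearMap.mul'_apply, LinearMap.mul'_apply]
        noncomm_ring
      rw [e, ← h]
      exact neg_mem (ιPow_mul_mem (commutator_mem_ιPow x hu) hv)
    exact h hz
  have hleft : ∀ (x : L) z, μ ((ι ℚ x ⊗ₜ 1) * z) = ι ℚ x * μ z := by
    intro x z
    induction z using TensorProduct.induction_on with
    | zero => rw [mul_zero, map_zero, mul_zero]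
    | add y z hy hz => rw [mul_add, map_add, hy, hz, map_add, mul_add]
    | tmul u v =>
      rw [Algebra.TensorProduct.tmul_mul_tmul, LinearMap.mul'_apply, LinearMap.mul'_apply,
        one_mul, mul_assoc]
  have hmul : ∀ (x : L) {n : ℕ} {u}, u ∈ ιPow L n →
      μ (Δ (ι ℚ x * u)) - (2 : ℚ) • (ι ℚ x * μ (Δ u)) ∈ ιPow L n := by
    intro x n u hu
    have e : μ (Δ (ι ℚ x * u)) - (2 : ℚ) • (ι ℚ x * μ (Δ u)) =
        μ ((1 ⊗ₜ ι ℚ x) * Δ u) - ι ℚ x * μ (Δ u) := by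
      rw [map_mul, hΔ, add_mul, map_add, hleft, two_smul]
      abel
    rw [e]
    exact hcomm x (comul_mem_ιPow₂ hΔ hu)
  suffices h : ∀ n : ℕ, ιPow L (n + 1) ≤
      (ιPow L n).comap (μ ∘ₗ Δ.toLinearMap - (2 : ℚ) ^ (n + 1) • LinearMap.id) from h n hu
  clear hu u n
  intro n
  induction n with
  | zero =>
    refine ιPow_succ_le ?_ ?_
    · intro u hu
      obtain ⟨q, rfl⟩ := mem_ιPow_zero hu
      change μ (Δ (q • 1)) - (2 : ℚ) ^ (0 + 1) • (q • 1) ∈ ιPow L 0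
      rw [map_smul, map_one, map_smul, Algebra.TensorProduct.one_def, LinearMap.mul'_apply, mul_one]
      exact sub_mem hu (Submodule.smul_mem _ _ hu)
    · intro x u hu
      obtain ⟨q, rfl⟩ := mem_ιPow_zero hu
      have h := hmul x hu
      rw [map_smul Δ, map_one, map_smul, Algebra.TensorProduct.one_def, LinearMap.mul'_apply,
        mul_one] at h
      change μ (Δ (ι ℚ x * (q • 1))) - (2 : ℚ) ^ (0 + 1) • (ι ℚ x * (q • 1)) ∈ ιPow L 0
      rw [zero_add, pow_one]
      exact h
  | succ n ih =>
    refine ιPow_succ_le ?_ ?_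
    · intro u hu
      change μ (Δ u) - (2 : ℚ) ^ (n + 1 + 1) • u ∈ ιPow L (n + 1)
      have h : μ (Δ u) - (2 : ℚ) ^ (n + 1) • u ∈ ιPow L n := ih hu
      have h' := add_mem (ιPow_mono (Nat.le_succ n) h)
        (Submodule.smul_mem _ ((2 : ℚ) ^ (n + 1)) hu)
      rw [sub_add_cancel] at h'
      exact sub_mem h' (Submodule.smul_mem _ _ hu)
    · intro x u hu
      change μ (Δ (ι ℚ x * u)) - (2 : ℚ) ^ (n + 1 + 1) • (ι ℚ x * u) ∈ ιPow L (n + 1)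
      have h : μ (Δ u) - (2 : ℚ) ^ (n + 1) • u ∈ ιPow L n := ih hu
      have e : μ (Δ (ι ℚ x * u)) - (2 : ℚ) ^ (n + 1 + 1) • (ι ℚ x * u) =
          (μ (Δ (ι ℚ x * u)) - (2 : ℚ) • (ι ℚ x * μ (Δ u))) +
            (2 : ℚ) • (ι ℚ x * (μ (Δ u) - (2 : ℚ) ^ (n + 1) • u)) := by
        rw [mul_sub, smul_sub, mul_smul_comm, smul_smul, ← pow_succ', sub_add_sub_cancel]
      rw [e]
      exact add_mem (hmul x hu) (Submodule.smul_mem _ _ (ι_mul_mem_ιPow x h))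

/-- The reduced comultiplication lowers the length of products of elements of `L`. -/
theorem comul_sub_mem_tensorSub (hΔ : ∀ x, Δ (ι ℚ x) = ι ℚ x ⊗ₜ 1 + 1 ⊗ₜ ι ℚ x) {n : ℕ}
    {u : UniversalEnvelopingAlgebra ℚ L} (hu : u ∈ ιPow L (n + 1)) :
    Δ u - (u ⊗ₜ 1 + 1 ⊗ₜ u) ∈ tensorSub (ιPow L n) (ιPow L n) := by
  have tmul : ∀ {n : ℕ} {u v}, u ∈ ιPow L n → v ∈ ιPow L n →
      u ⊗ₜ v ∈ tensorSub (ιPow L n) (ιPow L n) := fun hu hv => Submodule.apply_mem_map₂ _ hu hv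
  have mono : ∀ {n : ℕ}, tensorSub (ιPow L n) (ιPow L n) ≤
      tensorSub (ιPow L (n + 1)) (ιPow L (n + 1)) := fun {n} =>
    Submodule.map₂_le_map₂ (ιPow_mono (Nat.le_succ n)) (ιPow_mono (Nat.le_succ n))
  suffices h : ∀ n : ℕ, ιPow L (n + 1) ≤ (tensorSub (ιPow L n) (ιPow L n)).comap (Δ.toLinearMap -
      ((TensorProduct.mk ℚ _ _).flip 1 + TensorProduct.mk ℚ _ _ 1)) from h n hu
  clear hu u n
  intro n
  induction n with
  | zero =>
    refine ιPow_succ_le ?_ ?_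
    · intro u hu
      obtain ⟨q, rfl⟩ := mem_ιPow_zero hu
      change Δ (q • 1) - ((q • 1) ⊗ₜ 1 + 1 ⊗ₜ (q • 1)) ∈ tensorSub (ιPow L 0) (ιPow L 0)
      rw [map_smul, map_one]
      exact sub_mem (Submodule.smul_mem _ q (tmul (one_mem_ιPow 0) (one_mem_ιPow 0)))
        (add_mem (tmul hu (one_mem_ιPow 0)) (tmul (one_mem_ιPow 0) hu))
    · intro x u hu
      obtain ⟨q, rfl⟩ := mem_ιPow_zero hu
      change Δ (ι ℚ x * (q • 1)) - ((ι ℚ x * (q • 1)) ⊗ₜ 1 + 1 ⊗ₜ (ι ℚ x * (q • 1))) ∈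
        tensorSub (ιPow L 0) (ιPow L 0)
      rw [mul_smul_comm, mul_one, map_smul, hΔ, TensorProduct.tmul_smul, smul_add,
        ← TensorProduct.smul_tmul', sub_self]
      exact zero_mem _
  | succ n ih =>
    refine ιPow_succ_le ?_ ?_
    · exact ih.trans (Submodule.comap_mono mono)
    · intro x u hu
      change Δ (ι ℚ x * u) - ((ι ℚ x * u) ⊗ₜ 1 + 1 ⊗ₜ (ι ℚ x * u)) ∈
        tensorSub (ιPow L (n + 1)) (ιPow L (n + 1))
      have h : Δ u - (u ⊗ₜ 1 + 1 ⊗ₜ u) ∈ tensorSub (ιPow L n) (ιPow L n) := ih hu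
      have e : Δ (ι ℚ x * u) - ((ι ℚ x * u) ⊗ₜ 1 + 1 ⊗ₜ (ι ℚ x * u)) =
          (ι ℚ x ⊗ₜ 1 + 1 ⊗ₜ ι ℚ x) * (Δ u - (u ⊗ₜ 1 + 1 ⊗ₜ u)) +
            (ι ℚ x ⊗ₜ u + u ⊗ₜ ι ℚ x) := by
        rw [map_mul, hΔ]
        simp only [mul_sub, mul_add, add_mul, Algebra.TensorProduct.tmul_mul_tmul, one_mul,
          mul_one]
        abel
      have hx : ι ℚ x ∈ ιPow L (n + 1) := ιPow_mono (Nat.le_add_left 1 n) (ι_mem_ιPow x)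
      rw [e]
      refine add_mem ?_ (add_mem (tmul hx hu) (tmul hu hx))
      have hle : tensorSub (ιPow L n) (ιPow L n) ≤
          (tensorSub (ιPow L (n + 1)) (ιPow L (n + 1))).comap
            (LinearMap.mulLeft ℚ (ι ℚ x ⊗ₜ[ℚ] 1 + 1 ⊗ₜ[ℚ] ι ℚ x)) := by
        refine Submodule.map₂_le.2 fun a ha b hb => ?_
        change (ι ℚ x ⊗ₜ 1 + 1 ⊗ₜ ι ℚ x) * (a ⊗ₜ b) ∈ tensorSub (ιPow L (n + 1)) (ιPow L (n + 1))
        rw [add_mul, Algebra.TensorProduct.tmul_mul_tmul, Algebra.TensorProduct.tmul_mul_tmul,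
          one_mul, one_mul]
        exact add_mem (tmul (ι_mul_mem_ιPow x ha) (ιPow_mono (Nat.le_succ n) hb))
          (tmul (ιPow_mono (Nat.le_succ n) ha) (ι_mul_mem_ιPow x hb))
      exact hle h

/-- A family of linear maps on the enveloping algebra of `L` whose common kernel is a coideal is
jointly injective as soon as it is jointly injective on `ℚ ⊕ L`. -/
theorem eq_zero_of_forall_eq_zero (hΔ : ∀ x, Δ (ι ℚ x) = ι ℚ x ⊗ₜ 1 + 1 ⊗ₜ ι ℚ x)
    {I : Type*} {X : I → Type*} [∀ i, AddCommGroup (X i)] [∀ i, Module ℚ (X i)]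
    {p : ∀ i, UniversalEnvelopingAlgebra ℚ L →ₗ[ℚ] X i}
    (h1 : ∀ (q : ℚ) (x : L), (∀ i, p i (q • 1 + ι ℚ x) = 0) → q • 1 + ι ℚ x = 0)
    (h2 : ∀ u, (∀ i, p i u = 0) → ∀ i j, TensorProduct.map (p i) (p j) (Δ u) = 0)
    {u : UniversalEnvelopingAlgebra ℚ L} (hu : ∀ i, p i u = 0) : u = 0 := by
  have key : ∀ n, ∀ u ∈ ιPow L (n + 1), (∀ i, p i u = 0) → u = 0 := by
    intro n
    induction n with
    | zero =>
      intro u hu hpu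
      unfold ιPow at hu
      rw [zero_add, pow_one] at hu
      obtain ⟨b, hb, c, ⟨x, rfl⟩, rfl⟩ := Submodule.mem_sup.1 hu
      obtain ⟨q, rfl⟩ := Submodule.mem_one.1 hb
      rw [Algebra.algebraMap_eq_smul_one] at hpu ⊢
      exact h1 q x hpu
    | succ n ih =>
      intro u hu hpu
      -- `u` is primitive
      have h3 : Δ u - (u ⊗ₜ 1 + 1 ⊗ₜ u) = 0 := by
        refine TensorProduct.eq_zero_of_mem_tensorSub ih (comul_sub_mem_tensorSub hΔ hu) ?_
        intro i j
        rw [map_sub, map_add, TensorProduct.map_tmul, TensorProduct.map_tmul, hpu, hpu,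
          TensorProduct.zero_tmul, TensorProduct.tmul_zero, add_zero, h2 u hpu, _root_.sub_zero]
      -- so the convolution square of the identity multiplies `u` by `2`, and `2 ≠ 2 ^ (n + 2)`
      have h4 := mul_comul_sub_mem hΔ hu
      rw [sub_eq_zero.1 h3, map_add, LinearMap.mul'_apply, LinearMap.mul'_apply, mul_one, one_mul,
        ← two_smul ℚ u, ← sub_smul] at h4
      have h5 : (2 : ℚ) - 2 ^ (n + 1 + 1) ≠ 0 := by
        have : (1 : ℚ) < 2 ^ (n + 1) := one_lt_pow₀ (by norm_num) n.succ_ne_zero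
        rw [pow_succ]
        linarith
      exact ih u ((Submodule.smul_mem_iff _ h5).1 h4) hpu
  obtain ⟨n, hn⟩ := exists_mem_ιPow u
  exact key n u (ιPow_mono (Nat.le_succ n) hn) hu

end Comul

end UniversalEnvelopingAlgebra

/-! ### The comparison homomorphism is injective -/

namespace ExtendedNSeries

attribute [local instance 100] LieRing.ofAssociativeRing

variable {G : Type*} [Group G] (K : ExtendedNSeries G)

theorem grComp_zero_symbLin (v : K.GrLieQ) : K.fil.grComp 0 (K.symbLin v) = 0 := by
  induction v using K.clsQ_induction with
  | zero => rw [map_zero, map_zero]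
  | add x y hx hy => rw [map_add, map_add, hx, hy, add_zero]
  | smul q x hx => rw [map_smul, map_smul, hx, smul_zero]
  | cls m k => rw [symbLin_clsQ, K.fil.grComp_mono_of_ne m.pos.ne]

theorem grMk_zero_one_ne_zero : K.fil.grMk 0 ⟨1, K.fil.mem_zero 1⟩ ≠ 0 := by
  intro h
  have h1 := K.fil.counit_eq_zero 1 le_rfl 1 (K.fil.grMk_eq_zero.1 h)
  rw [Bialgebra.counit_one] at h1
  exact one_ne_zero h1

/-- The map `U(gr₊^ℚ(K)) → ∏ J_m / J_{m+1}` is injective: its kernel is a coideal which meets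
`ℚ ⊕ gr₊^ℚ(K)` trivially. -/
theorem compPos_injective : Function.Injective K.compPos := by
  rw [injective_iff_map_eq_zero]
  intro u hu
  refine UniversalEnvelopingAlgebra.eq_zero_of_forall_eq_zero (Δ := K.comulUPos) K.comulUPos_ι
    (X := fun n => K.fil.Gr n) (p := fun n => K.fil.grComp n ∘ₗ K.compPos.toLinearMap) ?_ ?_ (u := u) ?_
  · intro q v h
    have h' : ∀ n, q • K.fil.grComp n 1 + K.fil.grComp n (K.symbLin v) = 0 := by
      intro n
      have h1 : K.compPos (UniversalEnvelopingAlgebra.ι ℚ v) = K.symbLin v :=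
        UniversalEnvelopingAlgebra.lift_ι_apply ℚ K.symbLie v
      have := h n
      rw [LinearMap.comp_apply, AlgHom.toLinearMap_apply, map_add, map_smul, map_one, h1, map_add,
        map_smul] at this
      exact this
    have hq : q = 0 := by
      have h1 := h' 0
      rw [grComp_zero_symbLin, add_zero] at h1
      exact (smul_eq_zero.1 h1).resolve_right K.grMk_zero_one_ne_zero
    subst hq
    have hv : v = 0 := by
      refine K.eq_zero_of_symbLin_eq_zero fun m => ?_
      have h1 := h' m
      rwa [zero_smul, zero_add] at h1
    rw [hv, zero_smul, map_zero, add_zero]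
  · intro u hu i j
    have h1 : K.compPos u = 0 := K.fil.grHat_ext fun n => (hu n).trans (map_zero _).symm
    have h2 := K.grHatComul_comparison i j (K.uSingle 1 u)
    rw [comparison_uSingle, h1, zero_mul, map_zero, comulU_uSingle, ← LinearMap.comp_apply,
      ← TensorProduct.map_comp] at h2
    have h3 : ∀ i, K.compDeg i ∘ₗ K.uSingle 1 = K.fil.grComp i ∘ₗ K.compPos.toLinearMap := by
      intro i
      refine LinearMap.ext fun u => ?_
      change K.fil.grComp i (K.comparison (K.uSingle 1 u)) = K.fil.grComp i (K.compPos u)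
      rw [comparison_uSingle, map_one, mul_one]
    rw [h3, h3] at h2
    exact h2.symm
  · intro n
    change K.fil.grComp n (K.compPos u) = 0
    rw [hu, map_zero]

/-- The projection of `J_n / J_{n+1}` induced by the projection of `ℚ[K₀]` to the span of the coset
`c` of `K₁`. -/
def cosetGr (c : G ⧸ K.sub 1) (n : ℕ) : K.fil.Gr n →ₗ[ℚ] K.fil.Gr n :=
  Submodule.mapQ _ _
    ((K.cosetProj c).restrict (p := K.fil.J n) (q := K.fil.J n) fun _ ha => K.cosetProj_mem_J c ha)
    (by
      intro a ha
      change K.cosetProj c (a : MonoidAlgebra ℚ G) ∈ K.fil.J (n + 1)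
      exact K.cosetProj_mem_J c ha)

/-- The projection of `∏ J_m / J_{m+1}` induced by the projection of `ℚ[K₀]` to the span of the
coset `c` of `K₁`. -/
def cosetHat (c : G ⧸ K.sub 1) : K.fil.GrHat →ₗ[ℚ] K.fil.GrHat where
  toFun x := fun n => K.cosetGr c n (x n)
  map_add' x y := funext fun n => map_add (K.cosetGr c n) (x n) (y n)
  map_smul' q x := funext fun n => map_smul (K.cosetGr c n) q (x n)

theorem cosetHat_mono (c : G ⧸ K.sub 1) {n : ℕ} {a : MonoidAlgebra ℚ G} (ha : a ∈ K.fil.J n) :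
    K.cosetHat c (K.fil.mono n a ha) = K.fil.mono n (K.cosetProj c a) (K.cosetProj_mem_J c ha) := by
  refine K.fil.grHat_ext fun k => ?_
  change K.cosetGr c k (K.fil.grComp k (K.fil.mono n a ha)) = _
  by_cases hk : k = n
  · subst hk
    rw [K.fil.grComp_mono_self, K.fil.grComp_mono_self]
    rfl
  · rw [K.fil.grComp_mono_of_ne hk, K.fil.grComp_mono_of_ne hk, map_zero]

open Classical in
theorem cosetHat_comparison_uSingle (c g : G ⧸ K.sub 1) (u : K.UPos) :
    K.cosetHat c (K.comparison (K.uSingle g u)) =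
      if g = c then K.comparison (K.uSingle g u) else 0 := by
  obtain ⟨g, rfl⟩ := QuotientGroup.mk_surjective g
  induction u using K.clsProd_induction with
  | add u v hu hv =>
    rw [map_add, map_add, map_add, hu, hv]
    split_ifs
    · rfl
    · rw [add_zero]
  | smul q u hu =>
    rw [map_smul, map_smul, map_smul, hu]
    split_ifs
    · rfl
    · rw [smul_zero]
  | prod l =>
    rw [comparison_clsProd, cosetHat_mono]
    split_ifs with h
    · refine K.fil.mono_congr _ _ ?_
      rw [cosetProj_incProd_mul, if_pos h, sub_self]
      exact zero_mem _
    · refine K.fil.mono_eq_zero _ ?_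
      rw [cosetProj_incProd_mul, if_neg h]
      exact zero_mem _

theorem cosetHat_comparison (c : G ⧸ K.sub 1) (x : K.U) :
    K.cosetHat c (K.comparison x) = K.comparison (K.uSingle c (x.coeff c)) := by
  classical
  induction x using SkewMonoidAlgebra.induction_on with
  | zero => simp
  | add u v hu hv => rw [map_add, map_add, hu, hv, SkewMonoidAlgebra.coeff_add, Finsupp.add_apply, map_add, map_add]
  | single g u =>
    change K.cosetHat c (K.comparison (K.uSingle g u)) = _
    rw [cosetHat_comparison_uSingle, SkewMonoidAlgebra.coeff_single_apply]
    split_ifs with h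
    · rw [h]
    · rw [map_zero, map_zero]

/-- The comparison homomorphism is injective. -/
theorem comparison_injective : Function.Injective K.comparison := by
  rw [injective_iff_map_eq_zero]
  intro x hx
  have h1 : ∀ c, x.coeff c = 0 := by
    intro c
    have h2 := K.cosetHat_comparison c x
    rw [hx, map_zero, comparison_uSingle] at h2
    refine K.compPos_injective ?_
    have h3 := congrArg (· * K.compGrp c⁻¹) h2.symm
    rwa [mul_assoc, ← map_mul, mul_inv_cancel, map_one, mul_one, zero_mul,
      ← map_zero K.compPos] at h3
  rw [K.uDeg_eq_sum (x := x), Finsupp.sum]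
  exact Finset.sum_eq_zero fun g _ => by rw [h1, map_zero]

/-! ### From formality to expansions -/

theorem grComp_comparison_injective {n : ℕ} {x y : K.U} (hx : x ∈ K.uDeg n) (hy : y ∈ K.uDeg n)
    (h : K.fil.grComp n (K.comparison x) = K.fil.grComp n (K.comparison y)) : x = y := by
  apply K.comparison_injective
  rw [← sub_eq_zero, ← map_sub]
  refine HopfFiltration.eq_zero_of_homog (K.comparison_mem_homog (sub_mem hx hy)) ?_
  rw [map_sub, map_sub, h, sub_self]

theorem compHat_injective : Function.Injective K.compHat := by
  intro x y h
  apply Subtype.ext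
  refine PowerSeries.ext fun n => ?_
  refine K.grComp_comparison_injective (K.comp_mem x n) (K.comp_mem y n) ?_
  have := congrArg (K.fil.grComp n) h
  rwa [grComp_compHat, grComp_compHat] at this

theorem compHat_surjective : Function.Surjective K.compHat := by
  intro y
  have h : ∀ n, ∃ x ∈ K.uDeg n, K.fil.grComp n (K.comparison x) = K.fil.grComp n y := by
    intro n
    obtain ⟨⟨a, ha⟩, h⟩ := Submodule.mkQ_surjective _ (K.fil.grComp n y)
    obtain ⟨x, hx, hxa⟩ := K.exists_comparison_eq n a ha
    refine ⟨x, hx, ?_⟩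
    rw [hxa, K.fil.grComp_mono_self]
    exact h
  choose x hx hxy using h
  have hmem : ∀ n, PowerSeries.coeff n (PowerSeries.mk x) ∈ K.uDeg n := fun n => by
    rw [PowerSeries.coeff_mk]
    exact hx n
  refine ⟨⟨PowerSeries.mk x, hmem⟩, K.fil.grHat_ext fun n => ?_⟩
  rw [grComp_compHat, ← hxy n]
  congr 2
  exact PowerSeries.coeff_mk n x

/-- The completed universal enveloping algebra is the degree-completion of the associated graded of
the group algebra. -/
def compHatEquiv : K.UHat ≃ₐ[ℚ] K.fil.GrHat :=
  AlgEquiv.ofBijective K.compHat ⟨K.compHat_injective, K.compHat_surjective⟩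

theorem compHat_symm (y : K.fil.GrHat) : K.compHat (K.compHatEquiv.symm y) = y :=
  K.compHatEquiv.apply_symm_apply y

/-- The homomorphism `K₀ → Û(gr_•^ℚ(K))` attached to `Φ : ℚ[K₀] → ∏ J_m / J_{m+1}`. -/
def homExp (Φ : MonoidAlgebra ℚ G →ₐ[ℚ] K.fil.GrHat) : G →* K.UHat :=
  ((K.compHatEquiv.symm : K.fil.GrHat →ₐ[ℚ] K.UHat) : K.fil.GrHat →* K.UHat).comp
    ((Φ : MonoidAlgebra ℚ G →* K.fil.GrHat).comp (MonoidAlgebra.of ℚ G))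

theorem grComp_comparison_homExp (Φ : MonoidAlgebra ℚ G →ₐ[ℚ] K.fil.GrHat) (g : G) (n : ℕ) :
    K.fil.grComp n (K.comparison (K.comp (K.homExp Φ g) n)) =
      K.fil.grComp n (Φ (MonoidAlgebra.of ℚ G g)) := by
  rw [← grComp_compHat]
  exact congrArg (K.fil.grComp n) (K.compHat_symm _)

/-- The identity `Δ(x) = x ⊗ x` can be tested after applying the comparison homomorphism to both
factors, because the latter is injective. -/
theorem isGroupLikeHat_homExp {Φ : MonoidAlgebra ℚ G →ₐ[ℚ] K.fil.GrHat}
    (h1 : K.fil.ComulCompat Φ) (h2 : K.fil.CounitCompat Φ) (g : G) :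
    K.IsGroupLikeHat (K.homExp Φ g) := by
  refine ⟨fun n => ?_, ?_⟩
  · rw [← sub_eq_zero]
    refine TensorProduct.eq_zero_of_forall_map (X := fun n => K.fil.Gr n) (p := K.compDeg) ?_ ?_
    · intro x hx
      apply K.comparison_injective
      rw [map_zero]
      exact K.fil.grHat_ext fun n => (hx n).trans (map_zero _).symm
    · intro i j
      rw [map_sub, map_compDeg_sum, ← grHatComul_comparison, sub_eq_zero]
      split_ifs with hij
      · subst hij
        have h3 := h1 i j (MonoidAlgebra.of ℚ G g)
        rw [comul_of, TensorProduct.map_tmul] at h3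
        simp only [LinearMap.comp_apply, AlgHom.toLinearMap_apply] at h3
        rw [compDeg_apply, compDeg_apply, grComp_comparison_homExp, grComp_comparison_homExp, h3]
        exact congrArg (K.fil.grComul i j) (K.grComp_comparison_homExp Φ g (i + j))
      · change K.fil.grComul i j (K.fil.grComp (i + j) _) = 0
        rw [HopfFiltration.grComp_eq_zero_of_homog
          (K.comparison_mem_homog (K.comp_mem _ n)) hij, map_zero]
  · rw [← grHatCounit_comparison]
    have h3 := h2 (MonoidAlgebra.of ℚ G g)
    have h4 : Coalgebra.counit (R := ℚ) (MonoidAlgebra.of ℚ G g) = 1 := by simp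
    rw [h4] at h3
    rw [← h3]
    unfold HopfFiltration.grHatCounit
    rw [LinearMap.comp_apply, LinearMap.comp_apply, grComp_comparison_homExp]

theorem isExpansion_homExp {Φ : MonoidAlgebra ℚ G →ₐ[ℚ] K.fil.GrHat}
    (h0 : K.fil.LeadingTermId Φ) (h1 : K.fil.ComulCompat Φ) (h2 : K.fil.CounitCompat Φ) :
    K.IsExpansion (K.homExp Φ) := by
  have hzero : ∀ g : G, K.comp (K.homExp Φ g) 0 = K.uSingle (QuotientGroup.mk g) 1 := by
    intro g
    refine K.grComp_comparison_injective (K.comp_mem _ 0)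
      (K.uSingle_mem_uDeg _ (K.clsProd_mem [])) ?_
    rw [grComp_comparison_homExp, comparison_uSingle, map_one, one_mul]
    exact HopfFiltration.LeadingTermId.grComp_eq h0 (K.fil.mem_zero _)
  have hpos : ∀ (i : ℕ+) (k : K.sub i) (j : ℕ), j ≠ 0 →
      K.fil.grComp j (K.comparison (K.comp (K.homExp Φ (k : G)) j)) =
        K.fil.grComp j (Φ (inc (k : G))) := by
    intro i k j hj
    have h3 : K.fil.grComp j 1 = 0 := K.fil.grComp_mono_of_ne hj 1 (K.fil.mem_zero 1)
    rw [grComp_comparison_homExp, inc, map_sub, map_one, map_sub, h3, _root_.sub_zero]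
  refine ⟨K.isGroupLikeHat_homExp h1 h2, hzero, fun i k => ⟨?_, fun j hj hji => ?_, ?_⟩⟩
  · rw [hzero, (QuotientGroup.eq_one_iff (k : G)).2 (K.sub_le_one i k.2)]
    rfl
  · refine K.grComp_comparison_injective (K.comp_mem _ j) (zero_mem _) ?_
    rw [hpos i k j hj.ne', map_zero, map_zero]
    exact HopfFiltration.LeadingTermId.map_mem h0 (K.inc_mem_J k.2) j hji
  · have h4 : UniversalEnvelopingAlgebra.ι ℚ (K.clsQ i k) ∈ K.uPosDeg i := by
      have := K.clsProd_mem [⟨i, k⟩]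
      simpa [clsProd, wt] using this
    refine K.grComp_comparison_injective (K.comp_mem _ i) (K.uSingle_mem_uDeg _ h4) ?_
    rw [hpos i k i i.pos.ne', comparison_uSingle_ι, K.fil.grComp_mono_self]
    exact HopfFiltration.LeadingTermId.grComp_eq h0 (K.inc_mem_J k.2)

end ExtendedNSeries

end

theorem proposition11p2 {G : Type*} [Group G] (K : ExtendedNSeries G) :
    K.IsFormal ↔ ∃ θ : G →* K.UHat, K.IsExpansion θ := by
  constructor
  · intro h
    obtain ⟨Φ, h0, h1, h2⟩ := HopfFiltration.IsFormal.exists_algHom h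
    exact ⟨K.homExp Φ, K.isExpansion_homExp h0 h1 h2⟩
  · rintro ⟨θ, hθ⟩
    exact hθ.isFormal
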